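/- **Conventions.** Fix a vocabulary and a class $K$ of models of it with a binary relation $\preceq$ on $K$; $M\prec N$ means $M\preceq N$, $M\ne N$; $K_\mu$ is the class of models in $K$ of cardinality $\mu$. A sequence $\langle M_i\rangle$ is *increasing* if $M_i\preceq M_j$ for $i<j$, and *continuous* if $M_\delta=\bigcup_{i<\delta}M_i$ for every limit $\delta$ in its domain. An *embedding* $f:M\to N$ is an isomorphism of $M$ onto some $f[M]\preceq N$; a map is *over* $A$ if it is the identity on $A$. $(K,\preceq)$ is an *abstract elementary class* (a.e.c.) if: $K$ and $\preceq$ are closed under isomorphisms; $\preceq$ is a partial order contained in the submodel relation; if $\langle M_i:i<\delta\rangle$ ($\delta$ limit) is increasing continuous, then $M_0\preceq\bigcup_i M_i\in K$, and if moreover $M_i\preceq N$ for all $i$, then $\bigcup_iM_i\preceq N$; if $M_0\subseteq M_1\subseteq M_2$, $M_0\preceq M_2$ and $M_1\preceq M_2$, then $M_0\preceq M_1$; and there is a first cardinal $\kappa=\mathrm{LST}(K,\preceq)$ such that for all $N\in K$ and $A\subseteq N$ there is $M\in K$ with $A\subseteq M\preceq N$ and $|M|\le\kappa+|A|$. For $M\preceq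 N$, $a\in N$, the *type* $tp(a,M,N)$ is the class of $(M,N,a)$ under the equivalence relation generated by: $(M,N_0,a_0)E^*(M,N_1,a_1)$ iff there are $N_2\in K$ with $N_1\preceq N_2$ and an embedding $f:N_0\to N_2$ over $M$ with $f(a_0)=a_1$. $S(M)$ is the set of types over $M$, and $tp(a,M_1,N)\restriction M_0=tp(a,M_0,N)$ for $M_0\preceq M_1$. Let $\lambda$ be an infinite cardinal. $\mathfrak s=(K,\preceq,S^{bs},\mathrm{nf})$ is a *semi-good $\lambda$-frame* if: (1) $(K,\preceq)$ is an a.e.c. with $\mathrm{LST}(K,\preceq)\le\lambda$, and $(K_\lambda,\preceq)$ has joint embedding, amalgamation and no maximal model. (2) $S^{bs}$ assigns to each $M\in K_\lambda$ a set $S^{bs}(M)$ (the basic types) of types $tp(a,M,N)$ with $M\prec N\in K_\lambda$, $a\in N-M$; it respects isomorphisms; if $M\prec N$ are in $K_\lambda$, then $tp(a,M,N)\in S^{bs}(M)$ for some $a\in N-M$; and $|S^{bs}(M)|\le\lambda^+$. (3) $\mathrm{nf}$ is a relation, closed under isomorphisms, on quadruples $(M_0,M_1,a,M_3)$ with $M_0\preceq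 M_1\preceq M_3$ in $K$, $M_0,M_1\in K_\lambda$, $a\in M_3-M_1$, and $tp(a,M_n,M_3)\in S^{bs}(M_n)$ for $n<2$. A type $p$ over $M_1$ *does not fork over* $M_0$ if $p=tp(a,M_1,M_3)$ and $\mathrm{nf}(M_0,M_1,a,M_3)$ for some $a,M_3$. One has: * *Monotonicity*: if $M_0\preceq M_0^*\preceq M_1^*\preceq M_1\preceq M_3\preceq M_3^*$, $M_1^*\cup\{a\}\subseteq M_3^{**}\preceq M_3^*$ and $\mathrm{nf}(M_0,M_1,a,M_3)$, then $\mathrm{nf}(M_0^*,M_1^*,a,M_3^{**})$. * *Local character*: if $\delta<\lambda^+$ is a limit and $\langle M_i:i\le\delta\rangle$ is increasing continuous in $K_\lambda$, then every $p\in S^{bs}(M_\delta)$ does not fork over $M_i$ for some $i<\delta$. * *Uniqueness*: if $M\preceq N$ are in $K_\lambda$, $p,q\in S^{bs}(N)$ do not fork over $M$ and $p\restriction M=q\restriction M$, then $p=q$. * *Symmetry*: if $M_0\preceq M_1\preceq M_3$ are in $K_\lambda$, $a_1\in M_1$, $tp(a_1,M_0,M_3)\in S^{bs}(M_0)$ and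 $tp(a_2,M_1,M_3)$ does not fork over $M_0$, then there are $M_2,M_3^*$ with $a_2\in M_2$, $M_0\preceq M_2\preceq M_3^*$, $M_3\preceq M_3^*$ such that $tp(a_1,M_2,M_3^*)$ does not fork over $M_0$. * *Extension*: if $M\prec N$ are in $K_\lambda$ and $p\in S^{bs}(M)$, some $q\in S^{bs}(N)$ does not fork over $M$ and has $q\restriction M=p$. * *Continuity*: if $\delta<\lambda^+$ is a limit, $\langle M_i:i\le\delta\rangle$ is increasing continuous in $K_\lambda$, $p\in S(M_\delta)$, and $p\restriction M_i$ does not fork over $M_0$ for all $i<\delta$, then $p\in S^{bs}(M_\delta)$ and $p$ does not fork over $M_0$. Types $p_0\in S(M_0)$, $p_1\in S(M_1)$ *conjugate* if $p_n=tp(a_n,M_n,M_n^+)$ ($n=0,1$) for some $a_n,M_n^+$ such that there is an isomorphism $f:M_0^+\to M_1^+$ with $f[M_0]=M_1$, $f(a_0)=a_1$. $\mathfrak s$ *has conjugation* if all models in $K_\lambda$ are isomorphic and, whenever $M_1\preceq M_2$ are in $K_\lambda$ and $p_2\in S^{bs}(M_2)$ is a non-forking extension of $p_1\in S^{bs}(M_1)$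 (that is, $p_2$ does not fork over $M_1$ and $p_2\restriction M_1=p_1$), $p_1$ and $p_2$ conjugate. $K^{3,bs}$ is the class of $(M,N,a)$ with $M\preceq N$ in $K_\lambda$, $a\in N-M$, $tp(a,M,N)\in S^{bs}(M)$; $(M,N,a)\preceq_{bs}(M^*,N^*,a)$ means that both are in $K^{3,bs}$, $M\preceq M^*$, $N\preceq N^*$ and $tp(a,M^*,N^*)$ does not fork over $M$. $(M,N,a)\in K^{3,bs}$ is a *uniqueness triple* if, whenever $(M,N,a)\preceq_{bs}(M_n,N_n,a)$ for $n=1,2$ and $f:M_1\to M_2$ is an isomorphism over $M$, there are $N^*\in K_\lambda$ and embeddings $f_n:N_n\to N^*$ over $N$ with $f_1\restriction M_1=f_2\circ f$. $\mathfrak s$ is *weakly successful* if for every $(M,N,a)\in K^{3,bs}$ there is a uniqueness triple $(M,N',a')$ with $tp(a',M,N')=tp(a,M,N)$. $NF^*(N_0,N_1,N_2,N_3)$ holds if $N_0\preceq N_n\preceq N_3$ for $n=1,2$ and there are $\alpha<\lambda^+$, increasing continuous $\langle N_{l,i}:i\le\alpha\rangle$ in $K_\lambda$ ($l=1,2$)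 and $\langle d_i:i<\alpha\rangle$ with $N_{1,0}=N_0$, $N_{1,\alpha}=N_1$, $N_{2,0}=N_2$, $N_{2,\alpha}=N_3$, $N_{1,i}\preceq N_{2,i}$, each $(N_{1,i},N_{1,i+1},d_i)$ a uniqueness triple, and $tp(d_i,N_{2,i},N_{2,i+1})$ not forking over $N_{1,i}$. $NF(M_0,M_1,M_2,M_3)$ holds for $M_0,\dots,M_3\in K_\lambda$ if $M_0\preceq M_n\preceq M_3$ for $n=1,2$ and there are $N_l\succeq M_l$ ($l=1,2,3$) with $NF^*(M_0,N_1,N_2,N_3)$. $\widehat{NF}(N_0,N_1,M_0,M_1)$ holds if $N_0,N_1\in K_\lambda$, $M_0,M_1\in K_{\lambda^+}$ and there are increasing continuous $\langle N_{n,\alpha}:\alpha<\lambda^+\rangle$ ($n<2$) with $N_{n,0}=N_n$, $\bigcup_\alpha N_{n,\alpha}=M_n$ and $NF(N_{0,\alpha},N_{1,\alpha},N_{0,\alpha+1},N_{1,\alpha+1})$ for all $\alpha$. For $M_0,M_1\in K_{\lambda^+}$, $M_0\prec^+M_1$ holds if there are increasing continuous sequences $\langle N_{0,\alpha}:\alpha<\lambda^+\rangle$,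 $\langle N_{1,\alpha}:\alpha<\lambda^+\rangle$, an increasing (not necessarily continuous) sequence $\langle N^\oplus_{1,\alpha}:\alpha<\lambda^+\rangle$ and a club $E\subseteq\lambda^+$ such that (i) $M_n=\bigcup_\alpha N_{n,\alpha}$ for $n=0,1$; (ii) $N_{0,\alpha}\preceq N_{1,\alpha}\preceq N^\oplus_{1,\alpha}$ for $\alpha\in E$; (iii) $NF(N_{0,\alpha},N^\oplus_{1,\alpha},N_{0,\beta},N_{1,\beta})$ for $\alpha<\beta$ in $E$; (iv) for all $\alpha\in E$ and $p\in S^{bs}(N_{1,\alpha})$ there is $\gamma<\lambda^+$ such that for every $\beta\in E$ with $\beta\ge\gamma$ the non-forking extension of $p$ to $N_{1,\beta}$ is realized in $N^\oplus_{1,\beta}$, i.e. it equals $tp(b,N_{1,\beta},N^\oplus_{1,\beta})$ for some $b\in N^\oplus_{1,\beta}$. **Theorem.** Let $\lambda$ be an infinite cardinal and $\mathfrak s$ a weakly successful semi-good $\lambda$-frame with conjugation. Suppose $M_0\prec^+M_1$ and $M_0\prec^+M_2$. Then: (a) $M_1$ and $M_2$ are isomorphic over $M_0$. (b) For all $a_1\in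 M_1$, $a_2\in M_2$: if $tp(a_1,N,M_1)=tp(a_2,N,M_2)$ for every $N\in K_\lambda$ with $N\preceq M_0$, then there is an isomorphism $f:M_1\to M_2$ over $M_0$ with $f(a_1)=a_2$. (c) For all $N_0,N^*\in K_\lambda$ with $N_0\preceq N^*$: if $\widehat{NF}(N_0,N^*,M_0,M_1)$ and $\widehat{NF}(N_0,N^*,M_0,M_2)$, then there is an isomorphism $f:M_1\to M_2$ over $M_0\cup N^*$. -/

import Mathlib

open scoped Cardinal

universe u

namespace SemiGood

/-! ### Models of a fixed vocabulary, and maps between them -/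

/-- A model of the vocabulary `L`: a set (a small class of sets) carrying an `L`-structure.
All elements of all models live in one universe of sets, so that inclusions, unions and
intersections of models are literal. -/
structure Model (L : FirstOrder.Language.{u, u}) : Type (u + 1) where
  carrier : Set ZFSet.{u}
  small : Small.{u} carrier
  str : L.Structure carrier

instance {L : FirstOrder.Language.{u, u}} (M : Model L) : L.Structure M.carrier := M.str

variable {L : FirstOrder.Language.{u, u}}

/-- Embeddings of structures. -/
abbrev Emb (M N : Model L) : Type (u + 1) := L.Embedding M.carrier N.carrier

/-- Isomorphisms of structures. -/
abbrev Iso (M N : Model L) : Type (u + 1) := L.Equiv M.carrier N.carrier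

/-- `M` is a submodel (substructure) of `N`. -/
def IsSub (M N : Model L) : Prop :=
  ∃ f : Emb M N, ∀ x : M.carrier, (f x : ZFSet.{u}) = x

/-- The map `f` is over `A`, i.e. it fixes every element of `A`. -/
def Over {M N : Model L} (f : M.carrier → N.carrier) (A : Set ZFSet.{u}) : Prop :=
  ∀ x : M.carrier, (x : ZFSet.{u}) ∈ A → (f x : ZFSet.{u}) = x

/-- The image of the set `A` under `f`. -/
def img {M N : Model L} (f : M.carrier → N.carrier) (A : Set ZFSet.{u}) : Set ZFSet.{u} :=
  {y | ∃ x : M.carrier, (x : ZFSet.{u}) ∈ A ∧ (f x : ZFSet.{u}) = y}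

/-- `f` maps `a` to `b` (used for elements `a` of the domain of `f`). -/
def Sends {M N : Model L} (f : M.carrier → N.carrier) (a b : ZFSet.{u}) : Prop :=
  ∀ x : M.carrier, (x : ZFSet.{u}) = a → (f x : ZFSet.{u}) = b

/-- The cardinality of the model `M` is `κ`. -/
def HasCard (M : Model L) (κ : Cardinal.{u}) : Prop :=
  #M.carrier = Cardinal.lift.{u + 1} κ

/-! ### Abstract elementary classes -/

/-- A class of models with a binary relation on it (data only). -/
structure OrderedClass (L : FirstOrder.Language.{u, u}) : Type (u + 1) where
  /-- the class `K` -/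
  K : Set (Model L)
  /-- the relation `⪯` -/
  le : Model L → Model L → Prop

namespace OrderedClass

variable (k : OrderedClass L)

/-- `M ≺ N`. -/
def lt (M N : Model L) : Prop := k.le M N ∧ M ≠ N

/-- The class of models in `K` of cardinality `κ`. -/
def KC (κ : Cardinal.{u}) : Set (Model L) := {M | M ∈ k.K ∧ HasCard M κ}

/-- `f` is a `⪯`-embedding: its image, as a submodel of `N`, is `⪯ N`. -/
def IsStrong {M N : Model L} (f : Emb M N) : Prop :=
  ∃ N' : Model L, k.le N' N ∧ N'.carrier = img f M.carrier

/-- The sequence `⟨c i : i < θ⟩` is `⪯`-increasing. -/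
def Increasing (c : Ordinal.{u} → Model L) (θ : Ordinal.{u}) : Prop :=
  ∀ i j, i < j → j < θ → k.le (c i) (c j)

/-- The sequence `⟨c i : i < θ⟩` is `⪯`-increasing and continuous. -/
def IncCont (c : Ordinal.{u} → Model L) (θ : Ordinal.{u}) : Prop :=
  k.Increasing c θ ∧
    ∀ δ, Order.IsSuccLimit δ → δ < θ → (c δ).carrier = ⋃ i ∈ Set.Iio δ, (c i).carrier

end OrderedClass

/-- `M` is the union, as a structure, of the models `c i` for `i < θ`. -/
def IsUnion (M : Model L) (c : Ordinal.{u} → Model L) (θ : Ordinal.{u}) : Prop :=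
  (∀ i < θ, IsSub (c i) M) ∧ M.carrier = ⋃ i ∈ Set.Iio θ, (c i).carrier

namespace OrderedClass

variable (k : OrderedClass L)

/-- The Löwenheim–Skolem–Tarski property for the cardinal `κ`. -/
def HasLST (κ : Cardinal.{u}) : Prop :=
  ∀ N ∈ k.K, ∀ A : Set ZFSet.{u}, A ⊆ N.carrier →
    ∃ M ∈ k.K, A ⊆ M.carrier ∧ k.le M N ∧ #M.carrier ≤ Cardinal.lift.{u + 1} κ + #A

/-- The Löwenheim–Skolem–Tarski number: the first cardinal with the above property. -/
noncomputable def LST : Cardinal.{u} := sInf {κ | k.HasLST κ}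

/-- `(K, ⪯)` is an abstract elementary class. -/
structure IsAEC : Prop where
  mem_iso : ∀ M N : Model L, M ∈ k.K → Nonempty (Iso M N) → N ∈ k.K
  le_iso : ∀ (M₀ M₁ N₀ N₁ : Model L) (f : Iso M₁ N₁), k.le M₀ M₁ → IsSub N₀ N₁ →
    N₀.carrier = img f M₀.carrier → k.le N₀ N₁
  mem_of_le : ∀ M N, k.le M N → M ∈ k.K ∧ N ∈ k.K
  refl : ∀ M ∈ k.K, k.le M M
  trans : ∀ M N P, k.le M N → k.le N P → k.le M P
  antisymm : ∀ M N, k.le M N → k.le N M → M = N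
  sub_of_le : ∀ M N, k.le M N → IsSub M N
  union : ∀ (δ : Ordinal.{u}) (c : Ordinal.{u} → Model L) (M : Model L),
    Order.IsSuccLimit δ → k.IncCont c δ → IsUnion M c δ → M ∈ k.K ∧ k.le (c 0) M
  smooth : ∀ (δ : Ordinal.{u}) (c : Ordinal.{u} → Model L) (M N : Model L),
    Order.IsSuccLimit δ → k.IncCont c δ → IsUnion M c δ → (∀ i < δ, k.le (c i) N) → k.le M N
  coherence : ∀ M₀ M₁ M₂, IsSub M₀ M₁ → IsSub M₁ M₂ → k.le M₀ M₂ → k.le M₁ M₂ → k.le M₀ M₁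
  lst : ∃ κ, k.HasLST κ

/-- Joint embedding in cardinality `κ`. -/
def JointEmbedding (κ : Cardinal.{u}) : Prop :=
  ∀ M₁ ∈ k.KC κ, ∀ M₂ ∈ k.KC κ, ∃ M₃ ∈ k.KC κ, ∃ (f₁ : Emb M₁ M₃) (f₂ : Emb M₂ M₃),
    k.IsStrong f₁ ∧ k.IsStrong f₂

/-- Amalgamation in cardinality `κ`. -/
def Amalgamation (κ : Cardinal.{u}) : Prop :=
  ∀ M₀ ∈ k.KC κ, ∀ M₁ ∈ k.KC κ, ∀ M₂ ∈ k.KC κ, k.le M₀ M₁ → k.le M₀ M₂ →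
    ∃ M₃ ∈ k.KC κ, ∃ (f₁ : Emb M₁ M₃) (f₂ : Emb M₂ M₃),
      k.IsStrong f₁ ∧ k.IsStrong f₂ ∧ Over f₁ M₀.carrier ∧ Over f₂ M₀.carrier

/-- All models in `K` of cardinality `κ` are isomorphic. -/
def Categorical (κ : Cardinal.{u}) : Prop :=
  ∀ M ∈ k.KC κ, ∀ N ∈ k.KC κ, Nonempty (Iso M N)

end OrderedClass

/-! ### Types -/

/-- A triple `(M, N, a)` of a base model, an extension of it, and an element. -/
structure Triple (L : FirstOrder.Language.{u, u}) : Type (u + 1) where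
  base : Model L
  top : Model L
  elt : ZFSet.{u}

namespace OrderedClass

variable (k : OrderedClass L)

/-- The class of triples `(M, N, a)` with `M ⪯ N` and `a ∈ N`. -/
def K3 : Set (Triple L) := {t | k.le t.base t.top ∧ t.elt ∈ t.top.carrier}

/-- The relation `E*`: the two triples have the same base, and over it the top of the first one
embeds into an extension of the top of the second one, sending element to element. -/
def EStar (t₀ t₁ : Triple L) : Prop :=
  t₀ ∈ k.K3 ∧ t₁ ∈ k.K3 ∧ t₁.base = t₀.base ∧
    ∃ N₂ : Model L, k.le t₁.top N₂ ∧ ∃ f : Emb t₀.top N₂,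
      k.IsStrong f ∧ Over f t₀.base.carrier ∧ Sends f t₀.elt t₁.elt

/-- The type of `a` in `N` over `M`: the class of `(M, N, a)` under the equivalence relation
generated by `E*`. -/
def tp (a : ZFSet.{u}) (M N : Model L) : Set (Triple L) :=
  {t | Relation.EqvGen k.EStar ⟨M, N, a⟩ t}

/-- The set `S(M)` of all types over `M`. -/
def S (M : Model L) : Set (Set (Triple L)) :=
  {p | ∃ (N : Model L) (a : ZFSet.{u}), k.le M N ∧ a ∈ N.carrier ∧ p = k.tp a M N}

/-- The set of non-algebraic types over `M` (a model of cardinality `κ`). -/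
def Sna (κ : Cardinal.{u}) (M : Model L) : Set (Set (Triple L)) :=
  {p | ∃ (N : Model L) (a : ZFSet.{u}), k.lt M N ∧ N ∈ k.KC κ ∧
    a ∈ N.carrier ∧ a ∉ M.carrier ∧ p = k.tp a M N}

/-- The restriction `p ↾ M₀`: for `p = tp(a, M₁, N)` this is `tp(a, M₀, N)`, for any choice of a
representative of `p`. -/
def restr (p : Set (Triple L)) (M₀ : Model L) : Set (Triple L) :=
  {t | ∃ s ∈ p, t ∈ k.tp s.elt M₀ s.top}

/-- Conjugate types `p₀ ∈ S(M₀)`, `p₁ ∈ S(M₁)`. -/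
def Conjugate (p₀ : Set (Triple L)) (M₀ : Model L) (p₁ : Set (Triple L)) (M₁ : Model L) : Prop :=
  ∃ (N₀ N₁ : Model L) (a₀ a₁ : ZFSet.{u}),
    k.le M₀ N₀ ∧ a₀ ∈ N₀.carrier ∧ k.tp a₀ M₀ N₀ = p₀ ∧
    k.le M₁ N₁ ∧ a₁ ∈ N₁.carrier ∧ k.tp a₁ M₁ N₁ = p₁ ∧
    ∃ f : Iso N₀ N₁, img f M₀.carrier = M₁.carrier ∧ Sends f a₀ a₁

end OrderedClass

/-! ### Semi-good frames -/

/-- The data `(K, ⪯, S^bs, nf)` of a frame; `nf M₀ M₁ a M₃` is the non-forking relation. -/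
structure PreFrame (L : FirstOrder.Language.{u, u}) : Type (u + 1) extends OrderedClass L where
  Sbs : Model L → Set (Set (Triple L))
  nf : Model L → Model L → ZFSet.{u} → Model L → Prop

namespace PreFrame

variable (s : PreFrame L)

/-- The type `p ∈ S(M₁)` does not fork over `M₀`. -/
def DNF (p : Set (Triple L)) (M₀ M₁ : Model L) : Prop :=
  ∃ (N : Model L) (a : ZFSet.{u}), p = s.tp a M₁ N ∧ s.nf M₀ M₁ a N

/-- `s` is a semi-good `κ`-frame. -/
structure IsSemiGood (κ : Cardinal.{u}) : Prop where
  aec : s.IsAEC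
  lst_le : s.LST ≤ κ
  joint_embedding : s.JointEmbedding κ
  amalgamation : s.Amalgamation κ
  no_max : ∀ M ∈ s.KC κ, ∃ N ∈ s.KC κ, s.lt M N
  /- basic types -/
  bs_na : ∀ M ∈ s.KC κ, s.Sbs M ⊆ s.Sna κ M
  bs_iso : ∀ (M N M' N' : Model L) (f : Iso N N') (a : N.carrier),
    M ∈ s.KC κ → s.le M N → s.le M' N' → M'.carrier = img f M.carrier →
    s.tp a M N ∈ s.Sbs M → s.tp (f a) M' N' ∈ s.Sbs M'
  density : ∀ M ∈ s.KC κ, ∀ N ∈ s.KC κ, s.lt M N →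
    ∃ a ∈ N.carrier, a ∉ M.carrier ∧ s.tp a M N ∈ s.Sbs M
  weak_stability : ∀ M ∈ s.KC κ, #(s.Sbs M) ≤ Cardinal.lift.{u + 1} (Order.succ κ)
  /- non-forking -/
  nf_basic : ∀ M₀ M₁ a M₃, s.nf M₀ M₁ a M₃ →
    M₀ ∈ s.KC κ ∧ M₁ ∈ s.KC κ ∧ M₃ ∈ s.K ∧ s.le M₀ M₁ ∧ s.le M₁ M₃ ∧
    a ∈ M₃.carrier ∧ a ∉ M₁.carrier ∧ s.tp a M₀ M₃ ∈ s.Sbs M₀ ∧ s.tp a M₁ M₃ ∈ s.Sbs M₁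
  nf_iso : ∀ (M₀ M₁ M₃ M₀' M₁' M₃' : Model L) (f : Iso M₃ M₃') (a : M₃.carrier),
    s.nf M₀ M₁ a M₃ → IsSub M₀' M₃' → IsSub M₁' M₃' →
    M₀'.carrier = img f M₀.carrier → M₁'.carrier = img f M₁.carrier →
    s.nf M₀' M₁' (f a) M₃'
  nf_mono : ∀ M₀ M₀' M₁' M₁ M₃ M₃' M₃'' a,
    s.le M₀ M₀' → s.le M₀' M₁' → s.le M₁' M₁ → s.le M₁ M₃ → s.le M₃ M₃' →
    M₁'.carrier ∪ {a} ⊆ M₃''.carrier → s.le M₃'' M₃' →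
    s.nf M₀ M₁ a M₃ → s.nf M₀' M₁' a M₃''
  local_character : ∀ (δ : Ordinal.{u}) (c : Ordinal.{u} → Model L),
    Order.IsSuccLimit δ → δ < (Order.succ κ).ord → s.IncCont c (Order.succ δ) →
    (∀ i ≤ δ, c i ∈ s.KC κ) → ∀ p ∈ s.Sbs (c δ), ∃ i < δ, s.DNF p (c i) (c δ)
  uniqueness : ∀ M ∈ s.KC κ, ∀ N ∈ s.KC κ, s.le M N → ∀ p ∈ s.Sbs N, ∀ q ∈ s.Sbs N,
    s.DNF p M N → s.DNF q M N → s.restr p M = s.restr q M → p = q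
  symmetry : ∀ M₀ ∈ s.KC κ, ∀ M₁ ∈ s.KC κ, ∀ M₃ ∈ s.KC κ, ∀ a₁ a₂,
    s.le M₀ M₁ → s.le M₁ M₃ → a₁ ∈ M₁.carrier → s.tp a₁ M₀ M₃ ∈ s.Sbs M₀ →
    s.nf M₀ M₁ a₂ M₃ →
    ∃ M₂ M₃', a₂ ∈ M₂.carrier ∧ s.le M₀ M₂ ∧ s.le M₂ M₃' ∧ s.le M₃ M₃' ∧ s.nf M₀ M₂ a₁ M₃'
  extension : ∀ M ∈ s.KC κ, ∀ N ∈ s.KC κ, s.lt M N → ∀ p ∈ s.Sbs M,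
    ∃ q ∈ s.Sbs N, s.DNF q M N ∧ s.restr q M = p
  continuity : ∀ (δ : Ordinal.{u}) (c : Ordinal.{u} → Model L),
    Order.IsSuccLimit δ → δ < (Order.succ κ).ord → s.IncCont c (Order.succ δ) →
    (∀ i ≤ δ, c i ∈ s.KC κ) → ∀ p ∈ s.S (c δ),
    (∀ i < δ, s.DNF (s.restr p (c i)) (c 0) (c i)) → p ∈ s.Sbs (c δ) ∧ s.DNF p (c 0) (c δ)

/-- `s` has conjugation: `K_κ` is categorical, and a basic type is conjugate to each of its
non-forking extensions. -/
def HasConjugation (κ : Cardinal.{u}) : Prop :=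
  s.Categorical κ ∧
    ∀ M₁ ∈ s.KC κ, ∀ M₂ ∈ s.KC κ, s.le M₁ M₂ → ∀ p₁ ∈ s.Sbs M₁, ∀ p₂ ∈ s.Sbs M₂,
      s.DNF p₂ M₁ M₂ → s.restr p₂ M₁ = p₁ → s.Conjugate p₁ M₁ p₂ M₂

/-- The class `K^{3,bs}`. -/
def K3bs (κ : Cardinal.{u}) (M N : Model L) (a : ZFSet.{u}) : Prop :=
  M ∈ s.KC κ ∧ N ∈ s.KC κ ∧ s.le M N ∧ a ∈ N.carrier ∧ a ∉ M.carrier ∧ s.tp a M N ∈ s.Sbs M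

/-- `(M, N, a) ⪯_bs (M', N', a)`. -/
def leBs (κ : Cardinal.{u}) (M N M' N' : Model L) (a : ZFSet.{u}) : Prop :=
  s.K3bs κ M N a ∧ s.K3bs κ M' N' a ∧ s.le M M' ∧ s.le N N' ∧ s.nf M M' a N'

/-- The class `K^{3,uq}` of uniqueness triples. -/
def K3uq (κ : Cardinal.{u}) (M N : Model L) (a : ZFSet.{u}) : Prop :=
  s.K3bs κ M N a ∧
    ∀ (M₁ N₁ M₂ N₂ : Model L) (f : Iso M₁ M₂),
      s.leBs κ M N M₁ N₁ a → s.leBs κ M N M₂ N₂ a → Over f M.carrier →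
      ∃ N' ∈ s.KC κ, ∃ (f₁ : Emb N₁ N') (f₂ : Emb N₂ N'),
        s.IsStrong f₁ ∧ s.IsStrong f₂ ∧ Over f₁ N.carrier ∧ Over f₂ N.carrier ∧
        ∀ x : M₁.carrier, ∀ y : N₁.carrier, ∀ z : N₂.carrier,
          (y : ZFSet.{u}) = x → (z : ZFSet.{u}) = f x → f₁ y = f₂ z

/-- `s` is weakly successful: every basic type contains a uniqueness triple. -/
def WeaklySuccessful (κ : Cardinal.{u}) : Prop :=
  ∀ M N a, s.K3bs κ M N a → ∃ N' a', s.tp a' M N' = s.tp a M N ∧ s.K3uq κ M N' a'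

/-! ### Non-forking amalgamation -/

/-- The relation `NF*`. -/
def NFStar (κ : Cardinal.{u}) (N₀ N₁ N₂ N₃ : Model L) : Prop :=
  s.le N₀ N₁ ∧ s.le N₁ N₃ ∧ s.le N₀ N₂ ∧ s.le N₂ N₃ ∧
  ∃ (α : Ordinal.{u}) (c₁ c₂ : Ordinal.{u} → Model L) (d : Ordinal.{u} → ZFSet.{u}),
    α < (Order.succ κ).ord ∧
    s.IncCont c₁ (Order.succ α) ∧ s.IncCont c₂ (Order.succ α) ∧
    (∀ i ≤ α, c₁ i ∈ s.KC κ ∧ c₂ i ∈ s.KC κ ∧ s.le (c₁ i) (c₂ i)) ∧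
    c₁ 0 = N₀ ∧ c₁ α = N₁ ∧ c₂ 0 = N₂ ∧ c₂ α = N₃ ∧
    ∀ i < α, d i ∈ (c₁ (Order.succ i)).carrier ∧ d i ∉ (c₁ i).carrier ∧
      s.K3uq κ (c₁ i) (c₁ (Order.succ i)) (d i) ∧
      s.nf (c₁ i) (c₂ i) (d i) (c₂ (Order.succ i))

/-- The relation `NF` on `K_κ`. -/
def NF (κ : Cardinal.{u}) (M₀ M₁ M₂ M₃ : Model L) : Prop :=
  M₀ ∈ s.KC κ ∧ M₁ ∈ s.KC κ ∧ M₂ ∈ s.KC κ ∧ M₃ ∈ s.KC κ ∧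
  s.le M₀ M₁ ∧ s.le M₁ M₃ ∧ s.le M₀ M₂ ∧ s.le M₂ M₃ ∧
  ∃ N₁ N₂ N₃, s.le M₁ N₁ ∧ s.le M₂ N₂ ∧ s.le M₃ N₃ ∧ s.NFStar κ M₀ N₁ N₂ N₃

/-- The relation `NF^` (NF-hat) between pairs of models of cardinality `κ` and `κ⁺`. -/
def NFHat (κ : Cardinal.{u}) (N₀ N₁ M₀ M₁ : Model L) : Prop :=
  N₀ ∈ s.KC κ ∧ N₁ ∈ s.KC κ ∧ M₀ ∈ s.KC (Order.succ κ) ∧ M₁ ∈ s.KC (Order.succ κ) ∧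
  ∃ c₀ c₁ : Ordinal.{u} → Model L,
    s.IncCont c₀ (Order.succ κ).ord ∧ s.IncCont c₁ (Order.succ κ).ord ∧
    (∀ α < (Order.succ κ).ord,
      s.NF κ (c₀ α) (c₁ α) (c₀ (Order.succ α)) (c₁ (Order.succ α))) ∧
    c₀ 0 = N₀ ∧ c₁ 0 = N₁ ∧
    IsUnion M₀ c₀ (Order.succ κ).ord ∧ IsUnion M₁ c₁ (Order.succ κ).ord

/-- The relation `M₀ ≺⁺ M₁` on models of cardinality `κ⁺`. The third sequence `e` is increasing,
but it is not required to be continuous. -/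
def PrecPlus (κ : Cardinal.{u}) (M₀ M₁ : Model L) : Prop :=
  M₀ ∈ s.KC (Order.succ κ) ∧ M₁ ∈ s.KC (Order.succ κ) ∧
  ∃ (c₀ c₁ e : Ordinal.{u} → Model L) (E : Set (Set.Iio (Order.succ κ).ord)),
    s.IncCont c₀ (Order.succ κ).ord ∧ s.IncCont c₁ (Order.succ κ).ord ∧
    s.Increasing e (Order.succ κ).ord ∧ IsClub E ∧
    IsUnion M₀ c₀ (Order.succ κ).ord ∧ IsUnion M₁ c₁ (Order.succ κ).ord ∧
    (∀ α ∈ E, s.le (c₀ α) (c₁ α) ∧ s.le (c₁ α) (e α)) ∧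
    (∀ α ∈ E, ∀ β ∈ E, α < β → s.NF κ (c₀ α) (e α) (c₀ β) (c₁ β)) ∧
    (∀ α ∈ E, ∀ p ∈ s.Sbs (c₁ α), ∃ γ < (Order.succ κ).ord, ∀ β ∈ E, γ ≤ β.1 →
      ∃ b ∈ (e β).carrier,
        s.DNF (s.tp b (c₁ β) (e β)) (c₁ α) (c₁ β) ∧
        s.restr (s.tp b (c₁ β) (e β)) (c₁ α) = p)

end PreFrame

end SemiGood

namespace SemiGood
open FirstOrder.Language FirstOrder.Language.Structure

variable {L : FirstOrder.Language.{u, u}}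

/-! ### Substructures -/

/-! Models are small, so every embedding between them extends to a permutation of the universe of
sets. Maps are therefore handled as permutations throughout, and copies of models as translates `σ •
M`.

The theorem is a construction of length `κ⁺` along two filtrations lying over one filtration of
`M₀`. The two filtrations of `M₀` agree on a club. After thinning there are `A` filtering `M₀`, `N
l` filtering the two extensions, and models `e l i` between `N l i` and `N l (i + 1)` with `NF (A i)
(e l i) (A (i + 1)) (N l (i + 1))`. One builds an increasing continuous chain `P i` in `K_κ` with
embeddings of both `N l i` into `P i` that agree on `A i`. To pass to `i + 1`, amalgamate `P i` with
both `e l i`, take a non-forking amalgam of the result with `A (i + 1)`, and let weak uniqueness of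
`NF` place both `N l (i + 1)` over it (`exists_step`). In doing so, if some element of `P i` outside
the image of `N l i` has a type over it that is realized in `e l i`, such an element is put into the
image of `e l i`.

This forces both embeddings to be onto in the limit (`mem_of_rich`). Otherwise `N δ ≠ P δ` at all
late `δ`, identifying `N δ` with its image. Take `δ` sufficiently closed. Density gives a basic type
over `N δ` realized in `P δ`, local character bases it on an earlier stage, richness realizes the
non-forking extension in `e δ`, and uniqueness identifies the two types. So some element of `P δ`
outside `N δ` enters `N (δ + 1)`. That element already lies in `P j` for some `j < δ`, and by
closure of `δ` it would have been caught before `δ`.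

The three statements differ only in the start of the construction: any amalgam of the first members
over `A 0`, an amalgam that identifies `a₁` with `a₂`, or one that fixes `N*`. The last exists
because `NF_chain` (long transitivity) gives `NF N₀ N* (A 0) (N l 0)` and `NF_unique` applies.

What remains is the theory of `NF`. A tower is a chain whose steps realize basic types, and a free
lift is a chain above it in which these realizations stay free. Free lifts exist over any extension
of the bottom, and are unique when the steps are uniqueness triples (`freeOver_unique`). Every
extension is covered by such a tower (`exists_uqTower`). Two towers over one model fill out to a
grid that is free in both directions (`exists_grid`), so the two sides of a free lift can be
exchanged. From this follow weak uniqueness independently of the chosen decompositions, symmetry,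
and long transitivity. -/

theorem IsSub.subset {M N : Model L} (h : IsSub M N) : M.carrier ⊆ N.carrier := by
  obtain ⟨f, hf⟩ := h
  intro x hx
  have := (f ⟨x, hx⟩).2
  rwa [hf] at this

theorem isSub_iff {M N : Model L} : IsSub M N ↔ ∃ h : M.carrier ⊆ N.carrier,
    (∀ (n : ℕ) (F : L.Functions n) (xs : Fin n → M.carrier),
      (funMap F (fun k => Set.inclusion h (xs k)) : N.carrier) = Set.inclusion h (funMap F xs)) ∧
    ∀ (n : ℕ) (R : L.Relations n) (xs : Fin n → M.carrier),
      RelMap R (fun k => Set.inclusion h (xs k)) ↔ RelMap R xs := by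
  constructor
  · intro h
    refine ⟨h.subset, ?_, ?_⟩
    · obtain ⟨f, hf⟩ := h
      have e : ∀ x, f x = Set.inclusion (IsSub.subset ⟨f, hf⟩) x := fun x => Subtype.ext (hf x)
      intro n F xs
      rw [← e, f.map_fun]
      congr 1
      funext k
      exact (e _).symm
    · obtain ⟨f, hf⟩ := h
      have e : ∀ x, f x = Set.inclusion (IsSub.subset ⟨f, hf⟩) x := fun x => Subtype.ext (hf x)
      intro n R xs
      rw [← f.map_rel]
      have : f ∘ xs = fun k => Set.inclusion (IsSub.subset ⟨f, hf⟩) (xs k) := by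
        funext k
        exact e _
      rw [this]
  · rintro ⟨h, h1, h2⟩
    exact ⟨⟨⟨Set.inclusion h, Set.inclusion_injective h⟩,
      fun {n} F xs => (h1 n F xs).symm, fun {n} R xs => h2 n R xs⟩, fun x => rfl⟩

theorem IsSub.refl (M : Model L) : IsSub M M := ⟨FirstOrder.Language.Embedding.refl L _, fun _ => rfl⟩

/-- Being a substructure supplies the agreement of the interpretations, which equality of carriers
alone would not give. Copies of models can therefore be compared by literal equality. -/
theorem IsSub.eq {M N : Model L} (h : IsSub M N) (h' : N.carrier ⊆ M.carrier) : M = N := by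
  obtain ⟨A, hA, sM⟩ := M
  obtain ⟨B, hB, sN⟩ := N
  obtain rfl : A = B := Set.Subset.antisymm h.subset h'
  obtain ⟨_, h1, h2⟩ := isSub_iff.1 h
  congr 1
  refine FirstOrder.Language.Structure.ext ?_ ?_
  · funext n F xs
    exact (h1 n F xs).symm
  · funext n R xs
    exact propext (h2 n R xs).symm

theorem IsSub.of_subset {A B N : Model L} (hA : IsSub A N) (hB : IsSub B N)
    (h : A.carrier ⊆ B.carrier) : IsSub A B := by
  obtain ⟨hA0, hA1, hA2⟩ := isSub_iff.1 hA
  obtain ⟨hB0, hB1, hB2⟩ := isSub_iff.1 hB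
  refine isSub_iff.2 ⟨h, fun n F xs => ?_, fun n R xs => ?_⟩
  · apply Set.inclusion_injective hB0
    rw [← hB1]
    exact hA1 n F xs
  · rw [← hB2, ← hA2]

/-! ### The action of permutations of the universe on models -/

/-- The ordinals inject into the sets, and they are not small. -/
theorem not_small_univ : ¬ Small.{u} (Set.univ : Set ZFSet.{u}) := by
  intro h
  apply not_small_ordinal.{u, u}
  exact small_of_injective (β := (Set.univ : Set ZFSet.{u})) (f := fun o => ⟨o.toZFSet, trivial⟩)
    (fun a b hab => Ordinal.toZFSet_injective (congrArg Subtype.val hab))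

theorem mk_lt_of_small (A : Set ZFSet.{u}) (h : Small.{u} A) : #A < #ZFSet.{u} := by
  refine lt_of_le_of_ne (Cardinal.mk_set_le A) fun he => not_small_univ ?_
  obtain ⟨e⟩ := Cardinal.eq.1 he
  exact small_of_injective (f := fun x : (Set.univ : Set ZFSet.{u}) => e.symm x.1)
    (fun a b hab => Subtype.ext (e.symm.injective hab))

/-- A small set has fewer elements than the universe, so the complements of domain and range are
equinumerous and the injection extends. -/
theorem exists_perm {A : Set ZFSet.{u}} (hA : Small.{u} A) (f : A → ZFSet.{u})
    (hf : Function.Injective f) : ∃ σ : Equiv.Perm ZFSet.{u}, ∀ x : A, σ x = f x :=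
  Cardinal.extend_function_of_lt ⟨f, hf⟩ (mk_lt_of_small A hA) ⟨Equiv.refl _⟩

namespace Model

/-- Transporting the structure along `σ` turns restriction, composition and inversion of maps into
identities of a group action. -/
noncomputable instance : SMul (Equiv.Perm ZFSet.{u}) (Model L) where
  smul σ M := ⟨σ '' M.carrier, by have := M.small; infer_instance,
    Equiv.inducedStructure (σ.image M.carrier)⟩

theorem carrier_smul (σ : Equiv.Perm ZFSet.{u}) (M : Model L) :
    (σ • M).carrier = σ '' M.carrier := rfl

noncomputable def isoSMul (σ : Equiv.Perm ZFSet.{u}) (M : Model L) : Iso M (σ • M) :=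
  Equiv.inducedStructureEquiv (σ.image M.carrier)

theorem isoSMul_apply (σ : Equiv.Perm ZFSet.{u}) (M : Model L) (x : M.carrier) :
    (isoSMul σ M x : ZFSet.{u}) = σ x := rfl

theorem smul_eq_of_iso {σ : Equiv.Perm ZFSet.{u}} {M N : Model L} (f : Iso M N)
    (h : ∀ x : M.carrier, (f x : ZFSet.{u}) = σ x) : σ • M = N := by
  refine IsSub.eq ⟨f.toEmbedding.comp (isoSMul σ M).symm.toEmbedding, fun x => ?_⟩ fun x hx => ?_
  · obtain ⟨y, rfl⟩ := (isoSMul σ M).surjective x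
    simp [h, isoSMul_apply]
  · obtain ⟨y, hy⟩ := f.surjective ⟨x, hx⟩
    exact ⟨y, y.2, by rw [← h, hy]⟩

noncomputable instance : MulAction (Equiv.Perm ZFSet.{u}) (Model L) where
  one_smul _ := smul_eq_of_iso (FirstOrder.Language.Equiv.refl L _) fun _ => rfl
  mul_smul σ τ M := smul_eq_of_iso ((isoSMul σ (τ • M)).comp (isoSMul τ M)) fun _ => rfl

theorem mem_smul {σ : Equiv.Perm ZFSet.{u}} {M : Model L} {x : ZFSet.{u}} :
    σ x ∈ (σ • M).carrier ↔ x ∈ M.carrier := by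
  rw [carrier_smul]
  exact σ.injective.mem_set_image

theorem smul_congr {σ τ : Equiv.Perm ZFSet.{u}} {M : Model L}
    (h : ∀ x ∈ M.carrier, σ x = τ x) : σ • M = τ • M :=
  smul_eq_of_iso (isoSMul τ M) fun x => (h x x.2).symm

theorem smul_eq_self {σ : Equiv.Perm ZFSet.{u}} {M : Model L}
    (h : ∀ x ∈ M.carrier, σ x = x) : σ • M = M := by
  rw [smul_congr (τ := 1) h, one_smul]

theorem smul_subset {σ : Equiv.Perm ZFSet.{u}} {M N : Model L} :
    (σ • M).carrier ⊆ (σ • N).carrier ↔ M.carrier ⊆ N.carrier :=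
  Set.image_subset_image_iff σ.injective

end Model

open Model

theorem exists_perm_iso {M N : Model L} (f : Iso M N) :
    ∃ σ : Equiv.Perm ZFSet.{u}, σ • M = N ∧ ∀ x : M.carrier, (f x : ZFSet.{u}) = σ x := by
  obtain ⟨σ, h⟩ := exists_perm M.small (fun x => (f x : ZFSet.{u}))
    (fun x y h => f.injective (Subtype.ext h))
  exact ⟨σ, smul_eq_of_iso f fun x => (h x).symm, fun x => (h x).symm⟩

theorem exists_iso {M N : Model L} {σ : Equiv.Perm ZFSet.{u}} (h : σ • M = N) :
    ∃ f : Iso M N, ∀ x : M.carrier, (f x : ZFSet.{u}) = σ x := by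
  subst h
  exact ⟨isoSMul σ M, fun x => rfl⟩

theorem IsSub.smul {M N : Model L} (σ : Equiv.Perm ZFSet.{u}) (h : IsSub M N) :
    IsSub (σ • M) (σ • N) := by
  obtain ⟨f, hf⟩ := h
  refine ⟨((isoSMul σ N).toEmbedding.comp f).comp (isoSMul σ M).symm.toEmbedding, fun x => ?_⟩
  obtain ⟨y, rfl⟩ := (isoSMul σ M).surjective x
  simp [hf, isoSMul_apply]

theorem exists_perm_emb {M N : Model L} (f : Emb M N) :
    ∃ σ : Equiv.Perm ZFSet.{u}, IsSub (σ • M) N ∧ (σ • M).carrier = img f M.carrier ∧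
      ∀ x : M.carrier, (f x : ZFSet.{u}) = σ x := by
  obtain ⟨σ, h⟩ := exists_perm M.small (fun x => (f x : ZFSet.{u}))
    (fun x y h => f.injective (Subtype.ext h))
  refine ⟨σ, ⟨f.comp (isoSMul σ M).symm.toEmbedding, fun x => ?_⟩, ?_, fun x => (h x).symm⟩
  · obtain ⟨y, rfl⟩ := (isoSMul σ M).surjective x
    simp [h, isoSMul_apply]
  · ext y
    constructor
    · rintro ⟨x, hx, rfl⟩
      exact ⟨⟨x, hx⟩, hx, (h ⟨x, hx⟩).symm⟩
    · rintro ⟨x, hx, rfl⟩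
      exact ⟨x, hx, h x⟩

theorem hasCard_smul {M : Model L} {κ : Cardinal.{u}} {σ : Equiv.Perm ZFSet.{u}} :
    HasCard (σ • M) κ ↔ HasCard M κ := by
  unfold HasCard
  rw [carrier_smul, Cardinal.mk_image_eq σ.injective]

/-! ### Unions of chains -/

/-- A finite tuple of the union lies in one member, and the symbols are interpreted there. The
choice of the member is immaterial, since any two members are substructures of the larger one. -/
theorem exists_isUnion {c : Ordinal.{u} → Model L} {δ : Ordinal.{u}} (hδ : Order.IsSuccLimit δ)
    (hc : ∀ i j, i < j → j < δ → IsSub (c i) (c j)) : ∃ M : Model L, IsUnion M c δ := by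
  have hc' : ∀ i j, i ≤ j → j < δ → IsSub (c i) (c j) := fun i j hij hj => by
    rcases hij.eq_or_lt with rfl | h
    · exact IsSub.refl _
    · exact hc i j h hj
  set A : Set ZFSet.{u} := ⋃ i ∈ Set.Iio δ, (c i).carrier with hA
  have hsub : ∀ i < δ, (c i).carrier ⊆ A := fun i hi => Set.subset_biUnion_of_mem (u := fun i => (c i).carrier) hi
  have hfin : ∀ (n : ℕ) (xs : Fin n → A), ∃ i, i < δ ∧ ∀ k, (xs k : ZFSet.{u}) ∈ (c i).carrier := by
    intro n xs
    have : ∀ k, ∃ i, i < δ ∧ (xs k : ZFSet.{u}) ∈ (c i).carrier := fun k => by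
      have := (xs k).2
      simp only [hA, Set.mem_iUnion, Set.mem_Iio] at this
      obtain ⟨i, hi, h⟩ := this
      exact ⟨i, hi, h⟩
    choose g hg hx using this
    refine ⟨Finset.univ.sup g, ?_, fun k => ?_⟩
    · exact (Finset.sup_lt_iff hδ.bot_lt).2 fun k _ => hg k
    · refine (hc' (g k) _ (Finset.le_sup (Finset.mem_univ k)) ?_).subset (hx k)
      exact (Finset.sup_lt_iff hδ.bot_lt).2 fun k _ => hg k
  choose g hg hx using hfin
  have hsm : Small.{u} A := by
    have : ∀ i, Small.{u} (c i).carrier := fun i => (c i).small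
    have h2 : A = ⋃ i : Set.Iio δ, (c i).carrier := by
      rw [hA, Set.biUnion_eq_iUnion]
    rw [h2]
    infer_instance
  let M : Model L := ⟨A, hsm,
    { funMap := fun {n} F xs =>
        Set.inclusion (hsub _ (hg n xs)) (funMap F (fun k => (⟨xs k, hx n xs k⟩ : (c (g n xs)).carrier)))
      RelMap := fun {n} R xs =>
        RelMap R (fun k => (⟨xs k, hx n xs k⟩ : (c (g n xs)).carrier)) }⟩
  refine ⟨M, fun i hi => isSub_iff.2 ⟨hsub i hi, fun n F xs => ?_, fun n R xs => ?_⟩, rfl⟩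
  · set ys : Fin n → A := fun k => Set.inclusion (hsub i hi) (xs k)
    obtain ⟨_, h1f, _⟩ := isSub_iff.1 (hc' _ _ (le_max_left i (g n ys)) (max_lt hi (hg n ys)))
    obtain ⟨_, h2f, _⟩ := isSub_iff.1 (hc' _ _ (le_max_right i (g n ys)) (max_lt hi (hg n ys)))
    have e1 := congrArg Subtype.val (h1f n F xs)
    have e2 := congrArg Subtype.val (h2f n F (fun k => ⟨ys k, hx n ys k⟩))
    exact Subtype.ext (e2.symm.trans e1)
  · set ys : Fin n → A := fun k => Set.inclusion (hsub i hi) (xs k)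
    obtain ⟨_, _, h1f⟩ := isSub_iff.1 (hc' _ _ (le_max_left i (g n ys)) (max_lt hi (hg n ys)))
    obtain ⟨_, _, h2f⟩ := isSub_iff.1 (hc' _ _ (le_max_right i (g n ys)) (max_lt hi (hg n ys)))
    have e1 := (h1f n R xs)
    have e2 := (h2f n R (fun k => ⟨ys k, hx n ys k⟩))
    exact e2.symm.trans e1

theorem IsUnion.mem_iff {M : Model L} {c : Ordinal.{u} → Model L} {δ : Ordinal.{u}}
    (h : IsUnion M c δ) {x : ZFSet.{u}} : x ∈ M.carrier ↔ ∃ i < δ, x ∈ (c i).carrier := by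
  rw [h.2]
  simp

theorem mem_limit_iff {k : OrderedClass L} {c : Ordinal.{u} → Model L} {θ δ : Ordinal.{u}}
    (h : k.IncCont c θ) (hδ : Order.IsSuccLimit δ) (hθ : δ < θ) {x : ZFSet.{u}} :
    x ∈ (c δ).carrier ↔ ∃ i < δ, x ∈ (c i).carrier := by
  rw [h.2 δ hδ hθ]
  simp

end SemiGood

namespace SemiGood
open Model

variable {L : FirstOrder.Language.{u, u}}

/-! ### Abstract elementary classes and permutations -/

namespace OrderedClass

variable {k : OrderedClass L}

theorem IsAEC.subset (hk : k.IsAEC) {M N : Model L} (h : k.le M N) : M.carrier ⊆ N.carrier :=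
  (hk.sub_of_le _ _ h).subset

theorem IsAEC.eq_of_subset (hk : k.IsAEC) {M N : Model L} (h : k.le M N)
    (h' : N.carrier ⊆ M.carrier) : M = N :=
  (hk.sub_of_le _ _ h).eq h'

theorem IsAEC.le_of_subset (hk : k.IsAEC) {A B N : Model L} (hA : k.le A N) (hB : k.le B N)
    (h : A.carrier ⊆ B.carrier) : k.le A B :=
  hk.coherence A B N ((hk.sub_of_le _ _ hA).of_subset (hk.sub_of_le _ _ hB) h)
    (hk.sub_of_le _ _ hB) hA hB

theorem IsAEC.smul_le_smul (hk : k.IsAEC) {M N : Model L} (σ : Equiv.Perm ZFSet.{u})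
    (h : k.le M N) : k.le (σ • M) (σ • N) := by
  refine hk.le_iso M N _ _ (isoSMul σ N) h ((hk.sub_of_le _ _ h).smul σ) ?_
  ext y
  constructor
  · rintro ⟨x, hx, rfl⟩
    exact ⟨⟨x, hk.subset h hx⟩, hx, rfl⟩
  · rintro ⟨x, hx, rfl⟩
    exact ⟨x, hx, rfl⟩

theorem IsAEC.smul_le_iff (hk : k.IsAEC) {M N : Model L} {σ : Equiv.Perm ZFSet.{u}} :
    k.le (σ • M) N ↔ k.le M (σ⁻¹ • N) :=
  ⟨fun h => by simpa using hk.smul_le_smul σ⁻¹ h, fun h => by simpa using hk.smul_le_smul σ h⟩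

theorem IsAEC.smul_mem (hk : k.IsAEC) {M : Model L} (σ : Equiv.Perm ZFSet.{u})
    (h : M ∈ k.K) : σ • M ∈ k.K :=
  hk.mem_iso M _ h ⟨isoSMul σ M⟩

theorem IsAEC.smul_mem_KC (hk : k.IsAEC) {M : Model L} {κ : Cardinal.{u}}
    (σ : Equiv.Perm ZFSet.{u}) (h : M ∈ k.KC κ) : σ • M ∈ k.KC κ :=
  ⟨hk.smul_mem σ h.1, hasCard_smul.2 h.2⟩

theorem IsAEC.exists_perm_of_isStrong (hk : k.IsAEC) {M N : Model L} {f : Emb M N}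
    (hf : k.IsStrong f) :
    ∃ σ : Equiv.Perm ZFSet.{u}, k.le (σ • M) N ∧ ∀ x : M.carrier, (f x : ZFSet.{u}) = σ x := by
  obtain ⟨N', hN', hc⟩ := hf
  obtain ⟨σ, h1, h2, h3⟩ := exists_perm_emb f
  have : N' = σ • M := ((hk.sub_of_le _ _ hN').of_subset h1 (by rw [h2, hc])).eq (by rw [h2, hc])
  exact ⟨σ, this ▸ hN', h3⟩

theorem IsAEC.exists_isStrong (hk : k.IsAEC) {M N : Model L} {σ : Equiv.Perm ZFSet.{u}}
    (h : k.le (σ • M) N) :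
    ∃ f : Emb M N, k.IsStrong f ∧ ∀ x : M.carrier, (f x : ZFSet.{u}) = σ x := by
  obtain ⟨g, hg⟩ := hk.sub_of_le _ _ h
  refine ⟨g.comp (isoSMul σ M).toEmbedding, ⟨σ • M, h, ?_⟩, fun x => ?_⟩
  · ext y
    constructor
    · rintro ⟨x, hx, rfl⟩
      exact ⟨⟨x, hx⟩, hx, by simp [hg, isoSMul_apply]⟩
    · rintro ⟨x, hx, rfl⟩
      exact ⟨x, hx, by simp [hg, isoSMul_apply]⟩
  · simp [hg, isoSMul_apply]

theorem IncCont.le (hk : k.IsAEC) {c : Ordinal.{u} → Model L} {θ i j : Ordinal.{u}}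
    (hc : k.IncCont c θ) (hij : i ≤ j) (hj : j < θ) (hi : c i ∈ k.K) : k.le (c i) (c j) := by
  rcases hij.eq_or_lt with rfl | h
  · exact hk.refl _ hi
  · exact hc.1 _ _ h hj

theorem IncCont.mono {c : Ordinal.{u} → Model L} {θ θ' : Ordinal.{u}} (hc : k.IncCont c θ)
    (h : θ' ≤ θ) : k.IncCont c θ' :=
  ⟨fun i j hij hj => hc.1 i j hij (hj.trans_le h), fun δ hδ hθ => hc.2 δ hδ (hθ.trans_le h)⟩

theorem IncCont.smul (hk : k.IsAEC) {c : Ordinal.{u} → Model L} {θ : Ordinal.{u}}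
    (hc : k.IncCont c θ) (σ : Equiv.Perm ZFSet.{u}) : k.IncCont (fun i => σ • c i) θ := by
  refine ⟨fun i j hij hj => hk.smul_le_smul σ (hc.1 i j hij hj), fun δ hδ hθ => ?_⟩
  simp only [carrier_smul, hc.2 δ hδ hθ, Set.image_iUnion]

/-- The union axiom speaks of the first member only. It is applied to the chain `j ↦ c (max i j)`,
which has the same union and starts at `c i`. -/
theorem IncCont.le_union (hk : k.IsAEC) {c : Ordinal.{u} → Model L} {δ : Ordinal.{u}}
    (hδ : Order.IsSuccLimit δ) (hc : k.IncCont c δ) {M : Model L} (hM : IsUnion M c δ) :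
    M ∈ k.K ∧ ∀ i < δ, k.le (c i) M := by
  refine ⟨(hk.union δ c M hδ hc hM).1, fun i hi => ?_⟩
  have hK : ∀ j < δ, c j ∈ k.K := fun j hj =>
    (hk.mem_of_le _ _ (hc.1 j _ (Order.lt_succ j) (hδ.succ_lt hj))).1
  have hle : ∀ a b, a ≤ b → b < δ → k.le (c a) (c b) := fun a b hab hb =>
    hc.le hk hab hb (hK a (hab.trans_lt hb))
  have h1 : k.IncCont (fun j => c (max i j)) δ := by
    refine ⟨fun a b hab hb => hle _ _ (max_le_max le_rfl hab.le) (max_lt hi hb), fun ε hε hεδ => ?_⟩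
    ext x
    simp only [Set.mem_iUnion, Set.mem_Iio, exists_prop]
    constructor
    · intro hx
      rcases le_or_gt ε i with h | h
      · rw [max_eq_left h] at hx
        exact ⟨0, hε.bot_lt, by simpa using hx⟩
      · rw [max_eq_right h.le] at hx
        obtain ⟨j, hj, hx⟩ := (mem_limit_iff hc hε hεδ).1 hx
        exact ⟨j, hj, hk.subset (hle _ _ (le_max_right _ _) (max_lt hi (hj.trans hεδ))) hx⟩
    · rintro ⟨j, hj, hx⟩
      exact hk.subset (hle _ _ (max_le_max le_rfl hj.le) (max_lt hi hεδ)) hx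
  have h2 : IsUnion M (fun j => c (max i j)) δ := by
    refine ⟨fun j hj => hM.1 _ (max_lt hi hj), ?_⟩
    ext x
    simp only [Set.mem_iUnion, Set.mem_Iio, exists_prop, hM.mem_iff]
    constructor
    · rintro ⟨j, hj, hx⟩
      exact ⟨j, hj, hk.subset (hle _ _ (le_max_right _ _) (max_lt hi hj)) hx⟩
    · rintro ⟨j, hj, hx⟩
      exact ⟨_, max_lt hi hj, hx⟩
  simpa using (hk.union δ _ M hδ h1 h2).2

theorem IncCont.isUnion (hk : k.IsAEC) {c : Ordinal.{u} → Model L} {θ δ : Ordinal.{u}}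
    (hδ : Order.IsSuccLimit δ) (hθ : δ < θ) (hc : k.IncCont c θ) : IsUnion (c δ) c δ :=
  ⟨fun i hi => hk.sub_of_le _ _ (hc.1 i δ hi hθ), hc.2 δ hδ hθ⟩

/-! ### Types -/

theorem mem_tp_self (a : ZFSet.{u}) (M N : Model L) : ⟨M, N, a⟩ ∈ k.tp a M N :=
  Relation.EqvGen.refl _

theorem tp_eq_iff_eqvGen {a b : ZFSet.{u}} {M M' N N' : Model L} :
    k.tp a M N = k.tp b M' N' ↔ Relation.EqvGen k.EStar ⟨M, N, a⟩ ⟨M', N', b⟩ := by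
  constructor
  · intro h
    have := mem_tp_self (k := k) b M' N'
    rw [← h] at this
    exact this
  · intro h
    ext t
    exact ⟨fun ht => .trans _ _ _ (.symm _ _ h) ht, fun ht => .trans _ _ _ h ht⟩

theorem IsAEC.tp_eq_of_perm (hk : k.IsAEC) {a : ZFSet.{u}} {M N N' P : Model L}
    {σ : Equiv.Perm ZFSet.{u}} (hMN : k.le M N) (hMN' : k.le M N') (ha : a ∈ N.carrier)
    (hσa : σ a ∈ N'.carrier) (hσ : ∀ x ∈ M.carrier, σ x = x)
    (h1 : k.le (σ • N) P) (h2 : k.le N' P) : k.tp a M N = k.tp (σ a) M N' := by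
  refine tp_eq_iff_eqvGen.2 (.rel _ _ ⟨⟨hMN, ha⟩, ⟨hMN', hσa⟩, rfl, P, h2, ?_⟩)
  obtain ⟨f, hf, hfσ⟩ := hk.exists_isStrong h1
  exact ⟨f, hf, fun x hx => (hfσ x).trans (hσ x hx), fun x hx => (hfσ x).trans (congrArg σ hx)⟩

theorem IsAEC.tp_eq_of_le (hk : k.IsAEC) {a : ZFSet.{u}} {M N N' : Model L}
    (hMN : k.le M N) (hNN' : k.le N N') (ha : a ∈ N.carrier) : k.tp a M N = k.tp a M N' :=
  hk.tp_eq_of_perm (σ := 1) hMN (hk.trans _ _ _ hMN hNN') ha (hk.subset hNN' ha) (fun _ _ => rfl)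
    (by simpa using hNN') (hk.refl _ (hk.mem_of_le _ _ hNN').2)

/-- Each step of `E*` over `M₁` is also one over `M₀`. The base is tracked through the induction
because the triples of an equivalence class carry their own base. -/
theorem IsAEC.tp_restrict_congr (hk : k.IsAEC) {M₀ M₁ : Model L} (h01 : k.le M₀ M₁)
    {t t' : Triple L} (h : Relation.EqvGen k.EStar t t') :
    (t.base = M₁ ↔ t'.base = M₁) ∧
      (t.base = M₁ → k.tp t.elt M₀ t.top = k.tp t'.elt M₀ t'.top) := by
  induction h with
  | rel t t' h =>
    obtain ⟨h1, h2, h3, N₂, h4, f, h5, h6, h7⟩ := h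
    refine ⟨by rw [h3], ?_⟩
    intro hb
    obtain ⟨M, N, a⟩ := t
    obtain ⟨M', N', a'⟩ := t'
    simp only at hb h3 h1 h2 h4 h5 h6 h7 ⊢
    subst h3
    subst hb
    refine tp_eq_iff_eqvGen.2 (.rel _ _ ⟨⟨hk.trans _ _ _ h01 h1.1, h1.2⟩,
      ⟨hk.trans _ _ _ h01 h2.1, h2.2⟩, rfl, N₂, h4, f, h5, ?_, h7⟩)
    exact fun x hx => h6 x (hk.subset h01 hx)
  | refl t => exact ⟨Iff.rfl, fun _ => rfl⟩
  | symm t t' _ ih => exact ⟨ih.1.symm, fun h => (ih.2 (ih.1.2 h)).symm⟩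
  | trans t t' t'' _ _ ih ih' =>
    exact ⟨ih.1.trans ih'.1, fun h => (ih.2 h).trans (ih'.2 (ih.1.1 h))⟩

theorem IsAEC.restr_tp (hk : k.IsAEC) {M₀ M₁ N : Model L} (h01 : k.le M₀ M₁) (a : ZFSet.{u}) :
    k.restr (k.tp a M₁ N) M₀ = k.tp a M₀ N := by
  ext t
  constructor
  · rintro ⟨t', ht', h⟩
    have := (hk.tp_restrict_congr h01 ht').2 rfl
    simp only at this
    rwa [this]
  · intro h
    exact ⟨_, mem_tp_self a M₁ N, h⟩

end OrderedClass

end SemiGood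

namespace SemiGood
open Model OrderedClass

variable {L : FirstOrder.Language.{u, u}}

namespace PreFrame

/-- A weakly successful semi-good frame in an infinite cardinality. -/
structure IsWSFrame (s : PreFrame L) (κ : Cardinal.{u}) : Prop where
  inf : ℵ₀ ≤ κ
  good : s.IsSemiGood κ
  ws : s.WeaklySuccessful κ

variable {s : PreFrame L} {κ : Cardinal.{u}}

namespace IsWSFrame

theorem aec (h : s.IsWSFrame κ) : s.IsAEC := h.good.aec

/-! ### Cardinalities -/

theorem mem_KC_of_le_of_le (h : s.IsWSFrame κ) {M N P : Model L} (hM : M ∈ s.KC κ)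
    (hP : P ∈ s.KC κ) (h1 : s.le M N) (h2 : s.le N P) : N ∈ s.KC κ := by
  refine ⟨(h.aec.mem_of_le _ _ h1).2, le_antisymm ?_ ?_⟩
  · exact (Cardinal.mk_le_mk_of_subset (h.aec.subset h2)).trans hP.2.le
  · exact hM.2.ge.trans (Cardinal.mk_le_mk_of_subset (h.aec.subset h1))

theorem exists_between (h : s.IsWSFrame κ) {M N : Model L} (hM : M ∈ s.KC κ) (hMN : s.le M N)
    {A : Set ZFSet.{u}} (hA : A ⊆ N.carrier) (hAc : #A ≤ Cardinal.lift.{u + 1} κ) :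
    ∃ N' ∈ s.KC κ, s.le M N' ∧ s.le N' N ∧ A ⊆ N'.carrier := by
  obtain ⟨κ', hκ'⟩ := h.aec.lst
  have hL : s.HasLST s.LST := csInf_mem (s := {κ | s.HasLST κ}) ⟨κ', hκ'⟩
  obtain ⟨N', hN', h1, h2, h3⟩ := hL N (h.aec.mem_of_le _ _ hMN).2 (A ∪ M.carrier)
    (Set.union_subset hA (h.aec.subset hMN))
  have hinf : ℵ₀ ≤ Cardinal.lift.{u + 1} κ := by simpa using h.inf
  have hle : s.le M N' := h.aec.le_of_subset hMN h2 (Set.subset_union_right.trans h1)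
  refine ⟨N', ⟨hN', le_antisymm ?_ ?_⟩, hle, h2, Set.subset_union_left.trans h1⟩
  · refine h3.trans ?_
    have h4 : #(A ∪ M.carrier : Set ZFSet.{u}) ≤ Cardinal.lift.{u + 1} κ := by
      refine (Cardinal.mk_union_le _ _).trans ?_
      exact (add_le_add hAc hM.2.le).trans (Cardinal.add_eq_self hinf).le
    exact (add_le_add (Cardinal.lift_le.2 h.good.lst_le) h4).trans (Cardinal.add_eq_self hinf).le
  · exact hM.2.ge.trans (Cardinal.mk_le_mk_of_subset (h.aec.subset hle))

theorem union_mem_KC (h : s.IsWSFrame κ) {c : Ordinal.{u} → Model L} {δ : Ordinal.{u}}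
    (hδ : Order.IsSuccLimit δ) (hδκ : δ < (Order.succ κ).ord) (hc : s.IncCont c δ)
    (hK : ∀ i < δ, c i ∈ s.KC κ) {M : Model L} (hM : IsUnion M c δ) : M ∈ s.KC κ := by
  obtain ⟨h1, h2⟩ := hc.le_union h.aec hδ hM
  have hinf : ℵ₀ ≤ Cardinal.lift.{u + 1} κ := by simpa using h.inf
  refine ⟨h1, le_antisymm ?_ ?_⟩
  · rw [hM.2]
    refine (Cardinal.mk_biUnion_le _ _).trans ?_
    rw [← Cardinal.mul_eq_self hinf]
    refine mul_le_mul' ?_ ?_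
    · rw [Cardinal.mk_Iio_ordinal, Cardinal.lift_le]
      exact Order.lt_succ_iff.1 (Cardinal.lt_ord.1 hδκ)
    · exact ciSup_le' fun i => (hK i i.2).2.le
  · exact (hK 0 hδ.bot_lt).2.ge.trans
      (Cardinal.mk_le_mk_of_subset (h.aec.subset (h2 0 hδ.bot_lt)))

/-! ### Amalgamation -/

/-- Moving the amalgam back by the second embedding leaves `M₂` in place, so only `M₁` is moved. The
permutation `σ₀` prescribes the map on `M₀`, which makes this the tool for extending partial maps.
-/
theorem amalg (h : s.IsWSFrame κ) {M₀ M₁ M₂ : Model L} (σ₀ : Equiv.Perm ZFSet.{u})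
    (h0 : M₀ ∈ s.KC κ) (h1 : M₁ ∈ s.KC κ) (h2 : M₂ ∈ s.KC κ) (h01 : s.le M₀ M₁)
    (h02 : s.le (σ₀ • M₀) M₂) :
    ∃ P ∈ s.KC κ, ∃ σ : Equiv.Perm ZFSet.{u}, (∀ x ∈ M₀.carrier, σ x = σ₀ x) ∧
      s.le (σ • M₁) P ∧ s.le M₂ P := by
  obtain ⟨P, hP, f₁, f₂, hf₁, hf₂, ho₁, ho₂⟩ := h.good.amalgamation (σ₀ • M₀)
    (h.aec.smul_mem_KC _ h0) (σ₀ • M₁) (h.aec.smul_mem_KC _ h1) M₂ h2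
    (h.aec.smul_le_smul _ h01) h02
  obtain ⟨σ, hσ, hσf⟩ := h.aec.exists_perm_of_isStrong hf₁
  obtain ⟨τ, hτ, hτf⟩ := h.aec.exists_perm_of_isStrong hf₂
  refine ⟨τ⁻¹ • P, h.aec.smul_mem_KC _ hP, τ⁻¹ * σ * σ₀, fun x hx => ?_, ?_, ?_⟩
  · have e1 : σ (σ₀ x) = σ₀ x := by
      rw [← hσf ⟨σ₀ x, mem_smul.2 (h.aec.subset h01 hx)⟩]
      exact ho₁ _ (mem_smul.2 hx)
    have e2 : τ (σ₀ x) = σ₀ x := by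
      rw [← hτf ⟨σ₀ x, h.aec.subset h02 (mem_smul.2 hx)⟩]
      exact ho₂ _ (mem_smul.2 hx)
    have e3 : τ⁻¹ (σ₀ x) = σ₀ x := by
      rw [Equiv.Perm.inv_eq_iff_eq, e2]
    rw [Equiv.Perm.mul_apply, Equiv.Perm.mul_apply, e1, e3]
  · rw [mul_assoc, mul_smul, mul_smul]
    exact h.aec.smul_le_smul _ hσ
  · exact h.aec.smul_le_iff.1 hτ

/-! ### Types -/

/-- The witnesses of `E*` may have any size, and equality of types is only generated by `E*`. The
LST property cuts each witness down to `K_κ`. For transitivity, a small model containing the middle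
element is inserted and the two amalgams are glued over it. -/
theorem tp_amalg_aux (h : s.IsWSFrame κ) {t t' : Triple L}
    (ht : Relation.EqvGen s.EStar t t') :
    t.base = t'.base ∧ (t ∈ s.K3 ↔ t' ∈ s.K3) ∧
    (t ∈ s.K3 → t.base ∈ s.KC κ → ∀ N ∈ s.KC κ, ∀ N' ∈ s.KC κ, s.le t.base N → s.le N t.top →
      t.elt ∈ N.carrier → s.le t.base N' → s.le N' t'.top → t'.elt ∈ N'.carrier →
      ∃ P ∈ s.KC κ, ∃ σ : Equiv.Perm ZFSet.{u}, (∀ x ∈ t.base.carrier, σ x = x) ∧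
        σ t.elt = t'.elt ∧ s.le (σ • N) P ∧ s.le N' P) := by
  induction ht with
  | rel t t' h' =>
    obtain ⟨h1, h2, h3, N₂, h4, f, h5, h6, h7⟩ := h'
    refine ⟨h3.symm, ⟨fun _ => h2, fun _ => h1⟩, fun _ _ N hN N' hN' hMN hNt ht hMN' hN't' ht' => ?_⟩
    obtain ⟨σ, hσ, hσf⟩ := h.aec.exists_perm_of_isStrong h5
    have hσN : s.le (σ • N) N₂ := h.aec.trans _ _ _ (h.aec.smul_le_smul σ hNt) hσ
    obtain ⟨P, hP, hP1, hP2, hP3⟩ := h.exists_between hN' (h.aec.trans _ _ _ hN't' h4)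
      (h.aec.subset hσN) (h.aec.smul_mem_KC σ hN).2.le
    refine ⟨P, hP, σ, fun x hx => ?_, ?_, h.aec.le_of_subset hσN hP2 hP3, hP1⟩
    · rw [← hσf ⟨x, h.aec.subset h1.1 hx⟩]
      exact h6 _ hx
    · rw [← hσf ⟨t.elt, h1.2⟩]
      exact h7 _ rfl
  | refl t =>
    refine ⟨rfl, Iff.rfl, fun _ _ N hN N' hN' hMN hNt ht hMN' hN't' ht' => ?_⟩
    obtain ⟨P, hP, hP1, hP2, hP3⟩ := h.exists_between hN' hN't'
      (h.aec.subset hNt) hN.2.le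
    exact ⟨P, hP, 1, fun x hx => rfl, rfl, by simpa using h.aec.le_of_subset hNt hP2 hP3, hP1⟩
  | symm t t' _ ih =>
    refine ⟨ih.1.symm, ih.2.1.symm, fun h3 hK N hN N' hN' hMN hNt ht hMN' hN't' ht' => ?_⟩
    rw [← ih.1] at hK hMN hMN' ⊢
    obtain ⟨P, hP, σ, h1, h2, h4, h5⟩ := ih.2.2 (ih.2.1.2 h3) hK N' hN' N hN hMN' hN't' ht' hMN hNt ht
    refine ⟨σ⁻¹ • P, h.aec.smul_mem_KC _ hP, σ⁻¹, fun x hx => ?_, ?_, h.aec.smul_le_smul _ h5,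
      h.aec.smul_le_iff.1 h4⟩
    · rw [Equiv.Perm.inv_eq_iff_eq, h1 x hx]
    · rw [Equiv.Perm.inv_eq_iff_eq, h2]
  | trans t t' t'' _ _ ih ih' =>
    refine ⟨ih.1.trans ih'.1, ih.2.1.trans ih'.2.1, fun h3 hK N hN N' hN' hMN hNt ht hMN' hN't' ht' => ?_⟩
    have h3' := ih.2.1.1 h3
    have hinf : 1 ≤ Cardinal.lift.{u + 1} κ := by
      simpa using (Cardinal.one_lt_aleph0.le.trans h.inf)
    obtain ⟨Q, hQ, hQ1, hQ2, hQ3⟩ := h.exists_between (ih.1 ▸ hK) h3'.1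
      (Set.singleton_subset_iff.2 h3'.2) (by simpa using hinf)
    have hQe := Set.singleton_subset_iff.1 hQ3
    obtain ⟨P, hP, σ, h1, h2, h4, h5⟩ := ih.2.2 h3 hK N hN Q hQ hMN hNt ht (ih.1 ▸ hQ1) hQ2 hQe
    obtain ⟨P', hP', σ', h1', h2', h4', h5'⟩ := ih'.2.2 h3' (ih.1 ▸ hK) Q hQ N' hN' hQ1 hQ2 hQe
      (ih.1 ▸ hMN') hN't' ht'
    obtain ⟨R, hR, ρ, hρ1, hρ2, hρ3⟩ := h.amalg σ' hQ hP hP' h5 h4'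
    refine ⟨R, hR, ρ * σ, fun x hx => ?_, ?_, ?_, h.aec.trans _ _ _ h5' hρ3⟩
    · have hx' : x ∈ t'.base.carrier := ih.1 ▸ hx
      rw [Equiv.Perm.mul_apply, h1 x hx, hρ1 x (h.aec.subset hQ1 hx'), h1' x hx']
    · rw [Equiv.Perm.mul_apply, h2, hρ1 _ hQe, h2']
    · rw [mul_smul]
      exact h.aec.trans _ _ _ (h.aec.smul_le_smul ρ h4) hρ2

/-- Equality of types is witnessed by an amalgam of any two small models realizing them. -/
theorem tp_amalg (h : s.IsWSFrame κ) {M N₁ N₂ N N' : Model L} {a b : ZFSet.{u}}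
    (ht : s.tp a M N₁ = s.tp b M N₂) (hM : M ∈ s.KC κ) (hN : N ∈ s.KC κ) (hN' : N' ∈ s.KC κ)
    (h1 : s.le M N) (h2 : s.le N N₁) (ha : a ∈ N.carrier)
    (h1' : s.le M N') (h2' : s.le N' N₂) (hb : b ∈ N'.carrier) :
    ∃ P ∈ s.KC κ, ∃ σ : Equiv.Perm ZFSet.{u}, (∀ x ∈ M.carrier, σ x = x) ∧
        σ a = b ∧ s.le (σ • N) P ∧ s.le N' P :=
  (h.tp_amalg_aux (tp_eq_iff_eqvGen.1 ht)).2.2 ⟨h.aec.trans _ _ _ h1 h2, h.aec.subset h2 ha⟩ hM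
    N hN N' hN' h1 h2 ha h1' h2' hb

theorem tp_amalg' (h : s.IsWSFrame κ) {M N N' : Model L} {a b : ZFSet.{u}}
    (ht : s.tp a M N = s.tp b M N') (hM : M ∈ s.KC κ) (hN : N ∈ s.KC κ) (hN' : N' ∈ s.KC κ)
    (h1 : s.le M N) (ha : a ∈ N.carrier) (h1' : s.le M N') (hb : b ∈ N'.carrier) :
    ∃ P ∈ s.KC κ, ∃ σ : Equiv.Perm ZFSet.{u}, (∀ x ∈ M.carrier, σ x = x) ∧
        σ a = b ∧ s.le (σ • N) P ∧ s.le N' P :=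
  h.tp_amalg ht hM hN hN' h1 (h.aec.refl _ hN.1) ha h1' (h.aec.refl _ hN'.1) hb

theorem tp_smul_mem (h : s.IsWSFrame κ) {M N : Model L} {a : ZFSet.{u}} (hM : M ∈ s.KC κ)
    (hMN : s.le M N) (ha : a ∈ N.carrier) (hp : s.tp a M N ∈ s.Sbs M)
    (σ : Equiv.Perm ZFSet.{u}) : s.tp (σ a) (σ • M) (σ • N) ∈ s.Sbs (σ • M) := by
  refine h.good.bs_iso M N _ _ (isoSMul σ N) ⟨a, ha⟩ hM hMN (h.aec.smul_le_smul σ hMN) ?_ hp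
  ext y
  constructor
  · rintro ⟨x, hx, rfl⟩
    exact ⟨⟨x, h.aec.subset hMN hx⟩, hx, rfl⟩
  · rintro ⟨x, hx, rfl⟩
    exact ⟨x, hx, rfl⟩

/-! ### Non-forking -/

theorem nf_smul (h : s.IsWSFrame κ) {M₀ M₁ N : Model L} {a : ZFSet.{u}} (hn : s.nf M₀ M₁ a N)
    (σ : Equiv.Perm ZFSet.{u}) : s.nf (σ • M₀) (σ • M₁) (σ a) (σ • N) := by
  obtain ⟨-, -, -, h01, h1N, ha, -⟩ := h.good.nf_basic _ _ _ _ hn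
  have h0N := h.aec.trans _ _ _ h01 h1N
  have aux : ∀ M : Model L, s.le M N → (σ • M).carrier = img (isoSMul σ N) M.carrier := by
    intro M hMN
    ext y
    constructor
    · rintro ⟨x, hx, rfl⟩
      exact ⟨⟨x, h.aec.subset hMN hx⟩, hx, rfl⟩
    · rintro ⟨x, hx, rfl⟩
      exact ⟨x, hx, rfl⟩
  exact h.good.nf_iso _ _ _ _ _ _ (isoSMul σ N) ⟨a, ha⟩ hn
    ((h.aec.sub_of_le _ _ h0N).smul σ) ((h.aec.sub_of_le _ _ h1N).smul σ) (aux _ h0N) (aux _ h1N)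

theorem nf_up (h : s.IsWSFrame κ) {M₀ M₁ N N' : Model L} {a : ZFSet.{u}} (hn : s.nf M₀ M₁ a N)
    (hN : s.le N N') : s.nf M₀ M₁ a N' := by
  obtain ⟨h0, h1, -, h01, h1N, ha, -⟩ := h.good.nf_basic _ _ _ _ hn
  refine h.good.nf_mono M₀ M₀ M₁ M₁ N N' N' a (h.aec.refl _ h0.1) h01 (h.aec.refl _ h1.1) h1N hN
    ?_ (h.aec.refl _ (h.aec.mem_of_le _ _ hN).2) hn
  exact Set.union_subset (h.aec.subset (h.aec.trans _ _ _ h1N hN))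
    (Set.singleton_subset_iff.2 (h.aec.subset hN ha))

theorem nf_down (h : s.IsWSFrame κ) {M₀ M₁ N N' : Model L} {a : ZFSet.{u}} (hn : s.nf M₀ M₁ a N)
    (hN : s.le N' N) (hM : s.le M₁ N') (haN : a ∈ N'.carrier) : s.nf M₀ M₁ a N' := by
  obtain ⟨h0, h1, hNK, h01, h1N, ha, -⟩ := h.good.nf_basic _ _ _ _ hn
  refine h.good.nf_mono M₀ M₀ M₁ M₁ N N N' a (h.aec.refl _ h0.1) h01 (h.aec.refl _ h1.1) h1N
    (h.aec.refl _ hNK) ?_ hN hn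
  exact Set.union_subset (h.aec.subset hM) (Set.singleton_subset_iff.2 haN)

theorem nf_base (h : s.IsWSFrame κ) {M₀ M₀' M₁' M₁ N : Model L} {a : ZFSet.{u}}
    (hn : s.nf M₀ M₁ a N) (h0 : s.le M₀ M₀') (h01 : s.le M₀' M₁') (h1 : s.le M₁' M₁) :
    s.nf M₀' M₁' a N := by
  obtain ⟨-, -, hNK, -, h1N, ha, -⟩ := h.good.nf_basic _ _ _ _ hn
  exact h.good.nf_mono M₀ M₀' M₁' M₁ N N N a h0 h01 h1 h1N
    (h.aec.refl _ hNK) (Set.union_subset (h.aec.subset (h.aec.trans _ _ _ h1 h1N))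
      (Set.singleton_subset_iff.2 ha)) (h.aec.refl _ hNK) hn

/-- Non-forking depends only on the type. -/
theorem nf_of_dnf (h : s.IsWSFrame κ) {M₀ M₁ N : Model L} {a : ZFSet.{u}}
    (hN : N ∈ s.KC κ) (h1N : s.le M₁ N) (ha : a ∈ N.carrier)
    (hd : s.DNF (s.tp a M₁ N) M₀ M₁) : s.nf M₀ M₁ a N := by
  obtain ⟨N', b, he, hn⟩ := hd
  obtain ⟨h0, h1, hN'K, h01, h1N', hb, -⟩ := h.good.nf_basic _ _ _ _ hn
  have hinf : 1 ≤ Cardinal.lift.{u + 1} κ := by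
    simpa using (Cardinal.one_lt_aleph0.le.trans h.inf)
  obtain ⟨Q, hQ, hQ1, hQ2, hQ3⟩ := h.exists_between h1 h1N'
      (Set.singleton_subset_iff.2 hb) (by simpa using hinf)
  have hQb := Set.singleton_subset_iff.1 hQ3
  have hnQ := h.nf_down hn hQ2 hQ1 hQb
  obtain ⟨P, hP, σ, hσ, hσb, hσQ, hNP⟩ := h.tp_amalg he.symm h1 hQ hN hQ1 hQ2 hQb h1N
    (h.aec.refl _ hN.1) ha
  have h' := h.nf_up (h.nf_smul hnQ σ) hσQ
  rw [smul_eq_self hσ, smul_eq_self (fun x hx => hσ x (h.aec.subset h01 hx)), hσb] at h'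
  exact h.nf_down h' hNP h1N ha

theorem dnf_of_nf {M₀ M₁ N : Model L} {a : ZFSet.{u}} (hn : s.nf M₀ M₁ a N) :
    s.DNF (s.tp a M₁ N) M₀ M₁ := ⟨N, a, rfl, hn⟩

theorem omega0_lt (h : s.IsWSFrame κ) : Ordinal.omega0.{u} < (Order.succ κ).ord := by
  rw [← Cardinal.ord_aleph0, Cardinal.ord_lt_ord]
  exact Order.lt_succ_of_le h.inf

/-- Local character for the constant chain of length `ω`. -/
theorem nf_refl (h : s.IsWSFrame κ) {M N : Model L} {a : ZFSet.{u}} (hM : M ∈ s.KC κ)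
    (hN : N ∈ s.KC κ) (hMN : s.le M N) (ha : a ∈ N.carrier) (hp : s.tp a M N ∈ s.Sbs M) :
    s.nf M M a N := by
  obtain ⟨i, -, hi⟩ := h.good.local_character Ordinal.omega0 (fun _ => M)
    Ordinal.isSuccLimit_omega0 h.omega0_lt
    ⟨fun _ _ _ _ => h.aec.refl _ hM.1, fun δ hδ _ => by
      ext x
      simp only [Set.mem_iUnion, Set.mem_Iio, exists_prop, exists_and_right]
      exact ⟨fun hx => ⟨⟨0, hδ.bot_lt⟩, hx⟩, fun hx => hx.2⟩⟩ (fun _ _ => hM) _ hp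
  exact h.nf_of_dnf hN hMN ha hi

/-- Non-forking extensions in the form of an amalgam. -/
theorem nf_ext (h : s.IsWSFrame κ) {M₀ M₁ N : Model L} {a : ZFSet.{u}}
    (σ₀ : Equiv.Perm ZFSet.{u}) (h0 : M₀ ∈ s.KC κ) (h1 : M₁ ∈ s.KC κ) (hN : N ∈ s.KC κ)
    (h0N : s.le M₀ N) (ha : a ∈ N.carrier) (hp : s.tp a M₀ N ∈ s.Sbs M₀)
    (h01 : s.le (σ₀ • M₀) M₁) :
    ∃ P ∈ s.KC κ, ∃ σ : Equiv.Perm ZFSet.{u}, (∀ x ∈ M₀.carrier, σ x = σ₀ x) ∧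
      s.le (σ • N) P ∧ s.le M₁ P ∧ s.nf (σ₀ • M₀) M₁ (σ a) P := by
  set M := σ₀ • M₀ with hMdef
  have hM : M ∈ s.KC κ := h.aec.smul_mem_KC _ h0
  have hp' : s.tp (σ₀ a) M (σ₀ • N) ∈ s.Sbs M := h.tp_smul_mem h0 h0N ha hp σ₀
  have hle : s.le M (σ₀ • N) := h.aec.smul_le_smul _ h0N
  have hσN := h.aec.smul_mem_KC σ₀ hN
  have key : ∃ N' ∈ s.KC κ, ∃ b ∈ N'.carrier, s.le M₁ N' ∧ s.nf M M₁ b N' ∧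
      s.tp (σ₀ a) M (σ₀ • N) = s.tp b M N' := by
    -- The extension axiom concerns proper extensions only; the trivial one is covered by `nf_refl`.
    by_cases hMM : M = M₁
    · exact ⟨σ₀ • N, hσN, σ₀ a, mem_smul.2 ha, hMM ▸ hle,
        hMM ▸ h.nf_refl hM hσN hle (mem_smul.2 ha) hp', rfl⟩
    · obtain ⟨q, hq, hqd, hqr⟩ := h.good.extension M hM M₁ h1 ⟨h01, hMM⟩ _ hp'
      obtain ⟨N', b, hlt, hN', hb, hbM, rfl⟩ := h.good.bs_na M₁ h1 hq
      refine ⟨N', hN', b, hb, hlt.1, h.nf_of_dnf hN' hlt.1 hb hqd, ?_⟩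
      rw [← hqr, h.aec.restr_tp h01]
  obtain ⟨N', hN', b, hb, hM1N', hn, he⟩ := key
  obtain ⟨P, hP, σ, hσ, hσb, hσQ, hNP⟩ := h.tp_amalg' he hM hσN hN' hle (mem_smul.2 ha)
    (h.aec.trans _ _ _ h01 hM1N') hb
  refine ⟨P, hP, σ * σ₀, fun x hx => hσ _ (mem_smul.2 hx), by rwa [mul_smul],
    h.aec.trans _ _ _ hM1N' hNP, ?_⟩
  rw [Equiv.Perm.mul_apply, hσb]
  exact h.nf_up hn hNP

/-- Take the non-forking extension to `M₂` of the type over `M₀`. By uniqueness it agrees with the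
given type first over `M₁` and then over `M₂`. -/
theorem nf_trans (h : s.IsWSFrame κ) {M₀ M₁ M₂ N : Model L} {a : ZFSet.{u}} (hN : N ∈ s.KC κ)
    (hn1 : s.nf M₀ M₁ a N) (hn2 : s.nf M₁ M₂ a N) : s.nf M₀ M₂ a N := by
  obtain ⟨h0, h1, -, h01, -, ha, -, hp0, hp1⟩ := h.good.nf_basic _ _ _ _ hn1
  obtain ⟨-, h2, -, h12, h2N, -, -, -, hp2⟩ := h.good.nf_basic _ _ _ _ hn2
  have h02 := h.aec.trans _ _ _ h01 h12
  obtain ⟨P, hP, σ, hσ, hσN, h2P, hn⟩ := h.nf_ext 1 h0 h2 hN (h.aec.trans _ _ _ h02 h2N) ha hp0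
    (by simpa using h02)
  simp only [Equiv.Perm.coe_one, id_eq, one_smul] at hσ hn
  obtain ⟨-, -, -, -, -, hσa, -, -, hp2'⟩ := h.good.nf_basic _ _ _ _ hn
  have e0 : s.tp a M₀ N = s.tp (σ a) M₀ P :=
    h.aec.tp_eq_of_perm (h.aec.trans _ _ _ h02 h2N) (h.aec.trans _ _ _ h02 h2P) ha hσa hσ hσN
      (h.aec.refl _ hP.1)
  have hn' : s.nf M₀ M₁ (σ a) P := h.nf_base hn (h.aec.refl _ h0.1) h01 h12
  obtain ⟨-, -, -, -, -, -, -, -, hp1'⟩ := h.good.nf_basic _ _ _ _ hn'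
  have e1 : s.tp a M₁ N = s.tp (σ a) M₁ P := by
    refine h.good.uniqueness M₀ h0 M₁ h1 h01 _ hp1 _ hp1' (dnf_of_nf hn1) (dnf_of_nf hn') ?_
    rw [h.aec.restr_tp h01, h.aec.restr_tp h01, e0]
  have e2 : s.tp a M₂ N = s.tp (σ a) M₂ P := by
    refine h.good.uniqueness M₁ h1 M₂ h2 h12 _ hp2 _ hp2' (dnf_of_nf hn2)
      (dnf_of_nf (h.nf_base hn h01 h12 (h.aec.refl _ h2.1))) ?_
    rw [h.aec.restr_tp h12, h.aec.restr_tp h12, e1]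
  exact h.nf_of_dnf hN h2N ha (e2 ▸ dnf_of_nf hn)

/-- Two types over a common model have an amalgam in which each is free from the other side. -/
theorem sym_amalg (h : s.IsWSFrame κ) {M₀ M₁ M₂ : Model L} {a b : ZFSet.{u}}
    (h0 : M₀ ∈ s.KC κ) (h1 : M₁ ∈ s.KC κ) (h2 : M₂ ∈ s.KC κ) (h01 : s.le M₀ M₁)
    (h02 : s.le M₀ M₂) (ha : a ∈ M₁.carrier) (hb : b ∈ M₂.carrier)
    (hpa : s.tp a M₀ M₁ ∈ s.Sbs M₀) (hpb : s.tp b M₀ M₂ ∈ s.Sbs M₀) :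
    ∃ P ∈ s.KC κ, ∃ σ : Equiv.Perm ZFSet.{u}, (∀ x ∈ M₀.carrier, σ x = x) ∧
      s.le (σ • M₁) P ∧ s.le M₂ P ∧ s.nf M₀ M₂ (σ a) P ∧ s.nf M₀ (σ • M₁) b P := by
  obtain ⟨N', hN', τ, hτ, hτM, h1N', hn⟩ := h.nf_ext 1 h0 h1 h2 h02 hb hpb (by simpa using h01)
  simp only [Equiv.Perm.coe_one, id_eq, one_smul] at hτ hn
  have hpa' : s.tp a M₀ N' ∈ s.Sbs M₀ := by rwa [← h.aec.tp_eq_of_le h01 h1N' ha]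
  obtain ⟨P, N'', hbP, h0P, hPN'', hN'N'', hnP⟩ := h.good.symmetry M₀ h0 M₁ h1 N' hN' a (τ b) h01
    h1N' ha hpa' hn
  obtain ⟨-, hP, -, -, -, -, -, -, hpaP⟩ := h.good.nf_basic _ _ _ _ hnP
  -- shrink `N''`
  obtain ⟨R, hR, hN'R, hRN, hPR⟩ := h.exists_between hN' hN'N'' (h.aec.subset hPN'') hP.2.le
  have hPR := h.aec.le_of_subset hPN'' hRN hPR
  have haR : a ∈ R.carrier := h.aec.subset hN'R (h.aec.subset h1N' ha)
  have hnP := h.nf_down hnP hRN hPR haR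
  have hnR := h.nf_up hn hN'R
  have hτR := h.aec.trans _ _ _ hτM hN'R
  obtain ⟨-, -, -, -, -, -, -, -, hpaP⟩ := h.good.nf_basic _ _ _ _ hnP
  -- a copy of `M₂` above `P`
  have hτ0 : s.le M₀ (τ • M₂) := by
    have := h.aec.smul_le_smul τ h02
    rwa [smul_eq_self hτ] at this
  have e : s.tp (τ b) M₀ (τ • M₂) = s.tp (τ b) M₀ P := by
    rw [h.aec.tp_eq_of_le hτ0 hτR (mem_smul.2 hb), h.aec.tp_eq_of_le h0P hPR hbP]
  obtain ⟨P', hP', ρ, hρ, hρb, hρM, hPP'⟩ := h.tp_amalg' e h0 (h.aec.smul_mem_KC _ h2) hP hτ0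
    (mem_smul.2 hb) h0P hbP
  -- Symmetry made `a` free from `P` only, and `P` need not contain a copy of `M₂`. So the type of
  -- `a` over `P` is extended freely to `P'`, and transitivity returns the base to `M₀`. Since `χ`
  -- fixes `P`, it fixes `τ b`, which stays free from the moved `M₁`.
  obtain ⟨Q, hQ, χ, hχ, hχR, hP'Q, hnQ⟩ := h.nf_ext 1 hP hP' hR hPR haR hpaP (by simpa using hPP')
  simp only [Equiv.Perm.coe_one, id_eq, one_smul] at hχ hnQ
  have hχ0 : ∀ x ∈ M₀.carrier, χ x = x := fun x hx => hχ x (h.aec.subset h0P hx)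
  have hn1 : s.nf M₀ P' (χ a) Q := by
    refine h.nf_trans hQ ?_ hnQ
    have := h.nf_up (h.nf_smul hnP χ) hχR
    rwa [smul_eq_self hχ, smul_eq_self hχ0] at this
  have hn2 : s.nf M₀ (χ • M₁) (τ b) Q := by
    have := h.nf_up (h.nf_smul hnR χ) hχR
    rwa [smul_eq_self hχ0, hχ _ hbP] at this
  have hρτ : ∀ x ∈ M₀.carrier, (ρ * τ) x = x := fun x hx => by
    rw [Equiv.Perm.mul_apply, hτ x hx, hρ x hx]
  have hρτ' : ∀ x ∈ M₀.carrier, (ρ * τ)⁻¹ x = x := fun x hx => by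
    rw [Equiv.Perm.inv_eq_iff_eq, hρτ x hx]
  have hM₂Q : s.le ((ρ * τ) • M₂) P' := by rwa [mul_smul]
  -- Undoing `ρ * τ` puts `M₂` back in place. It sends `τ b` to `b` because `ρ` fixes `τ b`.
  refine ⟨(ρ * τ)⁻¹ • Q, h.aec.smul_mem_KC _ hQ, (ρ * τ)⁻¹ * χ, fun x hx => ?_, ?_, ?_, ?_, ?_⟩
  · rw [Equiv.Perm.mul_apply, hχ0 x hx, hρτ' x hx]
  · rw [mul_smul]
    exact h.aec.smul_le_smul _ (h.aec.trans _ _ _ (h.aec.smul_le_smul χ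
      (h.aec.trans _ _ _ h1N' hN'R)) hχR)
  · exact h.aec.smul_le_iff.1 (h.aec.trans _ _ _ hM₂Q hP'Q)
  · have h3 : s.le M₀ ((ρ * τ) • M₂) := by
      have := h.aec.smul_le_smul (ρ * τ) h02
      rwa [smul_eq_self hρτ] at this
    have := h.nf_smul (h.nf_base hn1 (h.aec.refl _ h0.1) h3 hM₂Q) (ρ * τ)⁻¹
    rwa [smul_eq_self hρτ', inv_smul_smul] at this
  · have := h.nf_smul hn2 (ρ * τ)⁻¹
    rw [smul_eq_self hρτ', ← mul_smul] at this
    convert this using 1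
    rw [Equiv.Perm.eq_inv_iff_eq, Equiv.Perm.mul_apply, hρb]

end IsWSFrame

end PreFrame

end SemiGood

namespace SemiGood
open Model OrderedClass

variable {L : FirstOrder.Language.{u, u}}

/-! ### Transfinite constructions of chains -/

/-- Since `Q i` depends only on the values below `i`, a choice made for the restriction of `f` to
`i`, padded by a default value, remains valid for `f` itself. -/
theorem exists_recursion {St : Type*} [Nonempty St] (θ : Ordinal.{u})
    (Q : Ordinal.{u} → (Ordinal.{u} → St) → St → Prop)
    (hcongr : ∀ i f g x, (∀ j < i, f j = g j) → Q i f x → Q i g x)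
    (hex : ∀ i < θ, ∀ f, (∀ j < i, Q j f (f j)) → ∃ x, Q i f x) :
    ∃ f, ∀ i < θ, Q i f (f i) := by
  classical
  let d : St := Classical.arbitrary St
  let ex : ∀ i : Ordinal.{u}, (∀ j, j < i → St) → Ordinal.{u} → St := fun i F j =>
    if hj : j < i then F j hj else d
  let f : Ordinal.{u} → St := WellFounded.fix (C := fun _ => St) Ordinal.lt_wf fun i F =>
    if hx : ∃ x, Q i (ex i F) x then hx.choose else d
  have hf : ∀ i, f i = if hx : ∃ x, Q i (ex i fun j _ => f j) x then hx.choose else d := fun i =>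
    WellFounded.fix_eq _ _ _
  refine ⟨f, fun i => ?_⟩
  induction i using WellFoundedLT.induction with
  | ind i ih =>
    intro hi
    have e : ∀ j < i, f j = ex i (fun j _ => f j) j := fun j hj => by simp [ex, hj]
    obtain ⟨x, hx⟩ := hex i hi f fun j hj => ih j hj (hj.trans hi)
    have hx' : ∃ x, Q i (ex i fun j _ => f j) x := ⟨x, hcongr i _ _ _ e hx⟩
    have := hx'.choose_spec
    rw [hf i, dif_pos hx']
    exact hcongr i _ _ _ (fun j hj => (e j hj).symm) this

/-- Coherent injections on an increasing chain have an injective union on a small set, and this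
extends to a permutation. -/
theorem exists_perm_limit {src : Ordinal.{u} → Model L} {τ : Ordinal.{u} → Equiv.Perm ZFSet.{u}}
    {δ : Ordinal.{u}} (hsrc : ∀ i j, i < j → j < δ → (src i).carrier ⊆ (src j).carrier)
    (hτ : ∀ i j, i < j → j < δ → ∀ x ∈ (src i).carrier, τ j x = τ i x) :
    ∃ σ : Equiv.Perm ZFSet.{u}, ∀ i < δ, ∀ x ∈ (src i).carrier, σ x = τ i x := by
  have hsrc' : ∀ i j, i ≤ j → j < δ → (src i).carrier ⊆ (src j).carrier := fun i j hij hj => by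
    rcases hij.eq_or_lt with rfl | h
    · exact subset_rfl
    · exact hsrc i j h hj
  have hτ' : ∀ i j, i ≤ j → j < δ → ∀ x ∈ (src i).carrier, τ j x = τ i x := fun i j hij hj => by
    rcases hij.eq_or_lt with rfl | h
    · exact fun _ _ => rfl
    · exact hτ i j h hj
  set A : Set ZFSet.{u} := ⋃ i : Set.Iio δ, (src i).carrier with hA
  have hsm : Small.{u} A := by
    have : ∀ i, Small.{u} (src i).carrier := fun i => (src i).small
    infer_instance
  have hx : ∀ x : A, ∃ i < δ, (x : ZFSet.{u}) ∈ (src i).carrier := fun x => by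
    obtain ⟨i, hi⟩ := Set.mem_iUnion.1 x.2
    exact ⟨i, i.2, hi⟩
  choose g hg hxg using hx
  obtain ⟨σ, hσ⟩ := exists_perm hsm (fun x => τ (g x) x) fun x y hxy => by
    have hm := max_lt (hg x) (hg y)
    simp only at hxy
    rw [← hτ' _ _ (le_max_left (g x) (g y)) hm x (hxg x),
      ← hτ' _ _ (le_max_right (g x) (g y)) hm y (hxg y)] at hxy
    exact Subtype.ext ((τ _).injective hxy)
  refine ⟨σ, fun i hi x hxi => ?_⟩
  have hxA : x ∈ A := Set.mem_iUnion.2 ⟨⟨i, hi⟩, hxi⟩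
  have hm := max_lt hi (hg ⟨x, hxA⟩)
  rw [hσ ⟨x, hxA⟩, ← hτ' _ _ (le_max_left i (g ⟨x, hxA⟩)) hm x hxi,
    ← hτ' _ _ (le_max_right i (g ⟨x, hxA⟩)) hm x (hxg ⟨x, hxA⟩)]

namespace OrderedClass

variable {k : OrderedClass L} {ι ι' : Type*}

/-- `P` is a family of increasing continuous chains, and `τ` a family of coherent maps on the
chains `src`. -/
structure CohChain (k : OrderedClass L) (src : ι → Ordinal.{u} → Model L) (θ : Ordinal.{u})
    (P : Ordinal.{u} → ι' → Model L) (τ : Ordinal.{u} → ι → Equiv.Perm ZFSet.{u}) : Prop where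
  chain : ∀ a, k.IncCont (fun i => P i a) θ
  coh : ∀ i j, i < j → j < θ → ∀ a, ∀ x ∈ (src a i).carrier, τ j a x = τ i a x

theorem CohChain.coh' {src : ι → Ordinal.{u} → Model L} {θ : Ordinal.{u}}
    {P : Ordinal.{u} → ι' → Model L} {τ : Ordinal.{u} → ι → Equiv.Perm ZFSet.{u}}
    (h : k.CohChain src θ P τ) {i j : Ordinal.{u}} (hij : i ≤ j) (hj : j < θ) (a : ι) {x : ZFSet.{u}}
    (hx : x ∈ (src a i).carrier) : τ j a x = τ i a x := by
  rcases hij.eq_or_lt with rfl | hlt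
  · rfl
  · exact h.coh i j hlt hj a x hx

/-- This is the common form of the transfinite constructions: chains `P` of targets, indexed by
`ι'`, are built together with coherent maps of given source chains, indexed by `ι`. `Inv` is kept at
every stage and `Step` records what happens at successors. At limits unions are forced, so only
`Inv` has to be checked there, with the chain up to and including the limit available as a
`CohChain`. -/
theorem IsAEC.exists_cohChain (hk : k.IsAEC) {θ : Ordinal.{u}} {src : ι → Ordinal.{u} → Model L}
    (hsrc : ∀ a i j, i < j → j < θ → (src a i).carrier ⊆ (src a j).carrier)
    (Inv : Ordinal.{u} → (ι' → Model L) → (ι → Equiv.Perm ZFSet.{u}) → Prop)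
    (Step : Ordinal.{u} → (ι' → Model L) → (ι → Equiv.Perm ZFSet.{u}) →
      (ι' → Model L) → (ι → Equiv.Perm ZFSet.{u}) → Prop)
    (P₀ : ι' → Model L) (τ₀ : ι → Equiv.Perm ZFSet.{u}) (h0 : Inv 0 P₀ τ₀)
    (hs : ∀ i P τ, Order.succ i < θ → Inv i P τ → ∃ P' τ', (∀ a, k.le (P a) (P' a)) ∧
      (∀ a, ∀ x ∈ (src a i).carrier, τ' a x = τ a x) ∧ Inv (Order.succ i) P' τ' ∧
      Step i P τ P' τ')
    (hl : ∀ δ P τ, Order.IsSuccLimit δ → δ < θ → k.CohChain src (Order.succ δ) P τ →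
      (∀ i < δ, Inv i (P i) (τ i)) → P 0 = P₀ → τ 0 = τ₀ → Inv δ (P δ) (τ δ)) :
    ∃ P τ, k.CohChain src θ P τ ∧ P 0 = P₀ ∧ τ 0 = τ₀ ∧ (∀ i < θ, Inv i (P i) (τ i)) ∧
      ∀ i, Order.succ i < θ → Step i (P i) (τ i) (P (Order.succ i)) (τ (Order.succ i)) := by
  classical
  let St := (ι' → Model L) × (ι → Equiv.Perm ZFSet.{u})
  let Q : Ordinal.{u} → (Ordinal.{u} → St) → St → Prop := fun i f x =>
    (i = 0 → x = (P₀, τ₀)) ∧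
    (∀ j, i = Order.succ j → (∀ a, k.le ((f j).1 a) (x.1 a)) ∧
      (∀ a, ∀ y ∈ (src a j).carrier, x.2 a y = (f j).2 a y) ∧
      Step j (f j).1 (f j).2 x.1 x.2) ∧
    (Order.IsSuccLimit i → (∀ a, IsUnion (x.1 a) (fun j => (f j).1 a) i) ∧
      ∀ a, ∀ j < i, ∀ y ∈ (src a j).carrier, x.2 a y = (f j).2 a y) ∧
    Inv i x.1 x.2
  have spec : ∀ (f : Ordinal.{u} → St) (ε : Ordinal.{u}), ε ≤ θ → (∀ j < ε, Q j f (f j)) →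
      k.CohChain src ε (fun i => (f i).1) (fun i => (f i).2) := by
    intro f ε hε hf
    have key : ∀ j, j < ε → ∀ l < j, (∀ a, k.le ((f l).1 a) ((f j).1 a)) ∧
        ∀ a, ∀ y ∈ (src a l).carrier, (f j).2 a y = (f l).2 a y := by
      intro j
      induction j using WellFoundedLT.induction with
      | ind i ih =>
      rcases Ordinal.zero_or_succ_or_isSuccLimit i with rfl | ⟨j, rfl⟩ | hjl
      · exact fun _ l hl => absurd hl not_lt_zero
      · intro hj l hl
        have hj' : j < ε := (Order.lt_succ j).trans hj
        obtain ⟨h1, h2, -⟩ := (hf _ hj).2.1 j rfl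
        rcases (Order.lt_succ_iff.1 hl).eq_or_lt with rfl | hlt
        · exact ⟨h1, h2⟩
        · obtain ⟨h3, h4⟩ := ih j (Order.lt_succ j) hj' l hlt
          exact ⟨fun a => hk.trans _ _ _ (h3 a) (h1 a), fun a y hy =>
            (h2 a y (hsrc a l j hlt (hj'.trans_le hε) hy)).trans (h4 a y hy)⟩
      · intro hj l hl
        obtain ⟨h1, h2⟩ := (hf _ hj).2.2.1 hjl
        refine ⟨fun a => ?_, fun a y hy => h2 a l hl y hy⟩
        have hc : k.IncCont (fun i => (f i).1 a) i :=
          ⟨fun i i' hi hi' => (ih i' hi' (hi'.trans hj) i hi).1 a, fun δ hδ hδj =>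
            (((hf _ (hδj.trans hj)).2.2.1 hδ).1 a).2⟩
        exact (hc.le_union hk hjl (h1 a)).2 l hl
    exact ⟨fun a => ⟨fun i j hij hj => (key j hj i hij).1 a, fun δ hδ hδε =>
      (((hf _ hδε).2.2.1 hδ).1 a).2⟩, fun i j hij hj a => (key j hj i hij).2 a⟩
  have : Nonempty St := ⟨(P₀, τ₀)⟩
  obtain ⟨f, hf⟩ : ∃ f : Ordinal.{u} → St, ∀ i < θ, Q i f (f i) := by
    refine exists_recursion θ Q ?_ ?_
    · rintro i f g x hfg ⟨h1, h2, h3, h4⟩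
      refine ⟨h1, fun j hj => ?_, fun hi => ?_, h4⟩
      · rw [← hfg j (hj ▸ Order.lt_succ j)]
        exact h2 j hj
      · obtain ⟨h5, h6⟩ := h3 hi
        refine ⟨fun a => ⟨fun j hj => ?_, ?_⟩, fun a j hj y hy => ?_⟩
        · beta_reduce
          rw [← hfg j hj]
          exact (h5 a).1 j hj
        · rw [(h5 a).2]
          exact Set.iUnion₂_congr fun j hj => by beta_reduce; rw [hfg j hj]
        · rw [← hfg j hj]
          exact h6 a j hj y hy
    · intro i hi f hf
      have hc := spec f i hi.le hf
      rcases Ordinal.zero_or_succ_or_isSuccLimit i with rfl | ⟨j, rfl⟩ | hlim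
      · exact ⟨(P₀, τ₀), fun _ => rfl, fun j hj => absurd hj.symm (Order.succ_ne_bot j),
          fun h => absurd h Order.not_isSuccLimit_bot, h0⟩
      · obtain ⟨P', τ', h1, h2, h3, h4⟩ := hs j (f j).1 (f j).2 hi (hf j (Order.lt_succ j)).2.2.2
        refine ⟨(P', τ'), fun h => absurd h (Order.succ_ne_bot j), fun j' hj' => ?_,
          fun h => absurd h (Order.not_isSuccLimit_succ j), h3⟩
        obtain rfl := Order.succ_injective hj'
        exact ⟨h1, h2, h4⟩
      · have hU : ∀ a, ∃ M : Model L, IsUnion M (fun j => (f j).1 a) i := fun a =>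
          exists_isUnion hlim fun l j hlj hj => hk.sub_of_le _ _ ((hc.chain a).1 l j hlj hj)
        have hT : ∀ a, ∃ σ : Equiv.Perm ZFSet.{u}, ∀ j < i, ∀ x ∈ (src a j).carrier,
            σ x = (f j).2 a x := fun a =>
          exists_perm_limit (fun l j hlj hj => hsrc a l j hlj (hj.trans hi))
            fun l j hlj hj => hc.coh l j hlj hj a
        choose U hU using hU
        choose T hT using hT
        refine ⟨(U, T), fun h => absurd h hlim.ne_bot, fun j hj => ?_, fun _ => ⟨hU, hT⟩, ?_⟩
        · exact absurd (hj ▸ hlim) (Order.not_isSuccLimit_succ j)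
        -- The limit stage is not yet a value of `f`, so `hl` is applied to `f` with the unions `U`
        -- and `T` inserted at `i`.
        · have := hl i (Function.update (fun j => (f j).1) i U)
            (Function.update (fun j => (f j).2) i T) hlim hi ⟨fun a => ⟨?_, ?_⟩, ?_⟩ ?_ ?_ ?_
          · simpa using this
          · intro l j hlj hj
            rcases (Order.lt_succ_iff.1 hj).eq_or_lt with rfl | hlt
            · simpa [hlj.ne] using ((hc.chain a).le_union hk hlim (hU a)).2 l hlj
            · simpa [hlt.ne, (hlj.trans hlt).ne] using (hc.chain a).1 l j hlj hlt
          · intro δ hδ hδi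
            have hδi := Order.lt_succ_iff.1 hδi
            have e1 : (⋃ j ∈ Set.Iio δ, (Function.update (fun j => (f j).1) i U j a).carrier) =
                ⋃ j ∈ Set.Iio δ, ((f j).1 a).carrier :=
              Set.iUnion₂_congr fun j hj => by
                rw [Function.update_of_ne (lt_of_lt_of_le hj hδi).ne]
            simp only at e1 ⊢
            rw [e1]
            rcases hδi.eq_or_lt with rfl | hlt
            · simpa using (hU a).2
            · simpa [hlt.ne] using (hc.chain a).2 δ hδ hlt
          · intro l j hlj hj a
            rcases (Order.lt_succ_iff.1 hj).eq_or_lt with rfl | hlt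
            · simpa [hlj.ne] using hT a l hlj
            · simpa [hlt.ne, (hlj.trans hlt).ne] using hc.coh l j hlj hlt a
          · intro j hj
            simpa [hj.ne] using (hf j hj).2.2.2
          · rw [Function.update_of_ne (show (0 : Ordinal.{u}) ≠ i from hlim.bot_lt.ne)]
            simp [(hf 0 hlim.bot_lt).1 rfl]
          · rw [Function.update_of_ne (show (0 : Ordinal.{u}) ≠ i from hlim.bot_lt.ne)]
            simp [(hf 0 hlim.bot_lt).1 rfl]
  -- For `θ = 0` the recursion says nothing about stage `0`, whose values are nevertheless
  -- prescribed.
  by_cases hθ : θ = 0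
  · subst hθ
    refine ⟨fun _ => P₀, fun _ => τ₀, ⟨fun a => ⟨?_, ?_⟩, ?_⟩, rfl, rfl, ?_, ?_⟩
    · exact fun i j _ hj => absurd hj not_lt_zero
    · exact fun i _ hj => absurd hj not_lt_zero
    · exact fun i j _ hj => absurd hj not_lt_zero
    · exact fun i hj => absurd hj not_lt_zero
    · exact fun i hj => absurd hj not_lt_zero
  have e0 := (hf 0 (pos_iff_ne_zero.2 hθ)).1 rfl
  exact ⟨fun i => (f i).1, fun i => (f i).2, spec f θ le_rfl hf, by simp [e0], by simp [e0],
    fun i hi => (hf i hi).2.2.2, fun i hi => ((hf _ hi).2.1 i rfl).2.2⟩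

end OrderedClass

end SemiGood

namespace SemiGood
open Model OrderedClass

variable {L : FirstOrder.Language.{u, u}}

theorem perm_inv_apply (σ : Equiv.Perm ZFSet.{u}) (x : ZFSet.{u}) : σ⁻¹ (σ x) = x :=
  σ.symm_apply_apply x

theorem perm_apply_inv (σ : Equiv.Perm ZFSet.{u}) (x : ZFSet.{u}) : σ (σ⁻¹ x) = x :=
  σ.apply_symm_apply x

namespace OrderedClass

variable {k : OrderedClass L} {ι ι' : Type*}

theorem IncCont.limit_le (hk : k.IsAEC) {c : Ordinal.{u} → Model L} {θ δ : Ordinal.{u}}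
    (hc : k.IncCont c θ) (hδ : Order.IsSuccLimit δ) (hθ : δ < θ) {N : Model L}
    (hN : ∀ i < δ, k.le (c i) N) : k.le (c δ) N :=
  hk.smooth δ c _ N hδ (hc.mono hθ.le) (hc.isUnion hk hδ hθ) hN

/-- Smoothness of the class, applied to the image of the source chain under the limit map. -/
theorem CohChain.limit_le (hk : k.IsAEC) {src : ι → Ordinal.{u} → Model L} {δ : Ordinal.{u}}
    {P : Ordinal.{u} → ι' → Model L} {τ : Ordinal.{u} → ι → Equiv.Perm ZFSet.{u}}
    (h : k.CohChain src (Order.succ δ) P τ) (hδ : Order.IsSuccLimit δ) {a : ι} {b : ι'}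
    (hc : k.IncCont (src a) (Order.succ δ)) (hle : ∀ i < δ, k.le (τ i a • src a i) (P i b)) :
    k.le (τ δ a • src a δ) (P δ b) := by
  refine (hc.smul hk (τ δ a)).limit_le hk hδ (Order.lt_succ δ) fun i hi => ?_
  rw [smul_congr (h.coh i δ hi (Order.lt_succ δ) a)]
  exact hk.trans _ _ _ (hle i hi) ((h.chain b).1 i δ hi (Order.lt_succ δ))

end OrderedClass

/-! ### Towers of basic types and their free lifts -/

namespace PreFrame

/-- An increasing continuous chain in `K_κ`, each step of which adds a realization of a basic
type. -/
structure Tower (s : PreFrame L) (κ : Cardinal.{u}) (α : Ordinal.{u})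
    (x : Ordinal.{u} → Model L) (a : Ordinal.{u} → ZFSet.{u}) : Prop where
  lt : α < (Order.succ κ).ord
  cont : s.IncCont x (Order.succ α)
  mem : ∀ i ≤ α, x i ∈ s.KC κ
  elt : ∀ i < α, a i ∈ (x (Order.succ i)).carrier
  bs : ∀ i < α, s.tp (a i) (x i) (x (Order.succ i)) ∈ s.Sbs (x i)

/-- The chain `y` lies above the tower `(x, a)`, and the elements `a i` are free from `y i` over
`x i`. -/
structure FreeOver (s : PreFrame L) (κ : Cardinal.{u}) (α : Ordinal.{u})
    (x : Ordinal.{u} → Model L) (a : Ordinal.{u} → ZFSet.{u}) (y : Ordinal.{u} → Model L) :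
    Prop where
  base : s.Tower κ α x a
  cont : s.IncCont y (Order.succ α)
  mem : ∀ i ≤ α, y i ∈ s.KC κ
  le : ∀ i ≤ α, s.le (x i) (y i)
  nf : ∀ i < α, s.nf (x i) (y i) (a i) (y (Order.succ i))

/-- All steps of the tower are uniqueness triples. -/
def UqTower (s : PreFrame L) (κ : Cardinal.{u}) (α : Ordinal.{u})
    (x : Ordinal.{u} → Model L) (a : Ordinal.{u} → ZFSet.{u}) : Prop :=
  s.Tower κ α x a ∧ ∀ i < α, s.K3uq κ (x i) (x (Order.succ i)) (a i)

variable {s : PreFrame L} {κ : Cardinal.{u}}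

theorem Tower.le_succ {α : Ordinal.{u}} {x : Ordinal.{u} → Model L} {a : Ordinal.{u} → ZFSet.{u}}
    (h : s.Tower κ α x a) {i : Ordinal.{u}} (hi : i < α) : s.le (x i) (x (Order.succ i)) :=
  h.cont.1 _ _ (Order.lt_succ i) (Order.succ_lt_succ hi)

namespace IsWSFrame

theorem chain_le (h : s.IsWSFrame κ) {α : Ordinal.{u}} {x : Ordinal.{u} → Model L}
    (hc : s.IncCont x (Order.succ α)) (hm : ∀ i ≤ α, x i ∈ s.KC κ) {i j : Ordinal.{u}}
    (hij : i ≤ j) (hj : j ≤ α) : s.le (x i) (x j) :=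
  hc.le h.aec hij (Order.lt_succ_of_le hj) (hm i (hij.trans hj)).1

theorem tower_smul (h : s.IsWSFrame κ) {α : Ordinal.{u}} {x : Ordinal.{u} → Model L}
    {a : Ordinal.{u} → ZFSet.{u}} (hx : s.Tower κ α x a) (σ : Equiv.Perm ZFSet.{u}) :
    s.Tower κ α (fun i => σ • x i) (fun i => σ (a i)) where
  lt := hx.lt
  cont := hx.cont.smul h.aec σ
  mem i hi := h.aec.smul_mem_KC σ (hx.mem i hi)
  elt i hi := mem_smul.2 (hx.elt i hi)
  bs i hi := h.tp_smul_mem (hx.mem i hi.le) (hx.le_succ hi) (hx.elt i hi) (hx.bs i hi) σ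

theorem freeOver_smul (h : s.IsWSFrame κ) {α : Ordinal.{u}} {x y : Ordinal.{u} → Model L}
    {a : Ordinal.{u} → ZFSet.{u}} (hx : s.FreeOver κ α x a y) (σ : Equiv.Perm ZFSet.{u}) :
    s.FreeOver κ α (fun i => σ • x i) (fun i => σ (a i)) (fun i => σ • y i) where
  base := h.tower_smul hx.base σ
  cont := hx.cont.smul h.aec σ
  mem i hi := h.aec.smul_mem_KC σ (hx.mem i hi)
  le i hi := h.aec.smul_le_smul σ (hx.le i hi)
  nf i hi := h.nf_smul (hx.nf i hi) σ

theorem tower_top (h : s.IsWSFrame κ) {α : Ordinal.{u}} {x y : Ordinal.{u} → Model L}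
    {a : Ordinal.{u} → ZFSet.{u}} (hx : s.FreeOver κ α x a y) : s.Tower κ α y a where
  lt := hx.base.lt
  cont := hx.cont
  mem := hx.mem
  elt i hi := h.aec.subset (hx.le _ (Order.succ_le_of_lt hi)) (hx.base.elt i hi)
  bs i hi := (h.good.nf_basic _ _ _ _ (hx.nf i hi)).2.2.2.2.2.2.2.2

theorem freeOver_trans (h : s.IsWSFrame κ) {α : Ordinal.{u}} {x y z : Ordinal.{u} → Model L}
    {a : Ordinal.{u} → ZFSet.{u}} (hxy : s.FreeOver κ α x a y) (hyz : s.FreeOver κ α y a z) :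
    s.FreeOver κ α x a z where
  base := hxy.base
  cont := hyz.cont
  mem := hyz.mem
  le i hi := h.aec.trans _ _ _ (hxy.le i hi) (hyz.le i hi)
  nf i hi := h.nf_trans (hyz.mem _ (Order.succ_le_of_lt hi))
    (h.nf_up (hxy.nf i hi) (hyz.le _ (Order.succ_le_of_lt hi))) (hyz.nf i hi)

theorem freeOver_refl (h : s.IsWSFrame κ) {α : Ordinal.{u}} {x : Ordinal.{u} → Model L}
    {a : Ordinal.{u} → ZFSet.{u}} (hx : s.Tower κ α x a) : s.FreeOver κ α x a x where
  base := hx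
  cont := hx.cont
  mem := hx.mem
  le i hi := h.aec.refl _ (hx.mem i hi).1
  nf i hi := h.nf_refl (hx.mem i hi.le) (hx.mem _ (Order.succ_le_of_lt hi)) (hx.le_succ hi)
    (hx.elt i hi) (hx.bs i hi)

theorem nf_limit (h : s.IsWSFrame κ) {c : Ordinal.{u} → Model L} {δ : Ordinal.{u}}
    {N : Model L} {b : ZFSet.{u}} (hδ : Order.IsSuccLimit δ) (hδκ : δ < (Order.succ κ).ord)
    (hc : s.IncCont c (Order.succ δ)) (hm : ∀ i ≤ δ, c i ∈ s.KC κ) (hN : N ∈ s.KC κ)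
    (hle : s.le (c δ) N) (hn : ∀ i < δ, s.nf (c 0) (c i) b N) : s.nf (c 0) (c δ) b N := by
  have hb : b ∈ N.carrier := (h.good.nf_basic _ _ _ _ (hn 0 hδ.bot_lt)).2.2.2.2.2.1
  refine h.nf_of_dnf hN hle hb ((h.good.continuity δ c hδ hδκ hc hm _ ⟨N, b, hle, hb, rfl⟩
    fun i hi => ?_).2)
  rw [h.aec.restr_tp (hc.1 i δ hi (Order.lt_succ δ))]
  exact dnf_of_nf (hn i hi)

theorem cohChain_mem_KC (h : s.IsWSFrame κ) {ι ι' : Type*} {src : ι → Ordinal.{u} → Model L}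
    {δ : Ordinal.{u}} {P : Ordinal.{u} → ι' → Model L}
    {τ : Ordinal.{u} → ι → Equiv.Perm ZFSet.{u}} (hc : s.CohChain src (Order.succ δ) P τ)
    (hδ : Order.IsSuccLimit δ) (hδκ : δ < (Order.succ κ).ord) {b : ι'}
    (hP : ∀ i < δ, P i b ∈ s.KC κ) : P δ b ∈ s.KC κ :=
  h.union_mem_KC hδ hδκ ((hc.chain b).mono (Order.le_succ δ)) hP
    ((hc.chain b).isUnion h.aec hδ (Order.lt_succ δ))

/-- A tower can be lifted freely over any extension of its bottom. -/
theorem exists_freeOver (h : s.IsWSFrame κ) {α : Ordinal.{u}} {x : Ordinal.{u} → Model L}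
    {a : Ordinal.{u} → ZFSet.{u}} (hx : s.Tower κ α x a) {M : Model L} (hM : M ∈ s.KC κ)
    (σ₀ : Equiv.Perm ZFSet.{u}) (h0 : s.le (σ₀ • x 0) M) :
    ∃ (σ : Equiv.Perm ZFSet.{u}) (y : Ordinal.{u} → Model L),
      (∀ v ∈ (x 0).carrier, σ v = σ₀ v) ∧
      s.FreeOver κ α (fun i => σ • x i) (fun i => σ (a i)) y ∧ y 0 = M := by
  refine Exists.elim (h.aec.exists_cohChain (ι := Unit) (ι' := Unit)
    (θ := Order.succ α) (src := fun _ => x)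
    (fun _ i j hij hj => h.aec.subset (hx.cont.1 i j hij hj))
    (fun i P τ => P () ∈ s.KC κ ∧ s.le (τ () • x i) (P ()))
    (fun i P τ P' τ' => s.nf (τ () • x i) (P ()) (τ' () (a i)) (P' ()))
    (fun _ => M) (fun _ => σ₀) ⟨hM, h0⟩ ?_ ?_) ?_
  · rintro i P τ hi ⟨h1, h2⟩
    have hi' : i < α := Order.succ_lt_succ_iff.1 hi
    obtain ⟨P', hP', τ', h3, h4, h5, h6⟩ := h.nf_ext (τ ()) (hx.mem i hi'.le) h1
      (hx.mem _ (Order.succ_le_of_lt hi')) (hx.le_succ hi') (hx.elt i hi') (hx.bs i hi') h2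
    exact ⟨fun _ => P', fun _ => τ', fun _ => h5, fun _ => h3, ⟨hP', h4⟩, h6⟩
  · intro δ P τ hδ hδα hc hInv _ _
    have hδα := Order.lt_succ_iff.1 hδα
    refine ⟨h.cohChain_mem_KC hc hδ (hδα.trans_lt hx.lt) fun i hi => (hInv i hi).1,
      hc.limit_le h.aec hδ (hx.cont.mono (Order.succ_le_succ hδα)) fun i hi => (hInv i hi).2⟩
  · rintro P ⟨τ, hc, hP0, hτ0, hInv, hStep⟩
    refine ⟨τ α (), fun i => P i (), fun v hv => ?_, ⟨h.tower_smul hx _, hc.chain (), fun i hi =>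
      (hInv i (Order.lt_succ_of_le hi)).1, fun i hi => ?_, fun i hi => ?_⟩, by simp only [hP0]⟩
    · rw [hc.coh' zero_le (Order.lt_succ α) () hv, hτ0]
    · rw [smul_congr fun v hv => hc.coh' hi (Order.lt_succ α) () hv]
      exact (hInv i (Order.lt_succ_of_le hi)).2
    · rw [smul_congr fun v hv => hc.coh' hi.le (Order.lt_succ α) () hv,
        hc.coh' (Order.succ_le_of_lt hi) (Order.lt_succ α) () (hx.elt i hi)]
      exact hStep i (Order.succ_lt_succ hi)

/-- A tower can be lifted freely so that moreover a given type over its bottom does not fork. -/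
theorem exists_freeOver_of_type (h : s.IsWSFrame κ) {α : Ordinal.{u}} {x : Ordinal.{u} → Model L}
    {a : Ordinal.{u} → ZFSet.{u}} (hx : s.Tower κ α x a) {N : Model L} {b : ZFSet.{u}}
    (hN : N ∈ s.KC κ) (h0 : s.le (x 0) N) (hb : b ∈ N.carrier)
    (hp : s.tp b (x 0) N ∈ s.Sbs (x 0)) :
    ∃ (σ : Equiv.Perm ZFSet.{u}) (y : Ordinal.{u} → Model L), (∀ v ∈ (x 0).carrier, σ v = v) ∧
      s.FreeOver κ α (fun i => σ • x i) (fun i => σ (a i)) y ∧ y 0 = N ∧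
      ∀ i ≤ α, s.nf (x 0) (σ • x i) b (y i) := by
  refine Exists.elim (h.aec.exists_cohChain (ι := Unit) (ι' := Unit)
    (θ := Order.succ α) (src := fun _ => x)
    (fun _ i j hij hj => h.aec.subset (hx.cont.1 i j hij hj))
    (fun i P τ => P () ∈ s.KC κ ∧ s.nf (x 0) (τ () • x i) b (P ()))
    (fun i P τ P' τ' => s.nf (τ () • x i) (P ()) (τ' () (a i)) (P' ()))
    (fun _ => N) (fun _ => 1) ⟨hN, by
      rw [one_smul]; exact h.nf_refl (hx.mem 0 zero_le) hN h0 hb hp⟩ ?_ ?_) ?_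
  · rintro i P τ hi ⟨h1, h2⟩
    have hi' : i < α := Order.succ_lt_succ_iff.1 hi
    obtain ⟨-, h3, -, h4, h5, h6, -, -, h7⟩ := h.good.nf_basic _ _ _ _ h2
    -- Here `a i` and `b` realize basic types over the copy of `x i`, and they are amalgamated so
    -- that each is free from the other side. One half continues the free lift; the other, by
    -- transitivity, keeps `b` free over `x 0` from the next stage of the tower.
    obtain ⟨P', hP', σ, h8, h9, h10, h11, h12⟩ := h.sym_amalg h3
      (h.aec.smul_mem_KC (τ ()) (hx.mem _ (Order.succ_le_of_lt hi'))) h1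
      (h.aec.smul_le_smul _ (hx.le_succ hi')) h5 (mem_smul.2 (hx.elt i hi')) h6
      (h.tp_smul_mem (hx.mem i hi'.le) (hx.le_succ hi') (hx.elt i hi') (hx.bs i hi') _) h7
    refine ⟨fun _ => P', fun _ => σ * τ (), fun _ => h10, fun _ v hv => h8 _ (mem_smul.2 hv),
      ⟨hP', ?_⟩, h11⟩
    rw [mul_smul]
    exact h.nf_trans hP' (h.nf_up h2 h10) h12
  · intro δ P τ hδ hδα hc hInv hP0 hτ0
    have hδα := Order.lt_succ_iff.1 hδα
    have hx' := hx.cont.mono (Order.succ_le_succ hδα)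
    have hPδ := h.cohChain_mem_KC hc hδ (hδα.trans_lt hx.lt) fun i hi => (hInv i hi).1
    have hle := hc.limit_le h.aec hδ hx' (b := ()) fun i hi =>
      (h.good.nf_basic _ _ _ _ (hInv i hi).2).2.2.2.2.1
    have e0 : τ δ () • x 0 = x 0 := by
      refine smul_eq_self fun v hv => ?_
      rw [hc.coh 0 δ hδ.bot_lt (Order.lt_succ δ) () v hv, hτ0]
      rfl
    refine ⟨hPδ, ?_⟩
    have := h.nf_limit (b := b) hδ (hδα.trans_lt hx.lt) (hx'.smul h.aec (τ δ ()))
      (fun i hi => h.aec.smul_mem_KC _ (hx.mem i (hi.trans hδα))) hPδ hle fun i hi => ?_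
    · simpa only [e0] using this
    · rw [e0, smul_congr (hc.coh i δ hi (Order.lt_succ δ) ())]
      exact h.nf_up (hInv i hi).2 ((hc.chain ()).1 i δ hi (Order.lt_succ δ))
  · rintro P ⟨τ, hc, hP0, hτ0, hInv, hStep⟩
    refine ⟨τ α (), fun i => P i (), fun v hv => ?_, ⟨h.tower_smul hx _, hc.chain (), fun i hi =>
      (hInv i (Order.lt_succ_of_le hi)).1, fun i hi => ?_, fun i hi => ?_⟩, by simp only [hP0],
      fun i hi => ?_⟩
    · rw [hc.coh' zero_le (Order.lt_succ α) () hv, hτ0]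
      rfl
    · rw [smul_congr fun v hv => hc.coh' hi (Order.lt_succ α) () hv]
      exact (h.good.nf_basic _ _ _ _ (hInv i (Order.lt_succ_of_le hi)).2).2.2.2.2.1
    · rw [smul_congr fun v hv => hc.coh' hi.le (Order.lt_succ α) () hv,
        hc.coh' (Order.succ_le_of_lt hi) (Order.lt_succ α) () (hx.elt i hi)]
      exact hStep i (Order.succ_lt_succ hi)
    · rw [smul_congr fun v hv => hc.coh' hi (Order.lt_succ α) () hv]
      exact (hInv i (Order.lt_succ_of_le hi)).2

/-! ### Uniqueness triples -/

/-- The definition of a uniqueness triple, with the extension itself allowed to move. Conjugating by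
`τ⁻¹` and `ρ⁻¹` brings both copies of `N` into place, and `τ⁻¹ * ρ` becomes the required isomorphism
over `M` between the two copies of `P`. -/
theorem uq_amalg (h : s.IsWSFrame κ) {M N P Q Q' : Model L} {a : ZFSet.{u}}
    (hu : s.K3uq κ M N a) {τ ρ : Equiv.Perm ZFSet.{u}} (hQ : Q ∈ s.KC κ) (hQ' : Q' ∈ s.KC κ)
    (hτρ : ∀ v ∈ M.carrier, τ v = ρ v) (h1 : s.le (τ • N) Q) (h2 : s.le (ρ • N) Q')
    (hn1 : s.nf (τ • M) P (τ a) Q) (hn2 : s.nf (ρ • M) P (ρ a) Q') :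
    ∃ R ∈ s.KC κ, ∃ ξ : Equiv.Perm ZFSet.{u}, s.le Q R ∧ s.le (ξ • Q') R ∧
      (∀ v ∈ P.carrier, ξ v = v) ∧ ∀ v ∈ N.carrier, ξ (ρ v) = τ v := by
  have aux : ∀ (τ : Equiv.Perm ZFSet.{u}) (Q : Model L), Q ∈ s.KC κ → s.le (τ • N) Q →
      s.nf (τ • M) P (τ a) Q → s.leBs κ M N (τ⁻¹ • P) (τ⁻¹ • Q) a := by
    intro τ Q hQ h1 hn1
    have hn := h.nf_smul hn1 τ⁻¹
    rw [inv_smul_smul, perm_inv_apply] at hn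
    obtain ⟨b1, b2, b3, b4, b5, b6, b7, b8, b9⟩ := h.good.nf_basic _ _ _ _ hn
    exact ⟨hu.1, ⟨b2, h.aec.smul_mem_KC _ hQ, b5, b6, b7, b9⟩, b4, h.aec.smul_le_iff.1 h1, hn⟩
  obtain ⟨f, hf⟩ := exists_iso (M := ρ⁻¹ • P) (N := τ⁻¹ • P) (σ := τ⁻¹ * ρ) (by
    rw [mul_smul, smul_inv_smul])
  obtain ⟨R, hR, f₁, f₂, hf₁, hf₂, ho₁, ho₂, hff⟩ := hu.2 _ _ _ _ f (aux ρ Q' hQ' h2 hn2)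
    (aux τ Q hQ h1 hn1) (fun v hv => by
      rw [hf, Equiv.Perm.mul_apply, Equiv.Perm.inv_eq_iff_eq, hτρ _ hv])
  obtain ⟨σ₁, h3, h4⟩ := h.aec.exists_perm_of_isStrong hf₁
  obtain ⟨σ₂, h5, h6⟩ := h.aec.exists_perm_of_isStrong hf₂
  have hPQ := (h.good.nf_basic _ _ _ _ hn1).2.2.2.2.1
  have hPQ' := (h.good.nf_basic _ _ _ _ hn2).2.2.2.2.1
  refine ⟨(τ * σ₂⁻¹) • R, h.aec.smul_mem_KC _ hR, τ * σ₂⁻¹ * σ₁ * ρ⁻¹, ?_, ?_, ?_, ?_⟩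
  · have := h.aec.smul_le_smul (τ * σ₂⁻¹) h5
    simpa [mul_smul] using this
  · have := h.aec.smul_le_smul (τ * σ₂⁻¹) h3
    simpa [mul_smul] using this
  · intro v hv
    have hv1 : ρ⁻¹ v ∈ (ρ⁻¹ • P).carrier := mem_smul.2 hv
    have hv2 : τ⁻¹ v ∈ (τ⁻¹ • P).carrier := mem_smul.2 hv
    have := congrArg Subtype.val (hff ⟨_, hv1⟩ ⟨_, h.aec.subset (h.aec.smul_le_smul _ hPQ') hv1⟩
      ⟨_, h.aec.subset (h.aec.smul_le_smul _ hPQ) hv2⟩ rfl (by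
        rw [hf, Equiv.Perm.mul_apply, perm_apply_inv]))
    rw [h4, h6] at this
    simp only [Equiv.Perm.mul_apply]
    rw [this, perm_inv_apply, perm_apply_inv]
  · intro v hv
    have hv1 : v ∈ (ρ⁻¹ • Q').carrier := h.aec.subset (h.aec.smul_le_iff.1 h2) hv
    have hv2 : v ∈ (τ⁻¹ • Q).carrier := h.aec.subset (h.aec.smul_le_iff.1 h1) hv
    have e1 : σ₁ v = v := (h4 ⟨v, hv1⟩).symm.trans (ho₁ ⟨v, hv1⟩ hv)
    have e2 : σ₂ v = v := (h6 ⟨v, hv2⟩).symm.trans (ho₂ ⟨v, hv2⟩ hv)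
    simp only [Equiv.Perm.mul_apply]
    rw [perm_inv_apply, e1]
    congr 1
    rw [Equiv.Perm.inv_eq_iff_eq, e2]

theorem K3bs_smul (h : s.IsWSFrame κ) {M N : Model L} {a : ZFSet.{u}} (hb : s.K3bs κ M N a)
    (σ : Equiv.Perm ZFSet.{u}) : s.K3bs κ (σ • M) (σ • N) (σ a) := by
  obtain ⟨h1, h2, h3, h4, h5, h6⟩ := hb
  exact ⟨h.aec.smul_mem_KC σ h1, h.aec.smul_mem_KC σ h2, h.aec.smul_le_smul σ h3, mem_smul.2 h4,
    fun hm => h5 (mem_smul.1 hm), h.tp_smul_mem h1 h3 h4 h6 σ⟩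

theorem K3uq_smul (h : s.IsWSFrame κ) {M N : Model L} {a : ZFSet.{u}} (hu : s.K3uq κ M N a)
    (σ : Equiv.Perm ZFSet.{u}) : s.K3uq κ (σ • M) (σ • N) (σ a) := by
  refine ⟨h.K3bs_smul hu.1 σ, fun M₁ N₁ M₂ N₂ f h1 h2 hf => ?_⟩
  obtain ⟨φ, hφ, hfφ⟩ := exists_perm_iso f
  have hn1 := h.nf_smul h1.2.2.2.2 φ
  rw [hφ] at hn1
  have hφM : ∀ v ∈ M.carrier, φ (σ v) = σ v := fun v hv => by
    have hv1 : σ v ∈ M₁.carrier := h.aec.subset h1.2.2.1 (mem_smul.2 hv)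
    rw [← hfφ ⟨σ v, hv1⟩]
    exact hf ⟨σ v, hv1⟩ (mem_smul.2 hv)
  obtain ⟨R, hR, ξ, h3, h4, h5, h6⟩ := h.uq_amalg hu (P := M₂) (Q := N₂) (Q' := φ • N₁)
    (τ := σ) (ρ := φ * σ) h2.2.1.2.1
    (h.aec.smul_mem_KC _ h1.2.1.2.1) (fun v hv => (hφM v hv).symm) h2.2.2.2.1
    (by rw [mul_smul]; exact h.aec.smul_le_smul φ h1.2.2.2.1) h2.2.2.2.2
    (by rw [mul_smul]; exact hn1)
  rw [← mul_smul] at h4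
  obtain ⟨f₁, hf₁, hf₁'⟩ := h.aec.exists_isStrong h4
  obtain ⟨f₂, hf₂, hf₂'⟩ := h.aec.exists_isStrong (M := N₂) (N := R) (σ := 1) (by simpa using h3)
  refine ⟨R, hR, f₁, f₂, hf₁, hf₂, ?_, ?_, ?_⟩
  · rintro ⟨v, hv⟩ hvN
    rw [hf₁']
    obtain ⟨w, hw, rfl⟩ := hvN
    exact h6 w hw
  · intro v _
    rw [hf₂']
    rfl
  · intro v y z hy hz
    apply Subtype.ext
    rw [hf₁', hf₂', hy, hz, hfφ, Equiv.Perm.mul_apply, Equiv.Perm.one_apply]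
    apply h5
    rw [← hfφ]
    exact (f v).2

theorem uqTower_smul (h : s.IsWSFrame κ) {α : Ordinal.{u}} {x : Ordinal.{u} → Model L}
    {a : Ordinal.{u} → ZFSet.{u}} (hx : s.UqTower κ α x a) (σ : Equiv.Perm ZFSet.{u}) :
    s.UqTower κ α (fun i => σ • x i) (fun i => σ (a i)) :=
  ⟨h.tower_smul hx.1 σ, fun i hi => h.K3uq_smul (hx.2 i hi) σ⟩

/-- Free lifts of a tower of uniqueness triples are unique. -/
theorem freeOver_unique (h : s.IsWSFrame κ) {α : Ordinal.{u}} {x y z : Ordinal.{u} → Model L}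
    {a : Ordinal.{u} → ZFSet.{u}} {θ : Equiv.Perm ZFSet.{u}} (hx : s.UqTower κ α x a)
    (hy : s.FreeOver κ α x a y)
    (hz : s.FreeOver κ α (fun i => θ • x i) (fun i => θ (a i)) z)
    {P₀ : Model L} (hP₀ : P₀ ∈ s.KC κ) {τ₀ ρ₀ : Equiv.Perm ZFSet.{u}} (hτ₀ : s.le (τ₀ • y 0) P₀)
    (hρ₀ : s.le (ρ₀ • z 0) P₀) (h0 : ∀ v ∈ (x 0).carrier, τ₀ v = ρ₀ (θ v)) :
    ∃ P ∈ s.KC κ, ∃ τ ρ : Equiv.Perm ZFSet.{u}, s.le P₀ P ∧ s.le (τ • y α) P ∧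
      s.le (ρ • z α) P ∧ (∀ v ∈ (x α).carrier, τ v = ρ (θ v)) ∧
      (∀ v ∈ (y 0).carrier, τ v = τ₀ v) ∧ ∀ v ∈ (z 0).carrier, ρ v = ρ₀ v := by
  let src : Bool → Ordinal.{u} → Model L := fun e => cond e y z
  refine Exists.elim (h.aec.exists_cohChain (ι := Bool) (ι' := Unit)
    (θ := Order.succ α) (src := src)
    (fun e i j hij hj => by
      cases e
      · exact h.aec.subset (hz.cont.1 i j hij hj)
      · exact h.aec.subset (hy.cont.1 i j hij hj))
    (fun i P τ => P () ∈ s.KC κ ∧ s.le (τ true • y i) (P ()) ∧ s.le (τ false • z i) (P ()) ∧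
      ∀ v ∈ (x i).carrier, τ true v = τ false (θ v))
    (fun _ _ _ _ _ => True)
    (fun _ => P₀) (fun e => cond e τ₀ ρ₀) ⟨hP₀, hτ₀, hρ₀, h0⟩ ?_ ?_) ?_
  · rintro i P τ hi ⟨h1, h2, h3, h4⟩
    have hi' : i < α := Order.succ_lt_succ_iff.1 hi
    have hsi := Order.succ_le_of_lt hi'
    have hyt := h.tower_top hy
    have hzt := h.tower_top hz
    -- The next models of both lifts are put over the current target with `a i` free from it over
    -- the copies of `y i` and `z i`. By transitivity it is free over the copy of `x i`, where the
    -- uniqueness triple makes the two copies of `x (i + 1)` coincide.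
    obtain ⟨Q, hQ, τ', a1, a2, a3, a4⟩ := h.nf_ext (τ true) (hy.mem i hi'.le) h1
      (hy.mem _ hsi) (hyt.le_succ hi') (hyt.elt i hi') (hyt.bs i hi') h2
    obtain ⟨Q', hQ', ρ', b1, b2, b3, b4⟩ := h.nf_ext (τ false) (hz.mem i hi'.le) h1
      (hz.mem _ hsi) (hzt.le_succ hi') (hzt.elt i hi') (hzt.bs i hi') h3
    have c1 : s.nf (τ' • x i) (P ()) (τ' (a i)) Q := by
      rw [← smul_congr a1] at a4
      exact h.nf_trans hQ (h.nf_up (h.nf_smul (hy.nf i hi') τ') a2) a4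
    have c2 : s.nf ((ρ' * θ) • x i) (P ()) ((ρ' * θ) (a i)) Q' := by
      rw [← smul_congr b1] at b4
      rw [mul_smul]
      exact h.nf_trans hQ' (h.nf_up (h.nf_smul (hz.nf i hi') ρ') b2) b4
    obtain ⟨R, hR, ξ, d1, d2, d3, d4⟩ := h.uq_amalg (hx.2 i hi') hQ hQ' (τ := τ') (ρ := ρ' * θ)
      (fun v hv => by
        rw [a1 v (h.aec.subset (hy.le i hi'.le) hv), h4 v hv, Equiv.Perm.mul_apply,
          b1 _ (h.aec.subset (hz.le i hi'.le) (mem_smul.2 hv))])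
      (h.aec.trans _ _ _ (h.aec.smul_le_smul _ (hy.le _ hsi)) a2)
      (by rw [mul_smul]; exact h.aec.trans _ _ _ (h.aec.smul_le_smul _ (hz.le _ hsi)) b2) c1 c2
    refine ⟨fun _ => R, fun e => cond e τ' (ξ * ρ'), fun _ => h.aec.trans _ _ _ a3 d1, ?_,
      ⟨hR, h.aec.trans _ _ _ a2 d1, ?_, fun v hv => (d4 v hv).symm⟩, trivial⟩
    · rintro (_ | _) v hv
      · have := d3 _ (h.aec.subset h3 (mem_smul.2 hv))
        simp only [cond_false, Equiv.Perm.mul_apply]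
        rw [b1 v hv, this]
      · exact a1 v hv
    · simp only [cond_false, mul_smul]
      exact h.aec.trans _ _ _ (h.aec.smul_le_smul ξ b2) d2
  · intro δ P τ hδ hδα hc hInv _ _
    have hδα := Order.lt_succ_iff.1 hδα
    refine ⟨h.cohChain_mem_KC hc hδ (hδα.trans_lt hx.1.lt) fun i hi => (hInv i hi).1,
      hc.limit_le (a := true) h.aec hδ (hy.cont.mono (Order.succ_le_succ hδα))
        fun i hi => (hInv i hi).2.1,
      hc.limit_le (a := false) h.aec hδ (hz.cont.mono (Order.succ_le_succ hδα))
        fun i hi => (hInv i hi).2.2.1, fun v hv => ?_⟩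
    obtain ⟨i, hi, hv⟩ := (mem_limit_iff hx.1.cont hδ (Order.lt_succ_of_le hδα)).1 hv
    rw [hc.coh i δ hi (Order.lt_succ δ) true v (h.aec.subset (hy.le i (hi.le.trans hδα)) hv),
      hc.coh i δ hi (Order.lt_succ δ) false (θ v)
        (h.aec.subset (hz.le i (hi.le.trans hδα)) (mem_smul.2 hv))]
    exact (hInv i hi).2.2.2 v hv
  · rintro P ⟨τ, hc, hP0, hτ0, hInv, -⟩
    obtain ⟨h1, h2, h3, h4⟩ := hInv α (Order.lt_succ α)
    refine ⟨P α (), h1, τ α true, τ α false, ?_, h2, h3, h4, fun v hv => ?_, fun v hv => ?_⟩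
    · have := (hc.chain ()).le h.aec (zero_le (a := α)) (Order.lt_succ α) (by rw [hP0]; exact hP₀.1)
      rwa [hP0] at this
    · rw [hc.coh' (a := true) zero_le (Order.lt_succ α) hv, hτ0]
      rfl
    · rw [hc.coh' (a := false) zero_le (Order.lt_succ α) hv, hτ0]
      rfl

end IsWSFrame

end PreFrame

end SemiGood

namespace SemiGood
open Model OrderedClass

variable {L : FirstOrder.Language.{u, u}}

/-! ### Closure points below a successor cardinal -/

/-- Regularity of `κ⁺`. -/
theorem exists_lt_of_card_le {κ : Cardinal.{u}} (hκ : ℵ₀ ≤ κ) {β : Type (u + 1)}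
    (hβ : #β ≤ Cardinal.lift.{u + 1} κ) (f : β → Ordinal.{u})
    (hf : ∀ b, f b < (Order.succ κ).ord) : ∃ ε < (Order.succ κ).ord, ∀ b, f b < ε := by
  have hs : Small.{u} β := by
    rw [Cardinal.small_iff_lift_mk_lt_univ]
    rw [Cardinal.lift_id]
    exact hβ.trans_lt (Cardinal.lift_lt_univ κ)
  have hcof : #(Set.range f) < Cardinal.lift.{u + 1} (Order.succ κ).ord.cof := by
    rw [(Cardinal.isRegular_succ hκ).cof_ord]
    exact (Cardinal.mk_range_le.trans hβ).trans_lt (Cardinal.lift_lt.2 (Order.lt_succ κ))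
  rw [Ordinal.lift_cof] at hcof
  have hlt := Ordinal.sSup_lt_of_lt_cof (s := Set.range f) hcof (by rintro _ ⟨b, rfl⟩; exact hf b)
  refine ⟨Order.succ (sSup (Set.range f)),
    (Cardinal.isSuccLimit_ord (hκ.trans (Order.le_succ κ))).succ_lt hlt, fun b =>
    Order.lt_succ_of_le (le_csSup ?_ ⟨b, rfl⟩)⟩
  exact Ordinal.bddAbove_of_small

/-- Iterate `ω` times a function that strictly increases and bounds all values of `F` at arguments
up to the given one. The supremum stays below `κ⁺` because its cofinality is uncountable. -/
theorem exists_closed {κ : Cardinal.{u}} (hκ : ℵ₀ ≤ κ) (F : Ordinal.{u} → Ordinal.{u})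
    (hF : ∀ i < (Order.succ κ).ord, F i < (Order.succ κ).ord) {β : Ordinal.{u}}
    (hβ : β < (Order.succ κ).ord) :
    ∃ δ < (Order.succ κ).ord, Order.IsSuccLimit δ ∧ β < δ ∧ ∀ i < δ, F i < δ := by
  have hlim := Cardinal.isSuccLimit_ord (hκ.trans (Order.le_succ κ))
  have h1 : ∀ i : Ordinal.{u}, ∃ j, i < (Order.succ κ).ord →
      (j < (Order.succ κ).ord ∧ i < j ∧ ∀ l ≤ i, F l < j) := by
    intro i
    by_cases hi : i < (Order.succ κ).ord
    · obtain ⟨ε, hε, hb⟩ := exists_lt_of_card_le hκ (β := Set.Iio (Order.succ i)) (by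
        rw [Cardinal.mk_Iio_ordinal, Cardinal.lift_le]
        exact Order.lt_succ_iff.1 (Cardinal.lt_ord.1 (hlim.succ_lt hi))) (fun l => F l)
        (fun l => hF _ ((Order.lt_succ_iff.1 l.2).trans_lt hi))
      exact ⟨max (Order.succ i) ε, fun _ => ⟨max_lt (hlim.succ_lt hi) hε,
        (Order.lt_succ i).trans_le (le_max_left _ _), fun l hl =>
        (hb ⟨l, Order.lt_succ_of_le hl⟩).trans_le (le_max_right _ _)⟩⟩
    · exact ⟨0, fun h => absurd h hi⟩
  choose G hG using h1
  let g : ℕ → Ordinal.{u} := fun n => G^[n] β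
  have hg : ∀ n, g n < (Order.succ κ).ord := fun n => by
    induction n with
    | zero => exact hβ
    | succ n ih =>
      simp only [g, Function.iterate_succ_apply'] at ih ⊢
      exact (hG _ ih).1
  have hgs : ∀ n, g (n + 1) = G (g n) := fun n => by simp only [g, Function.iterate_succ_apply']
  have hbdd : BddAbove (Set.range g) := ⟨(Order.succ κ).ord, by rintro _ ⟨n, rfl⟩; exact (hg n).le⟩
  have hlt : ∀ n, g n < ⨆ n, g n := fun n =>
    ((hG _ (hg n)).2.1.trans_eq (hgs n).symm).trans_le (le_ciSup hbdd (n + 1))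
  obtain ⟨ε, hε, hb⟩ := exists_lt_of_card_le hκ (β := ULift.{u + 1} ℕ) (by
    simpa using hκ) (fun n => g n.down) (fun n => hg _)
  refine ⟨⨆ n, g n, (ciSup_le fun n => (hb ⟨n⟩).le).trans_lt hε, ?_, hlt 0, fun i hi => ?_⟩
  · refine Order.isSuccLimit_iff_of_orderBot.2 ⟨(bot_le.trans_lt (hlt 0)).ne',
      Order.isSuccPrelimit_of_succ_lt fun i hi => ?_⟩
    obtain ⟨n, hn⟩ := exists_lt_of_lt_ciSup hi
    exact (Order.succ_le_of_lt hn).trans_lt (hlt n)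
  · obtain ⟨n, hn⟩ := exists_lt_of_lt_ciSup hi
    exact ((hG _ (hg n)).2.2 i hn.le).trans_eq (hgs n).symm |>.trans (hlt (n + 1))

namespace PreFrame

variable {s : PreFrame L} {κ : Cardinal.{u}}

namespace IsWSFrame

theorem isSuccLimit_ord (h : s.IsWSFrame κ) : Order.IsSuccLimit (Order.succ κ).ord :=
  Cardinal.isSuccLimit_ord (h.inf.trans (Order.le_succ κ))

theorem exists_subset_of_chain (h : s.IsWSFrame κ) {c : Ordinal.{u} → Model L}
    (hc : ∀ i j, i ≤ j → j < (Order.succ κ).ord → (c i).carrier ⊆ (c j).carrier)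
    {A : Set ZFSet.{u}} (hA : #A ≤ Cardinal.lift.{u + 1} κ)
    (hAc : ∀ v ∈ A, ∃ i < (Order.succ κ).ord, v ∈ (c i).carrier) :
    ∃ i < (Order.succ κ).ord, A ⊆ (c i).carrier := by
  choose! f hf hfc using hAc
  obtain ⟨ε, hε, hb⟩ := exists_lt_of_card_le h.inf hA (fun v => f v) fun v => hf v v.2
  exact ⟨ε, hε, fun v hv => hc _ _ (hb ⟨v, hv⟩).le hε (hfc v hv)⟩

/-- Any element added to a large chain is caught at bounded stages, so there is a stage closed
under catching. -/
theorem exists_catch (h : s.IsWSFrame κ) {c d : Ordinal.{u} → Model L}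
    (hc : ∀ i j, i ≤ j → j < (Order.succ κ).ord → (c i).carrier ⊆ (c j).carrier)
    (hd : ∀ i < (Order.succ κ).ord, #(d i).carrier ≤ Cardinal.lift.{u + 1} κ) :
    ∃ F : Ordinal.{u} → Ordinal.{u}, (∀ i < (Order.succ κ).ord, F i < (Order.succ κ).ord) ∧
      ∀ i < (Order.succ κ).ord, ∀ v ∈ (d i).carrier, ∀ j < (Order.succ κ).ord,
        v ∈ (c j).carrier → v ∈ (c (F i)).carrier := by
  have : ∀ i : Ordinal.{u}, ∃ l, i < (Order.succ κ).ord → (l < (Order.succ κ).ord ∧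
      ∀ v ∈ (d i).carrier, ∀ j < (Order.succ κ).ord, v ∈ (c j).carrier → v ∈ (c l).carrier) := by
    intro i
    by_cases hi : i < (Order.succ κ).ord
    · obtain ⟨l, hl, hA⟩ := h.exists_subset_of_chain hc
        (A := {v ∈ (d i).carrier | ∃ j < (Order.succ κ).ord, v ∈ (c j).carrier})
        ((Cardinal.mk_le_mk_of_subset (Set.sep_subset _ _)).trans (hd i hi))
        (fun v hv => hv.2)
      exact ⟨l, fun _ => ⟨hl, fun v hv j hj hvj => hA ⟨hv, j, hj, hvj⟩⟩⟩
    · exact ⟨0, fun h => absurd h hi⟩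
  choose F hF using this
  exact ⟨F, fun i hi => (hF i hi).1, fun i hi => (hF i hi).2⟩

/-! ### Decompositions into uniqueness triples -/

/-- Weak success yields a uniqueness triple with the type of some `a ∈ N`. Amalgamating over `M`
moves its element onto `a` itself, so the triple makes progress inside `N`. -/
theorem exists_K3uq_of_lt (h : s.IsWSFrame κ) {M N : Model L} (hM : M ∈ s.KC κ) (hN : N ∈ s.KC κ)
    (hMN : s.lt M N) : ∃ a ∈ N.carrier, ∃ M' ∈ s.KC κ, ∃ N' ∈ s.KC κ,
      s.K3uq κ M M' a ∧ s.le M' N' ∧ s.le N N' := by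
  obtain ⟨a, ha, haM, hp⟩ := h.good.density M hM N hN hMN
  obtain ⟨N', a', he, hu⟩ := h.ws M N a ⟨hM, hN, hMN.1, ha, haM, hp⟩
  obtain ⟨R, hR, σ, h1, h2, h3, h4⟩ := h.tp_amalg' he hM hu.1.2.1 hN hu.1.2.2.1 hu.1.2.2.2.1 hMN.1 ha
  have := h.K3uq_smul hu σ
  rw [smul_eq_self h1, h2] at this
  exact ⟨a, ha, _, this.1.2.1, R, hR, this, h3, h4⟩

/-- Two chains start at `M` and at `N`, the first inside the second. While they differ, the lower
one swallows an element of the upper one by a uniqueness triple. They meet before `κ⁺`: at a stage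
`δ` closed under catching, the element swallowed would come from an earlier upper model, and so
would already lie in the lower model at `δ`. -/
theorem exists_uqTower_aux (h : s.IsWSFrame κ) {M N : Model L} (hM : M ∈ s.KC κ) (hN : N ∈ s.KC κ)
    (hMN : s.le M N) :
    ∃ α x a, s.UqTower κ α x a ∧ x 0 = M ∧ s.le N (x α) := by
  refine Exists.elim (h.aec.exists_cohChain (ι := PEmpty.{1}) (ι' := Bool)
    (θ := (Order.succ κ).ord) (src := fun e => e.elim) (fun e => e.elim)
    (fun i P _ => P false ∈ s.KC κ ∧ P true ∈ s.KC κ ∧ s.le (P false) (P true))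
    (fun i P _ P' _ => P false = P true ∨ ∃ a ∈ (P true).carrier, s.K3uq κ (P false) (P' false) a)
    (fun e => cond e N M) (fun e => e.elim) ⟨hM, hN, hMN⟩ ?_ ?_) ?_
  · rintro i P - hi ⟨h1, h2, h3⟩
    by_cases he : P false = P true
    · exact ⟨P, fun e => e.elim, fun e => h.aec.refl _ (by cases e; exacts [h1.1, h2.1]),
        fun e => e.elim, ⟨h1, h2, h3⟩, Or.inl he⟩
    · obtain ⟨a, ha, M', hM', N', hN', hu, h4, h5⟩ := h.exists_K3uq_of_lt h1 h2 ⟨h3, he⟩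
      refine ⟨fun e => cond e N' M', fun e => e.elim, ?_, fun e => e.elim, ⟨hM', hN', h4⟩,
        Or.inr ⟨a, ha, hu⟩⟩
      rintro (_ | _)
      exacts [hu.1.2.2.1, h5]
  · intro δ P τ hδ hδκ hc hInv _ _
    refine ⟨h.cohChain_mem_KC hc hδ hδκ fun i hi => (hInv i hi).1,
      h.cohChain_mem_KC hc hδ hδκ fun i hi => (hInv i hi).2.1, ?_⟩
    exact (hc.chain false).limit_le h.aec hδ (Order.lt_succ δ) fun i hi =>
      h.aec.trans _ _ _ (hInv i hi).2.2 ((hc.chain true).1 i δ hi (Order.lt_succ δ))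
  · rintro P ⟨τ, hc, hP0, -, hInv, hStep⟩
    have hle : ∀ e i j, i ≤ j → j < (Order.succ κ).ord → s.le (P i e) (P j e) := by
      intro e i j hij hj
      refine (hc.chain e).le h.aec hij hj ?_
      cases e
      exacts [(hInv i (hij.trans_lt hj)).1.1, (hInv i (hij.trans_lt hj)).2.1.1]
    have hex : ∃ δ, δ < (Order.succ κ).ord ∧ P δ false = P δ true := by
      obtain ⟨F, hF, hFc⟩ := h.exists_catch (c := fun i => P i false) (d := fun i => P i true)
        (fun i j hij hj => h.aec.subset (hle false i j hij hj)) (fun i hi => (hInv i hi).2.1.2.le)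
      obtain ⟨δ, hδ, hlim, -, hcl⟩ := exists_closed h.inf F hF h.isSuccLimit_ord.bot_lt
      have hδ' := h.isSuccLimit_ord.succ_lt hδ
      refine ⟨δ, hδ, ?_⟩
      rcases hStep δ hδ' with h1 | ⟨a, ha, hu⟩
      · exact h1
      · obtain ⟨i, hi, hai⟩ := (mem_limit_iff (hc.chain true) hlim hδ).1 ha
        exact absurd (h.aec.subset (hle false _ _ (hcl i hi).le hδ)
          (hFc i (hi.trans hδ) a hai _ hδ' hu.1.2.2.2.1)) hu.1.2.2.2.2.1
    classical
    -- Before the first meeting point every step added a uniqueness triple.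
    obtain ⟨α, ⟨hα, he⟩, hmin⟩ := WellFounded.has_min Ordinal.lt_wf
      {δ | δ < (Order.succ κ).ord ∧ P δ false = P δ true} hex
    have hst : ∀ i, ∃ a, i < α → s.K3uq κ (P i false) (P (Order.succ i) false) a := by
      intro i
      by_cases hi : i < α
      · rcases hStep i (h.isSuccLimit_ord.succ_lt (hi.trans hα)) with h1 | ⟨a, -, hu⟩
        · exact absurd hi (hmin i ⟨hi.trans hα, h1⟩)
        · exact ⟨a, fun _ => hu⟩
      · exact ⟨∅, fun h => absurd h hi⟩
    choose a ha using hst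
    refine ⟨α, fun i => P i false, a, ⟨⟨hα, (hc.chain false).mono (Order.succ_le_of_lt hα),
      fun i hi => (hInv i (hi.trans_lt hα)).1, fun i hi => (ha i hi).1.2.2.2.1,
      fun i hi => (ha i hi).1.2.2.2.2.2⟩, ha⟩, by simp only [hP0, cond_false], ?_⟩
    change s.le N (P α false)
    rw [he]
    have := hle true 0 α zero_le hα
    rwa [hP0] at this

theorem incCont_update {k : OrderedClass L} {x : Ordinal.{u} → Model L} {γ : Ordinal.{u}}
    (hx : k.IncCont x (Order.succ γ)) {N : Model L} (hN : ∀ i ≤ γ, k.le (x i) N) :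
    k.IncCont (Function.update x (Order.succ γ) N) (Order.succ (Order.succ γ)) := by
  refine ⟨fun i j hij hj => ?_, fun δ hδ hj => ?_⟩
  · rcases (Order.lt_succ_iff.1 hj).eq_or_lt with rfl | hlt
    · rw [Function.update_self, Function.update_of_ne hij.ne]
      exact hN i (Order.lt_succ_iff.1 hij)
    · rw [Function.update_of_ne hlt.ne, Function.update_of_ne (hij.trans hlt).ne]
      exact hx.1 i j hij hlt
  · rcases (Order.lt_succ_iff.1 hj).eq_or_lt with rfl | hlt
    · exact absurd hδ (Order.not_isSuccLimit_succ γ)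
    · rw [Function.update_of_ne hlt.ne, hx.2 δ hδ hlt]
      exact Set.iUnion₂_congr fun i hi => by
        rw [Function.update_of_ne (lt_trans (Set.mem_Iio.1 hi) hlt).ne]

/-- Every extension can be further extended to one which is decomposed, in successor many steps,
into uniqueness triples. -/
theorem exists_uqTower (h : s.IsWSFrame κ) {M N : Model L} (hM : M ∈ s.KC κ) (hN : N ∈ s.KC κ)
    (hMN : s.le M N) :
    ∃ γ x a, s.UqTower κ (Order.succ γ) x a ∧ x 0 = M ∧ s.le N (x (Order.succ γ)) := by
  obtain ⟨γ, x, a, hx, hx0, hxN⟩ := h.exists_uqTower_aux hM hN hMN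
  -- One more triple on top makes the length a successor, so that the top of a free lift can later
  -- be enlarged without violating continuity.
  obtain ⟨N₁, hN₁, hlt⟩ := h.good.no_max _ (hx.1.mem γ le_rfl)
  obtain ⟨b, -, M', hM', -, -, hu, -, -⟩ := h.exists_K3uq_of_lt (hx.1.mem γ le_rfl) hN₁ hlt
  have hγM := hu.1.2.2.1
  have e1 : ∀ i ≤ γ, Function.update x (Order.succ γ) M' i = x i := fun i hi =>
    Function.update_of_ne (Order.lt_succ_of_le hi).ne _ _
  have e2 : ∀ i < γ, Function.update a γ b i = a i := fun i hi => Function.update_of_ne hi.ne _ _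
  have key : ∀ i < Order.succ γ, s.K3uq κ (Function.update x (Order.succ γ) M' i)
      (Function.update x (Order.succ γ) M' (Order.succ i)) (Function.update a γ b i) := by
    intro i hi
    rcases (Order.lt_succ_iff.1 hi).eq_or_lt with rfl | hlt
    · rw [e1 i le_rfl, Function.update_self, Function.update_self]
      exact hu
    · rw [e1 i hlt.le, e2 i hlt, e1 _ (Order.succ_le_of_lt hlt)]
      exact hx.2 i hlt
  refine ⟨γ, Function.update x (Order.succ γ) M', Function.update a γ b, ⟨⟨
    h.isSuccLimit_ord.succ_lt hx.1.lt, incCont_update hx.1.cont fun i hi =>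
      h.aec.trans _ _ _ (h.chain_le hx.1.cont hx.1.mem hi le_rfl) hγM, fun i hi => ?_,
      fun i hi => (key i hi).1.2.2.2.1, fun i hi => (key i hi).1.2.2.2.2.2⟩, key⟩, ?_, ?_⟩
  · rcases hi.eq_or_lt with rfl | hlt
    · rw [Function.update_self]
      exact hM'
    · rw [e1 i (Order.lt_succ_iff.1 hlt)]
      exact hx.1.mem i (Order.lt_succ_iff.1 hlt)
  · rw [e1 0 zero_le, hx0]
  · rw [Function.update_self]
    exact h.aec.trans _ _ _ hxN hγM

/-! ### Rows of free lifts -/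

theorem freeOver_congr {α : Ordinal.{u}} {x y y' : Ordinal.{u} → Model L}
    {a : Ordinal.{u} → ZFSet.{u}} (hx : s.FreeOver κ α x a y) (hyy : ∀ i ≤ α, y i = y' i) :
    s.FreeOver κ α x a y' where
  base := hx.base
  cont := ⟨fun i j hij hj => by
      rw [← hyy i (hij.le.trans (Order.lt_succ_iff.1 hj)), ← hyy j (Order.lt_succ_iff.1 hj)]
      exact hx.cont.1 i j hij hj,
    fun δ hδ hj => by
      rw [← hyy δ (Order.lt_succ_iff.1 hj), hx.cont.2 δ hδ hj]
      exact Set.iUnion₂_congr fun i hi => by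
        rw [hyy i ((le_of_lt hi).trans (Order.lt_succ_iff.1 hj))]⟩
  mem i hi := hyy i hi ▸ hx.mem i hi
  le i hi := hyy i hi ▸ hx.le i hi
  nf i hi := by
    rw [← hyy _ (Order.succ_le_of_lt hi), ← hyy i hi.le]
    exact hx.nf i hi

/-- In column `i`, continuity along `j ↦ r j i` shows that `a i` is free from `r δ i` over `r 0 i`;
transitivity replaces this base by `x i`. Continuity of the limit row comes from interchanging two
unions. -/
theorem freeOver_limit (h : s.IsWSFrame κ) {α δ : Ordinal.{u}} {x : Ordinal.{u} → Model L}
    {a : Ordinal.{u} → ZFSet.{u}} {r : Ordinal.{u} → Ordinal.{u} → Model L}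
    (hδ : Order.IsSuccLimit δ) (hδκ : δ < (Order.succ κ).ord)
    (hr : ∀ i ≤ α, s.IncCont (fun j => r j i) (Order.succ δ))
    (hf : ∀ j < δ, s.FreeOver κ α x a (r j)) : s.FreeOver κ α x a (r δ) := by
  have hf0 := hf 0 hδ.bot_lt
  have hle : ∀ i ≤ α, ∀ j < δ, s.le (r j i) (r δ i) := fun i hi j hj =>
    (hr i hi).1 j δ hj (Order.lt_succ δ)
  have hmem : ∀ i ≤ α, r δ i ∈ s.KC κ := fun i hi =>
    h.union_mem_KC hδ hδκ ((hr i hi).mono (Order.le_succ δ)) (fun j hj => (hf j hj).mem i hi)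
      ((hr i hi).isUnion h.aec hδ (Order.lt_succ δ))
  have hinc : ∀ i j, i < j → j ≤ α → s.le (r δ i) (r δ j) := fun i j hij hj =>
    (hr i (hij.le.trans hj)).limit_le h.aec hδ (Order.lt_succ δ) fun l hl =>
      h.aec.trans _ _ _ ((hf l hl).cont.1 i j hij (Order.lt_succ_of_le hj)) (hle j hj l hl)
  refine ⟨hf0.base, ⟨fun i j hij hj => hinc i j hij (Order.lt_succ_iff.1 hj), fun ε hε hεα => ?_⟩,
    hmem, fun i hi => h.aec.trans _ _ _ (hf0.le i hi) (hle i hi 0 hδ.bot_lt), fun i hi => ?_⟩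
  · have hεα := Order.lt_succ_iff.1 hεα
    ext v
    simp only [Set.mem_iUnion, Set.mem_Iio, exists_prop]
    constructor
    · intro hv
      obtain ⟨j, hj, hv⟩ := (mem_limit_iff (hr ε hεα) hδ (Order.lt_succ δ)).1 hv
      obtain ⟨i, hi, hv⟩ := (mem_limit_iff (hf j hj).cont hε (Order.lt_succ_of_le hεα)).1 hv
      exact ⟨i, hi, h.aec.subset (hle i (hi.le.trans hεα) j hj) hv⟩
    · rintro ⟨i, hi, hv⟩
      exact h.aec.subset (hinc i ε hi hεα) hv
  · have hsi := Order.succ_le_of_lt hi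
    have hup : ∀ j < δ, s.nf (x i) (r j i) (a i) (r δ (Order.succ i)) := fun j hj =>
      h.nf_up ((hf j hj).nf i hi) (hle _ hsi j hj)
    refine h.nf_trans (hmem _ hsi) (hup 0 hδ.bot_lt) ?_
    refine h.nf_limit (c := fun j => r j i) hδ hδκ (hr i hi.le) (fun j hj => ?_) (hmem _ hsi)
      (hinc i _ (Order.lt_succ i) hsi) fun j hj => ?_
    · rcases hj.eq_or_lt with rfl | hlt
      · exact hmem i hi.le
      · exact (hf j hlt).mem i hi.le
    · refine h.nf_base (hup j hj) (hf0.le i hi.le) ?_ (h.aec.refl _ ((hf j hj).mem i hi.le).1)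
      exact (hr i hi.le).le h.aec zero_le (hj.trans (Order.lt_succ δ)) (hf0.mem i hi.le).1

/-- A family indexed by `i ≤ α`, extended to all ordinals by its last value. -/
noncomputable def row {α : Ordinal.{u}} (P : Set.Iic α → Model L) (i : Ordinal.{u}) : Model L :=
  P ⟨min i α, min_le_right i α⟩

theorem row_coe {α : Ordinal.{u}} (P : Set.Iic α → Model L) (i : Set.Iic α) : row P i = P i := by
  have : (⟨min i.1 α, min_le_right i.1 α⟩ : Set.Iic α) = i := Subtype.ext (min_eq_left i.2)
  rw [row, this]

theorem row_eq {α : Ordinal.{u}} (y : Ordinal.{u} → Model L) {i : Ordinal.{u}} (hi : i ≤ α) :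
    row (fun k : Set.Iic α => y k) i = y i := by
  change y (min i α) = y i
  rw [min_eq_left hi]

/-- Two towers over the same model have an amalgam which is free over both of them. -/
theorem exists_grid (h : s.IsWSFrame κ) {α β : Ordinal.{u}} {x y : Ordinal.{u} → Model L}
    {a b : Ordinal.{u} → ZFSet.{u}} (hx : s.Tower κ α x a) (hy : s.Tower κ β y b)
    (h0 : x 0 = y 0) :
    ∃ (σ : Equiv.Perm ZFSet.{u}) (w v : Ordinal.{u} → Model L), (∀ z ∈ (x 0).carrier, σ z = z) ∧
      s.FreeOver κ α (fun i => σ • x i) (fun i => σ (a i)) w ∧ w 0 = y β ∧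
      s.FreeOver κ β y b v ∧ v 0 = σ • x α ∧ v β = w α := by
  refine Exists.elim (h.aec.exists_cohChain (ι := Unit) (ι' := Set.Iic α)
    (θ := Order.succ β) (src := fun _ => y)
    (fun _ i j hij hj => h.aec.subset (hy.cont.1 i j hij hj))
    (fun j P τ => s.FreeOver κ α x a (row P) ∧ τ () • y j = row P 0)
    (fun j P τ P' τ' => s.nf (row P 0) (row P α) (τ' () (b j)) (row P' α))
    (fun i => x i) (fun _ => 1)
    ⟨freeOver_congr (h.freeOver_refl hx) fun i hi => (row_eq x hi).symm, by
      rw [one_smul, row_eq x zero_le, h0]⟩ ?_ ?_) ?_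
  · rintro j P τ hj ⟨h1, h2⟩
    have hj' : j < β := Order.succ_lt_succ_iff.1 hj
    have hsj := Order.succ_le_of_lt hj'
    have hp := h.tp_smul_mem (hy.mem j hj'.le) (hy.le_succ hj') (hy.elt j hj') (hy.bs j hj') (τ ())
    have hle := h.aec.smul_le_smul (τ ()) (hy.le_succ hj')
    rw [h2] at hp hle
    -- The whole current row is lifted over the next member of `y`, with `b j` kept free from the
    -- row. The lift moves the row by `σ`; conjugating with `σ⁻¹` keeps the row in place and moves
    -- the copy of `y (j + 1)` instead.
    obtain ⟨σ, y', h3, h4, h5, h6⟩ := h.exists_freeOver_of_type (h.tower_top h1)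
      (h.aec.smul_mem_KC _ (hy.mem _ hsj)) hle (mem_smul.2 (hy.elt j hj')) hp
    have h4' := h.freeOver_smul h4 σ⁻¹
    simp only [inv_smul_smul, perm_inv_apply] at h4'
    have hr : ∀ i ≤ α, row (fun k : Set.Iic α => σ⁻¹ • y' k) i = σ⁻¹ • y' i := fun i hi =>
      row_eq (fun i => σ⁻¹ • y' i) hi
    have h4'' := freeOver_congr h4' fun i hi => (hr i hi).symm
    have h3' : σ • row P 0 = row P 0 := smul_eq_self h3
    have h3i : σ⁻¹ • row P 0 = row P 0 := by rw [inv_smul_eq_iff, h3']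
    refine ⟨fun k => σ⁻¹ • y' k, fun _ => σ⁻¹ * τ (), fun k => ?_, fun _ v hv => ?_,
      ⟨h.freeOver_trans h1 h4'', ?_⟩, ?_⟩
    · have := h4'.le k k.2
      rwa [row_coe] at this
    · rw [Equiv.Perm.mul_apply, Equiv.Perm.inv_eq_iff_eq, h3]
      rw [← h2]
      exact mem_smul.2 hv
    · rw [mul_smul, hr 0 zero_le, h5]
    · rw [hr α le_rfl, Equiv.Perm.mul_apply]
      have := h.nf_smul (h6 α le_rfl) σ⁻¹
      rwa [h3i, inv_smul_smul] at this
  · intro δ P τ hδ hδβ hc hInv _ _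
    have hδβ := Order.lt_succ_iff.1 hδβ
    have hfree := h.freeOver_limit hδ (hδβ.trans_lt hy.lt) (r := fun j => row (P j))
      (fun i hi => hc.chain ⟨min i α, min_le_right i α⟩) fun j hj => (hInv j hj).1
    refine ⟨hfree, ?_⟩
    have hle : s.le (τ δ () • y δ) (row (P δ) 0) :=
      hc.limit_le h.aec hδ (hy.cont.mono (Order.succ_le_succ hδβ))
        (b := ⟨min 0 α, min_le_right 0 α⟩) fun j hj => by
          rw [(hInv j hj).2]
          exact h.aec.refl _ ((hInv j hj).1.mem 0 zero_le).1
    refine h.aec.eq_of_subset hle fun v hv => ?_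
    obtain ⟨j, hj, hv⟩ := (mem_limit_iff (hc.chain ⟨min 0 α, min_le_right 0 α⟩) hδ
      (Order.lt_succ δ)).1 hv
    have e : P j ⟨min 0 α, min_le_right 0 α⟩ = τ j () • y j := (hInv j hj).2.symm
    rw [e, ← smul_congr (hc.coh j δ hj (Order.lt_succ δ) ())] at hv
    exact smul_subset.2 (h.aec.subset (hy.cont.1 j δ hj (Order.lt_succ_of_le hδβ))) hv
  · rintro P ⟨τ, hc, hP0, hτ0, hInv, hStep⟩
    set g := τ β () with hg
    have hcoh : ∀ j ≤ β, τ j () • y j = g • y j := fun j hj =>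
      (smul_congr fun v hv => hc.coh' hj (Order.lt_succ β) () hv).symm
    have hrow : ∀ j ≤ β, g⁻¹ • row (P j) 0 = y j := fun j hj => by
      rw [← (hInv j (Order.lt_succ_of_le hj)).2, hcoh j hj, inv_smul_smul]
    have hβ := hInv β (Order.lt_succ β)
    -- The construction fixed `x` and moved `y` by `g`; undoing `g` puts `y` back and moves `x`. The
    -- last row is `w`, the last column is `v`, and they meet in the corner.
    refine ⟨g⁻¹, fun i => g⁻¹ • row (P β) i, fun j => g⁻¹ • row (P j) α, fun z hz => ?_,
      h.freeOver_smul hβ.1 g⁻¹, hrow β le_rfl, ⟨hy, ?_, ?_, ?_, ?_⟩, ?_, rfl⟩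
    · rw [Equiv.Perm.inv_eq_iff_eq, hc.coh' zero_le (Order.lt_succ β) () (h0 ▸ hz), hτ0]
      rfl
    · exact (hc.chain ⟨min α α, min_le_right α α⟩).smul h.aec g⁻¹
    · exact fun j hj => h.aec.smul_mem_KC _ ((hInv j (Order.lt_succ_of_le hj)).1.mem α le_rfl)
    · intro j hj
      rw [← hrow j hj]
      have hI := (hInv j (Order.lt_succ_of_le hj)).1
      exact h.aec.smul_le_smul _ (h.chain_le hI.cont hI.mem zero_le le_rfl)
    · intro j hj
      have := h.nf_smul (hStep j (Order.succ_lt_succ hj)) g⁻¹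
      rw [hrow j hj.le, ← hc.coh' (Order.succ_le_of_lt hj) (Order.lt_succ β) () (hy.elt j hj),
        perm_inv_apply] at this
      exact this
    · simp only [hP0, row_eq x le_rfl]

end IsWSFrame

end PreFrame

end SemiGood

namespace SemiGood
open Model OrderedClass

variable {L : FirstOrder.Language.{u, u}}

namespace PreFrame

variable {s : PreFrame L} {κ : Cardinal.{u}}

namespace IsWSFrame

/-! ### Non-forking amalgamation -/

/-- With `nf_elim` this trades `NF` for a free lift of a tower of uniqueness triples that covers the
amalgam, the form in which `NF` is used below. -/
theorem nf_intro (h : s.IsWSFrame κ) {α : Ordinal.{u}} {x y : Ordinal.{u} → Model L}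
    {a : Ordinal.{u} → ZFSet.{u}} (hx : s.UqTower κ α x a) (hy : s.FreeOver κ α x a y)
    {M₁ M₂ M₃ : Model L} (h1 : M₁ ∈ s.KC κ) (h2 : M₂ ∈ s.KC κ) (h3 : M₃ ∈ s.KC κ)
    (h01 : s.le (x 0) M₁) (h02 : s.le (x 0) M₂) (h13 : s.le M₁ M₃) (h23 : s.le M₂ M₃)
    (h1x : s.le M₁ (x α)) (h2y : s.le M₂ (y 0)) (h3y : s.le M₃ (y α)) :
    s.NF κ (x 0) M₁ M₂ M₃ := by
  have hxα := h.chain_le hx.1.cont hx.1.mem (zero_le (a := α)) le_rfl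
  have hyα := h.chain_le hy.cont hy.mem (zero_le (a := α)) le_rfl
  refine ⟨hx.1.mem 0 zero_le, h1, h2, h3, h01, h13, h02, h23, x α, y 0, y α, h1x, h2y, h3y, hxα,
    hy.le α le_rfl, hy.le 0 zero_le, hyα, α, x, y, a, hx.1.lt, hx.1.cont, hy.cont, fun i hi =>
    ⟨hx.1.mem i hi, hy.mem i hi, hy.le i hi⟩, rfl, rfl, rfl, rfl, fun i hi => ?_⟩
  exact ⟨hx.1.elt i hi, (hx.2 i hi).1.2.2.2.2.1, hx.2 i hi, hy.nf i hi⟩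

theorem nf_elim {M₀ M₁ M₂ M₃ : Model L} (hn : s.NF κ M₀ M₁ M₂ M₃) :
    ∃ α x a y, s.UqTower κ α x a ∧ s.FreeOver κ α x a y ∧ x 0 = M₀ ∧ s.le M₁ (x α) ∧
      s.le M₂ (y 0) ∧ s.le M₃ (y α) := by
  obtain ⟨-, -, -, -, -, -, -, -, N₁, N₂, N₃, h1, h2, h3, -, -, -, -, α, x, y, a, hα, hx, hy, hm,
    e1, e2, e3, e4, hs⟩ := hn
  have hT : s.UqTower κ α x a := ⟨⟨hα, hx, fun i hi => (hm i hi).1, fun i hi => (hs i hi).1,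
    fun i hi => (hs i hi).2.2.1.1.2.2.2.2.2⟩, fun i hi => (hs i hi).2.2.1⟩
  exact ⟨α, x, a, y, hT, ⟨hT.1, hy, fun i hi => (hm i hi).2.1, fun i hi => (hm i hi).2.2,
    fun i hi => (hs i hi).2.2.2⟩, e1, e2 ▸ h1, e3 ▸ h2, e4 ▸ h3⟩

theorem NF_smul (h : s.IsWSFrame κ) {M₀ M₁ M₂ M₃ : Model L} (hn : s.NF κ M₀ M₁ M₂ M₃)
    (σ : Equiv.Perm ZFSet.{u}) : s.NF κ (σ • M₀) (σ • M₁) (σ • M₂) (σ • M₃) := by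
  obtain ⟨α, x, a, y, hx, hy, rfl, h1, h2, h3⟩ := nf_elim hn
  obtain ⟨b0, b1, b2, b3, b01, b13, b02, b23, -⟩ := hn
  exact h.nf_intro (h.uqTower_smul hx σ) (h.freeOver_smul hy σ) (h.aec.smul_mem_KC σ b1)
    (h.aec.smul_mem_KC σ b2) (h.aec.smul_mem_KC σ b3) (h.aec.smul_le_smul σ b01)
    (h.aec.smul_le_smul σ b02) (h.aec.smul_le_smul σ b13) (h.aec.smul_le_smul σ b23)
    (h.aec.smul_le_smul σ h1) (h.aec.smul_le_smul σ h2) (h.aec.smul_le_smul σ h3)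

/-- Covers of the larger sides also cover the smaller ones, so the same witnesses serve. -/
theorem NF_mono (h : s.IsWSFrame κ) {M₀ M₁ M₂ M₃ M₁' M₂' : Model L} (hn : s.NF κ M₀ M₁ M₂ M₃)
    (h01 : s.le M₀ M₁') (h02 : s.le M₀ M₂') (h1 : s.le M₁' M₁) (h2 : s.le M₂' M₂) :
    s.NF κ M₀ M₁' M₂' M₃ := by
  obtain ⟨b0, b1, b2, b3, b01, b13, b02, b23, N₁, N₂, N₃, c1, c2, c3, c4⟩ := hn
  exact ⟨b0, h.mem_KC_of_le_of_le b0 b1 h01 h1, h.mem_KC_of_le_of_le b0 b2 h02 h2, b3, h01,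
    h.aec.trans _ _ _ h1 b13, h02, h.aec.trans _ _ _ h2 b23, N₁, N₂, N₃,
    h.aec.trans _ _ _ h1 c1, h.aec.trans _ _ _ h2 c2, c3, c4⟩

/-- A free lift of a tower over `M` is compatible with every decomposition of an extension of `M`:
the roles of the two sides can be exchanged. -/
theorem exists_swap (h : s.IsWSFrame κ) {α β : Ordinal.{u}} {x u y : Ordinal.{u} → Model L}
    {a b : Ordinal.{u} → ZFSet.{u}} (hx : s.UqTower κ α x a) (hu : s.FreeOver κ α x a u)
    (hy : s.Tower κ β y b) (h0 : x 0 = y 0) (hle : s.le (u 0) (y β)) :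
    ∃ (σ η : Equiv.Perm ZFSet.{u}) (v : Ordinal.{u} → Model L), (∀ z ∈ (x 0).carrier, σ z = z) ∧
      s.FreeOver κ β y b v ∧ v 0 = σ • x α ∧ ∃ P ∈ s.KC κ, s.le (v β) P ∧ s.le (η • u α) P ∧
      (∀ z ∈ (x α).carrier, η z = σ z) ∧ ∀ z ∈ (u 0).carrier, η z = z := by
  obtain ⟨σ, w, v, h1, h2, h3, h4, h5, h6⟩ := h.exists_grid hx.1 hy h0
  have hK := hy.mem β le_rfl
  obtain ⟨P, hP, τ, ρ, c1, c2, c3, c4, c5, c6⟩ := h.freeOver_unique hx hu h2 hK (τ₀ := 1) (ρ₀ := 1)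
    (by rwa [one_smul]) (by rw [one_smul, h3]; exact h.aec.refl _ hK.1) (fun z hz => (h1 z hz).symm)
  refine ⟨σ, ρ⁻¹ * τ, v, h1, h4, h5, ρ⁻¹ • P, h.aec.smul_mem_KC _ hP, ?_, ?_, ?_, ?_⟩
  · rw [h6]
    exact h.aec.smul_le_iff.1 c3
  · rw [mul_smul]
    exact h.aec.smul_le_smul _ c2
  · intro z hz
    rw [Equiv.Perm.mul_apply, c4 z hz, perm_inv_apply]
  · intro z hz
    rw [Equiv.Perm.mul_apply, c5 z hz, Equiv.Perm.inv_eq_iff_eq, c6 z]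
    rw [h3]
    exact h.aec.subset hle hz

/-- The two amalgams come with unrelated decompositions of the `M₁` side, so uniqueness of lifts
does not apply directly. Exchanging sides turns both into free lifts of one common tower that covers
the `M₂` side of each. The copies of `M₁` then sit in the bottoms of these lifts, and
`freeOver_unique` for the common tower finishes. -/
theorem NF_unique_aux (h : s.IsWSFrame κ) {M₀ M₁ M₂ M₃ M₃' : Model L} {g : Equiv.Perm ZFSet.{u}}
    (hn : s.NF κ M₀ M₁ M₂ M₃) (hn' : s.NF κ M₀ (g • M₁) M₂ M₃')
    (hg : ∀ z ∈ M₀.carrier, g z = z) :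
    ∃ P ∈ s.KC κ, ∃ τ : Equiv.Perm ZFSet.{u}, s.le M₃' P ∧ s.le (τ • M₃) P ∧
      (∀ z ∈ M₁.carrier, τ z = g z) ∧ ∀ z ∈ M₂.carrier, τ z = z := by
  obtain ⟨α, x, a, u, hx, hu, x0, h1x, h2u, h3u⟩ := nf_elim hn
  obtain ⟨α', x', a', u', hx', hu', x0', h1x', h2u', h3u'⟩ := nf_elim hn'
  obtain ⟨b0, b1, b2, b3, b01, b13, b02, b23, -⟩ := hn
  obtain ⟨Q, hQ, ρ, hρ, hρu, huQ⟩ := h.amalg 1 b2 (hu'.mem 0 zero_le) (hu.mem 0 zero_le) h2u'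
    (by rwa [one_smul])
  have hρ : ∀ z ∈ M₂.carrier, ρ z = z := hρ
  have hρ0 : ∀ z ∈ M₀.carrier, ρ z = z := fun z hz => hρ z (h.aec.subset b02 hz)
  -- The common tower: its top contains `Q`, in which the bottoms of both lifts have been
  -- amalgamated over `M₂`.
  obtain ⟨γ, y, b, hy, y0, hQy⟩ := h.exists_uqTower b0 hQ
    (h.aec.trans _ _ _ b02 (h.aec.trans _ _ _ h2u huQ))
  set β := Order.succ γ
  obtain ⟨σ, η, v, c1, c2, c3, P, hP, c4, c5, c6, c7⟩ := h.exists_swap hx hu hy.1 (x0.trans y0.symm)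
    (h.aec.trans _ _ _ huQ hQy)
  obtain ⟨σ', η', v', d1, d2, d3, P', hP', d4, d5, d6, d7⟩ := h.exists_swap
    (h.uqTower_smul hx' ρ) (h.freeOver_smul hu' ρ) hy.1
    (by rw [x0', y0]; exact smul_eq_self hρ0) (h.aec.trans _ _ _ hρu hQy)
  have c1 : ∀ z ∈ M₀.carrier, σ z = z := x0 ▸ c1
  have d1 : ∀ z ∈ M₀.carrier, σ' z = z := fun z hz => d1 z (by
    rw [x0', ← hρ0 z hz]; exact mem_smul.2 hz)
  have hσM₁ : s.le (σ • M₁) (v 0) := by rw [c3]; exact h.aec.smul_le_smul σ h1x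
  have hσ'M₁ : s.le ((σ' * ρ * g) • M₁) (v' 0) := by
    rw [d3, mul_smul, mul_smul]
    exact h.aec.smul_le_smul σ' (h.aec.smul_le_smul ρ h1x')
  -- The bottoms of the exchanged lifts are amalgamated so that the two copies of `M₁` are
  -- identified in accordance with `g`.
  obtain ⟨P₀, hP₀, τ₀, e1, e2, e3⟩ := h.amalg (σ' * ρ * g * σ⁻¹) (h.aec.smul_mem_KC σ b1)
    (c2.mem 0 zero_le) (d2.mem 0 zero_le) hσM₁ (by
      rw [mul_smul _ σ⁻¹, inv_smul_smul]; exact hσ'M₁)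
  have e1' : ∀ z ∈ M₁.carrier, τ₀ (σ z) = σ' (ρ (g z)) := fun z hz => by
    rw [e1 _ (mem_smul.2 hz)]
    simp only [Equiv.Perm.mul_apply]
    rw [perm_inv_apply]
  obtain ⟨R, hR, τ, ρ', f1, f2, f3, f4, f5, f6⟩ := h.freeOver_unique hy c2 (θ := 1) (z := v')
    (by simpa using d2) hP₀ (τ₀ := τ₀) (ρ₀ := 1) e2 (by rwa [one_smul]) (fun z hz => by
      rw [y0] at hz
      have := e1' z (h.aec.subset b01 hz)
      rw [c1 z hz, hg z hz, hρ0 z hz, d1 z hz] at this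
      exact this)
  have f4 : ∀ z ∈ (y β).carrier, τ z = ρ' z := f4
  have f6 : ∀ z ∈ (v' 0).carrier, ρ' z = z := f6
  obtain ⟨R', hR', τ', g1, g2, g3⟩ := h.amalg τ (c2.mem β le_rfl) hP hR c4 f2
  obtain ⟨R'', hR'', ρ'', k1, k2, k3⟩ := h.amalg ρ' (d2.mem β le_rfl) hP' hR' d4
    (h.aec.trans _ _ _ f3 g3)
  have hvle := h.aec.subset (h.chain_le c2.cont c2.mem (zero_le (a := β)) le_rfl)
  have hvle' := h.aec.subset (h.chain_le d2.cont d2.mem (zero_le (a := β)) le_rfl)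
  refine ⟨(ρ'' * η' * ρ)⁻¹ • R'', h.aec.smul_mem_KC _ hR'', (ρ'' * η' * ρ)⁻¹ * (τ' * η), ?_, ?_,
    fun z hz => ?_, fun z hz => ?_⟩
  · refine h.aec.smul_le_iff.1 (h.aec.trans _ _ _ (h.aec.smul_le_smul _ h3u') ?_)
    rw [mul_smul, mul_smul]
    exact h.aec.trans _ _ _ (h.aec.smul_le_smul _ d5) k2
  · rw [mul_smul]
    refine h.aec.smul_le_smul _ (h.aec.trans _ _ _ (h.aec.smul_le_smul _ h3u) ?_)
    rw [mul_smul]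
    exact h.aec.trans _ _ _ (h.aec.trans _ _ _ (h.aec.smul_le_smul _ c5) g2) k3
  · rw [Equiv.Perm.mul_apply, Equiv.Perm.inv_eq_iff_eq]
    simp only [Equiv.Perm.mul_apply]
    have i1 : σ z ∈ (v 0).carrier := h.aec.subset hσM₁ (mem_smul.2 hz)
    have i2 : σ' (ρ (g z)) ∈ (v' 0).carrier := h.aec.subset hσ'M₁ (mem_smul.2 hz)
    rw [c6 z (h.aec.subset h1x hz), g1 _ (hvle i1), f5 _ i1, e1' z hz,
      d6 _ (mem_smul.2 (h.aec.subset h1x' (mem_smul.2 hz))), k1 _ (hvle' i2), f6 _ i2]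
  · rw [Equiv.Perm.mul_apply, Equiv.Perm.inv_eq_iff_eq]
    simp only [Equiv.Perm.mul_apply]
    have i1 : z ∈ (y β).carrier := h.aec.subset hQy (h.aec.subset huQ (h.aec.subset h2u hz))
    have i2 : z ∈ (ρ • u' 0).carrier := by
      rw [← hρ z hz]
      exact mem_smul.2 (h.aec.subset h2u' hz)
    rw [c7 z (h.aec.subset h2u hz), g1 _ (h.aec.subset (c2.le β le_rfl) i1), f4 z i1, hρ z hz,
      d7 z i2, k1 _ (h.aec.subset (d2.le β le_rfl) i1)]

/-- Weak uniqueness of non-forking amalgamation. -/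
theorem NF_unique (h : s.IsWSFrame κ) {M₀ M₁ M₂ M₃ M₃' : Model L} {g₁ g₂ : Equiv.Perm ZFSet.{u}}
    (hn : s.NF κ M₀ M₁ M₂ M₃) (hn' : s.NF κ (g₁ • M₀) (g₁ • M₁) (g₂ • M₂) M₃')
    (hg : ∀ z ∈ M₀.carrier, g₁ z = g₂ z) :
    ∃ P ∈ s.KC κ, ∃ τ : Equiv.Perm ZFSet.{u}, s.le M₃' P ∧ s.le (τ • M₃) P ∧
      (∀ z ∈ M₁.carrier, τ z = g₁ z) ∧ ∀ z ∈ M₂.carrier, τ z = g₂ z := by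
  have hn'' := h.NF_smul hn' g₂⁻¹
  rw [smul_congr hg, inv_smul_smul, inv_smul_smul, ← mul_smul] at hn''
  obtain ⟨P, hP, τ, h1, h2, h3, h4⟩ := h.NF_unique_aux hn hn'' fun z hz => by
    rw [Equiv.Perm.mul_apply, hg z hz, perm_inv_apply]
  refine ⟨g₂ • P, h.aec.smul_mem_KC _ hP, g₂ * τ, ?_, ?_, fun z hz => ?_, fun z hz => ?_⟩
  · have := h.aec.smul_le_smul g₂ h1
    rwa [smul_inv_smul] at this
  · rw [mul_smul]
    exact h.aec.smul_le_smul _ h2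
  · rw [Equiv.Perm.mul_apply, h3 z hz, Equiv.Perm.mul_apply, perm_apply_inv]
  · rw [Equiv.Perm.mul_apply, h4 z hz]

/-- The last index is a successor, so no union condition involves the top, and non-forking is
preserved in larger ambient models. -/
theorem freeOver_update_top (h : s.IsWSFrame κ) {γ : Ordinal.{u}} {x y : Ordinal.{u} → Model L}
    {a : Ordinal.{u} → ZFSet.{u}} (hy : s.FreeOver κ (Order.succ γ) x a y) {P : Model L}
    (hP : P ∈ s.KC κ) (hle : s.le (y (Order.succ γ)) P) :
    s.FreeOver κ (Order.succ γ) x a (Function.update y (Order.succ γ) P) := by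
  have e1 : ∀ i ≤ γ, Function.update y (Order.succ γ) P i = y i := fun i hi =>
    Function.update_of_ne (Order.lt_succ_of_le hi).ne _ _
  refine ⟨hy.base, incCont_update (hy.cont.mono (Order.le_succ _)) fun i hi =>
    h.aec.trans _ _ _ (h.chain_le hy.cont hy.mem (hi.trans (Order.le_succ γ)) le_rfl) hle,
    fun i hi => ?_, fun i hi => ?_, fun i hi => ?_⟩
  · rcases hi.eq_or_lt with rfl | hlt
    · rwa [Function.update_self]
    · rw [e1 i (Order.lt_succ_iff.1 hlt)]
      exact hy.mem i hi
  · rcases hi.eq_or_lt with rfl | hlt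
    · rw [Function.update_self]
      exact h.aec.trans _ _ _ (hy.le _ le_rfl) hle
    · rw [e1 i (Order.lt_succ_iff.1 hlt)]
      exact hy.le i hi
  · rw [e1 i (Order.lt_succ_iff.1 hi)]
    rcases (Order.lt_succ_iff.1 hi).eq_or_lt with rfl | hlt
    · rw [Function.update_self]
      exact h.nf_up (hy.nf i hi) hle
    · rw [e1 _ (Order.succ_le_of_lt hlt)]
      exact hy.nf i hi

/-- Unions at limits do not notice the first member, and freeness from `y 0` passes down to `N`. -/
theorem freeOver_update_bot (h : s.IsWSFrame κ) {α : Ordinal.{u}} {x y : Ordinal.{u} → Model L}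
    {a : Ordinal.{u} → ZFSet.{u}} (hy : s.FreeOver κ α x a y) {N : Model L}
    (hle : s.le (x 0) N) (hle' : s.le N (y 0)) :
    s.FreeOver κ α x a (Function.update y 0 N) := by
  have hN := h.mem_KC_of_le_of_le (hy.base.mem 0 zero_le) (hy.mem 0 zero_le) hle hle'
  have e1 : ∀ i, i ≠ 0 → Function.update y 0 N i = y i := fun i hi =>
    Function.update_of_ne hi _ _
  refine ⟨hy.base, ⟨fun i j hij hj => ?_, fun δ hδ hj => ?_⟩, fun i hi => ?_, fun i hi => ?_,
    fun i hi => ?_⟩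
  · rw [e1 j (bot_le.trans_lt hij).ne']
    rcases eq_or_ne i 0 with rfl | hi
    · rw [Function.update_self]
      exact h.aec.trans _ _ _ hle' (hy.cont.1 0 j hij hj)
    · rw [e1 i hi]
      exact hy.cont.1 i j hij hj
  · rw [e1 δ hδ.ne_bot]
    ext z
    rw [mem_limit_iff hy.cont hδ hj]
    simp only [Set.mem_iUnion, Set.mem_Iio, exists_prop]
    constructor
    · rintro ⟨i, hi, hz⟩
      refine ⟨Order.succ i, hδ.succ_lt hi, ?_⟩
      rw [e1 _ (Order.succ_ne_bot i)]
      exact h.aec.subset (hy.cont.1 i _ (Order.lt_succ i) ((hδ.succ_lt hi).trans hj)) hz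
    · rintro ⟨i, hi, hz⟩
      refine ⟨i, hi, ?_⟩
      rcases eq_or_ne i 0 with rfl | hi
      · rw [Function.update_self] at hz
        exact h.aec.subset hle' hz
      · rwa [e1 i hi] at hz
  · rcases eq_or_ne i 0 with rfl | hi'
    · rwa [Function.update_self]
    · rw [e1 i hi']
      exact hy.mem i hi
  · rcases eq_or_ne i 0 with rfl | hi'
    · rwa [Function.update_self]
    · rw [e1 i hi']
      exact hy.le i hi
  · rw [e1 _ (Order.succ_ne_bot i)]
    rcases eq_or_ne i 0 with rfl | hi'
    · rw [Function.update_self]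
      exact h.nf_base (hy.nf 0 hi) (h.aec.refl _ (hy.base.mem 0 zero_le).1) hle hle'
    · rw [e1 i hi']
      exact hy.nf i hi

/-- Symmetry of non-forking amalgamation. -/
theorem NF_symm (h : s.IsWSFrame κ) {M₀ M₁ M₂ M₃ : Model L} (hn : s.NF κ M₀ M₁ M₂ M₃) :
    s.NF κ M₀ M₂ M₁ M₃ := by
  obtain ⟨α, x, a, u, hx, hu, rfl, h1x, h2u, h3u⟩ := nf_elim hn
  obtain ⟨b0, b1, b2, b3, b01, b13, b02, b23, -⟩ := hn
  obtain ⟨γ, y, b, hy, y0, huy⟩ := h.exists_uqTower b0 (hu.mem 0 zero_le) (hu.le 0 zero_le)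
  obtain ⟨σ, η, v, c1, c2, c3, P, hP, c4, c5, c6, c7⟩ := h.exists_swap hx hu hy.1 y0.symm huy
  have hη0 : η • x 0 = x 0 := smul_eq_self fun z hz => c7 z (h.aec.subset (hu.le 0 zero_le) hz)
  have hη2 : η • M₂ = M₂ := smul_eq_self fun z hz => c7 z (h.aec.subset h2u hz)
  have hη1 : σ • M₁ = η • M₁ := (smul_congr fun z hz => c6 z (h.aec.subset h1x hz)).symm
  -- After the exchange, `v` lifts a decomposition of the `M₂` side and has `M₁` in its bottom. Its
  -- top is enlarged to `P` in order to contain the copy of `M₃`.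
  have key := h.nf_intro hy (h.freeOver_update_top c2 hP c4) (M₁ := η • M₂) (M₂ := η • M₁)
    (M₃ := η • M₃) (h.aec.smul_mem_KC η b2) (h.aec.smul_mem_KC η b1) (h.aec.smul_mem_KC η b3)
    (by rw [y0, hη2]; exact b02) (by rw [y0, ← hη0]; exact h.aec.smul_le_smul η b01)
    (h.aec.smul_le_smul η b23) (h.aec.smul_le_smul η b13)
    (by rw [hη2]; exact h.aec.trans _ _ _ h2u huy)
    (by
      rw [Function.update_of_ne (show (0 : Ordinal.{u}) ≠ Order.succ γ from (Order.succ_ne_bot γ).symm), c3, ← hη1]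
      exact h.aec.smul_le_smul σ h1x)
    (by
      rw [Function.update_self]
      exact h.aec.trans _ _ _ (h.aec.smul_le_smul η h3u) c5)
  rw [y0, ← hη0] at key
  have := h.NF_smul key η⁻¹
  simpa only [inv_smul_smul] using this

/-- Existence of non-forking amalgams. -/
theorem exists_NF (h : s.IsWSFrame κ) {M₀ M₁ M₂ : Model L} (h0 : M₀ ∈ s.KC κ) (h1 : M₁ ∈ s.KC κ)
    (h2 : M₂ ∈ s.KC κ) (h01 : s.le M₀ M₁) (h02 : s.le M₀ M₂) :
    ∃ P ∈ s.KC κ, ∃ σ : Equiv.Perm ZFSet.{u}, (∀ z ∈ M₀.carrier, σ z = z) ∧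
      s.NF κ M₀ (σ • M₁) M₂ P := by
  obtain ⟨γ, x, a, hx, rfl, hMx⟩ := h.exists_uqTower h0 h1 h01
  obtain ⟨σ, y, hσ, hy, y0⟩ := h.exists_freeOver hx.1 h2 1 (by rwa [one_smul])
  have hσ0 : σ • x 0 = x 0 := smul_eq_self hσ
  refine ⟨y (Order.succ γ), hy.mem _ le_rfl, σ, hσ, ?_⟩
  have hσM := h.aec.smul_le_smul σ hMx
  have := h.nf_intro (h.uqTower_smul hx σ) hy (M₁ := σ • M₁) (M₂ := M₂)
    (h.aec.smul_mem_KC σ h1) h2 (hy.mem _ le_rfl) (h.aec.smul_le_smul σ h01) (by rwa [hσ0])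
    (h.aec.trans _ _ _ hσM (hy.le _ le_rfl))
    (y0 ▸ h.chain_le hy.cont hy.mem zero_le le_rfl) hσM (by rw [y0]; exact h.aec.refl _ h2.1)
    (h.aec.refl _ (hy.mem _ le_rfl).1)
  rwa [hσ0] at this

/-- Long transitivity of non-forking amalgamation. -/
theorem NF_chain (h : s.IsWSFrame κ) {α : Ordinal.{u}} (hα : α < (Order.succ κ).ord)
    {A B : Ordinal.{u} → Model L} (hA : s.IncCont A (Order.succ α))
    (hB : s.IncCont B (Order.succ α)) (hAm : ∀ i ≤ α, A i ∈ s.KC κ) (hBm : ∀ i ≤ α, B i ∈ s.KC κ)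
    (hAB : ∀ i ≤ α, s.le (A i) (B i))
    (hn : ∀ i < α, s.NF κ (A i) (B i) (A (Order.succ i)) (B (Order.succ i))) :
    s.NF κ (A 0) (B 0) (A α) (B α) := by
  obtain ⟨γ, x, a, hx, x0, hBx⟩ := h.exists_uqTower (hAm 0 zero_le) (hBm 0 zero_le) (hAB 0 zero_le)
  set ε := Order.succ γ with hε
  -- Over a decomposition `x` of a cover of `B 0`, one builds an increasing chain of free lifts of
  -- `x`. The `j`-th has a copy of `A j` as its bottom and contains the corresponding copy of `B j`
  -- in its top; the last one witnesses the claim.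
  refine Exists.elim (h.aec.exists_cohChain (ι := Unit) (ι' := Set.Iic ε)
    (θ := Order.succ α) (src := fun _ => B)
    (fun _ i j hij hj => h.aec.subset (hB.1 i j hij hj))
    (fun j P τ => s.FreeOver κ ε x a (row P) ∧ τ () • A j = row P 0 ∧ s.le (τ () • B j) (row P ε))
    (fun _ _ _ _ _ => True) (fun i => x i) (fun _ => 1)
    ⟨freeOver_congr (h.freeOver_refl hx.1) fun i hi => (row_eq x hi).symm, by
      rw [one_smul, row_eq x zero_le, x0], by rwa [one_smul, row_eq x le_rfl]⟩ ?_ ?_) ?_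
  · rintro i P τ hi ⟨h1, h2, h3⟩
    have hi' : i < α := Order.succ_lt_succ_iff.1 hi
    have hsi := Order.succ_le_of_lt hi'
    have hAi := hA.1 i _ (Order.lt_succ i) hi
    set g := τ () with hg
    set u := row P with hu
    have hgA : s.le (u 0) (g • A (Order.succ i)) := by
      rw [← h2]
      exact h.aec.smul_le_smul g hAi
    obtain ⟨γ', y, b, hy, y0, hAy⟩ := h.exists_uqTower (h1.mem 0 zero_le)
      (h.aec.smul_mem_KC g (hAm _ hsi)) hgA
    -- The grid of the current row with a decomposition of a cover of `A (i + 1)`. Read along `w` it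
    -- is the next row; read along `v` it is a non-forking amalgam of the top of the current row
    -- with that cover.
    obtain ⟨σ, w, v, c1, c2, c3, c4, c5, c6⟩ := h.exists_grid (h.tower_top h1) hy.1 y0.symm
    have hσ0 : σ • u 0 = u 0 := smul_eq_self c1
    have hyle := h.chain_le hy.1.cont hy.1.mem (zero_le (a := Order.succ γ')) le_rfl
    have huε := h.chain_le h1.cont h1.mem (zero_le (a := ε)) le_rfl
    have k1 : s.NF κ (u 0) (y (Order.succ γ')) (σ • u ε) (w ε) := by
      have := h.nf_intro hy c4 (M₁ := y (Order.succ γ')) (M₂ := σ • u ε) (M₃ := w ε)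
        (hy.1.mem _ le_rfl) (h.aec.smul_mem_KC σ (h1.mem _ le_rfl)) (c2.mem _ le_rfl) hyle
        (by rw [y0, ← hσ0]; exact h.aec.smul_le_smul σ huε)
        (by rw [← c6]; exact c4.le _ le_rfl) (c2.le _ le_rfl) (h.aec.refl _ (hy.1.mem _ le_rfl).1)
        (by rw [c5]; exact h.aec.refl _ (h.aec.smul_mem_KC σ (h1.mem _ le_rfl)).1)
        (by rw [c6]; exact h.aec.refl _ (c2.mem _ le_rfl).1)
      rwa [y0] at this
    have hσg0 : (σ * g) • A i = u 0 := by rw [mul_smul, h2, hσ0]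
    have k2 : s.NF κ ((σ * g) • A i) ((σ * g) • B i) (g • A (Order.succ i)) (w ε) := by
      rw [hσg0]
      refine h.NF_mono (h.NF_symm k1) ?_ hgA ?_ hAy
      · rw [← hσg0]
        exact h.aec.smul_le_smul _ (hAB i hi'.le)
      · rw [mul_smul]
        exact h.aec.smul_le_smul σ h3
    -- Weak uniqueness places `B (i + 1)` in an extension of the top of `w`, compatibly with `B i`
    -- and `A (i + 1)`.
    obtain ⟨R, hR, τ', d1, d2, d3, d4⟩ := h.NF_unique (hn i hi') k2 fun z hz => by
      rw [Equiv.Perm.mul_apply]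
      apply c1
      rw [← h2]
      exact mem_smul.2 hz
    -- Both ends of `w` are corrected: the top grows to `R` to contain `B (i + 1)`, and the bottom
    -- shrinks from the cover to the copy of `A (i + 1)` itself.
    have hw := h.freeOver_update_bot (h.freeOver_update_top c2 hR d1) (N := g • A (Order.succ i))
      (by rwa [hσ0]) (by
        rw [Function.update_of_ne (show (0 : Ordinal.{u}) ≠ Order.succ γ from (Order.succ_ne_bot γ).symm), c3]
        exact hAy)
    set w' := Function.update (Function.update w ε R) 0 (g • A (Order.succ i)) with hw'
    have w0 : w' 0 = g • A (Order.succ i) := Function.update_self _ _ _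
    have wε : w' ε = R := by
      rw [hw', Function.update_of_ne (show ε ≠ 0 from Order.succ_ne_bot γ), Function.update_self]
    have hws := h.freeOver_smul hw σ⁻¹
    simp only [inv_smul_smul, perm_inv_apply] at hws
    have hr : ∀ i ≤ ε, row (fun k : Set.Iic ε => σ⁻¹ • w' k) i = σ⁻¹ • w' i := fun i hi =>
      row_eq (fun i => σ⁻¹ • w' i) hi
    refine ⟨fun k => σ⁻¹ • w' k, fun _ => σ⁻¹ * τ', fun k => ?_, fun _ z hz => ?_,
      ⟨h.freeOver_trans h1 (freeOver_congr hws fun i hi => (hr i hi).symm), ?_, ?_⟩, trivial⟩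
    · have := hws.le k k.2
      rwa [hu, row_coe] at this
    · rw [Equiv.Perm.mul_apply, Equiv.Perm.inv_eq_iff_eq, d3 z hz, Equiv.Perm.mul_apply]
    · rw [hr 0 zero_le, w0, mul_smul, smul_congr d4]
    · rw [hr ε le_rfl, wε, mul_smul]
      exact h.aec.smul_le_smul _ d2
  · intro δ P τ hδ hδα hc hInv _ _
    have hδα := Order.lt_succ_iff.1 hδα
    have hfree := h.freeOver_limit hδ (hδα.trans_lt hα) (r := fun j => row (P j))
      (fun i hi => hc.chain ⟨min i ε, min_le_right i ε⟩) fun j hj => (hInv j hj).1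
    refine ⟨hfree, ?_, hc.limit_le h.aec hδ (hB.mono (Order.succ_le_succ hδα))
        (b := ⟨min ε ε, min_le_right ε ε⟩) fun j hj => (hInv j hj).2.2⟩
    have hcA : ∀ j < δ, τ δ () • A j = τ j () • A j := fun j hj => smul_congr fun z hz =>
      hc.coh j δ hj (Order.lt_succ δ) () z (h.aec.subset (hAB j (hj.le.trans hδα)) hz)
    have hle : s.le (τ δ () • A δ) (row (P δ) 0) := by
      refine ((hA.mono (Order.succ_le_succ hδα)).smul h.aec (τ δ ())).limit_le h.aec hδ
        (Order.lt_succ δ) fun j hj => ?_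
      rw [hcA j hj, (hInv j hj).2.1]
      exact (hc.chain ⟨min 0 ε, min_le_right 0 ε⟩).1 j δ hj (Order.lt_succ δ)
    refine h.aec.eq_of_subset hle fun z hz => ?_
    obtain ⟨j, hj, hz⟩ := (mem_limit_iff (hc.chain ⟨min 0 ε, min_le_right 0 ε⟩) hδ
      (Order.lt_succ δ)).1 hz
    have e : P j ⟨min 0 ε, min_le_right 0 ε⟩ = τ j () • A j := (hInv j hj).2.1.symm
    rw [e, ← hcA j hj] at hz
    exact smul_subset.2 (h.aec.subset (hA.1 j δ hj (Order.lt_succ_of_le hδα))) hz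
  · rintro P ⟨τ, hc, hP0, hτ0, hInv, -⟩
    obtain ⟨h1, h2, h3⟩ := hInv α (Order.lt_succ α)
    set g := τ α () with hg
    have hg0 : ∀ z ∈ (B 0).carrier, g z = z := fun z hz => by
      rw [hg, hc.coh' zero_le (Order.lt_succ α) () hz, hτ0]
      rfl
    have hgB : g • B 0 = B 0 := smul_eq_self hg0
    have hgA : g • A 0 = A 0 := smul_eq_self fun z hz => hg0 z (h.aec.subset (hAB 0 zero_le) hz)
    have hA0 := h.aec.smul_le_smul g (h.chain_le hA hAm (zero_le (a := α)) le_rfl)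
    have hB0 := h.aec.smul_le_smul g (h.chain_le hB hBm (zero_le (a := α)) le_rfl)
    have key := h.nf_intro hx h1 (M₁ := g • B 0) (M₂ := g • A α) (M₃ := g • B α)
      (h.aec.smul_mem_KC g (hBm 0 zero_le)) (h.aec.smul_mem_KC g (hAm α le_rfl))
      (h.aec.smul_mem_KC g (hBm α le_rfl)) (by rw [x0, hgB]; exact hAB 0 zero_le)
      (by rw [x0, ← hgA]; exact hA0) hB0 (h.aec.smul_le_smul g (hAB α le_rfl)) (by rwa [hgB])
      (by rw [h2]; exact h.aec.refl _ (h1.mem 0 zero_le).1) h3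
    rw [x0, ← hgA] at key
    simpa only [inv_smul_smul] using h.NF_smul key g⁻¹

end IsWSFrame

end PreFrame

end SemiGood

namespace SemiGood
open Model OrderedClass

variable {L : FirstOrder.Language.{u, u}}

/-! ### Properties holding on a club -/

/-- The property `p` holds at all limit ordinals below `κ⁺` closed under some function. -/
def OnClub (κ : Cardinal.{u}) (p : Ordinal.{u} → Prop) : Prop :=
  ∃ F : Ordinal.{u} → Ordinal.{u}, (∀ i < (Order.succ κ).ord, F i < (Order.succ κ).ord) ∧
    ∀ δ < (Order.succ κ).ord, Order.IsSuccLimit δ → (∀ i < δ, F i < δ) → p δ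

theorem OnClub.and {κ : Cardinal.{u}} {p q : Ordinal.{u} → Prop} (hp : OnClub κ p)
    (hq : OnClub κ q) : OnClub κ fun δ => p δ ∧ q δ := by
  obtain ⟨F, hF, hFp⟩ := hp
  obtain ⟨G, hG, hGq⟩ := hq
  refine ⟨fun i => max (F i) (G i), fun i hi => max_lt (hF i hi) (hG i hi), fun δ hδ hl hcl => ?_⟩
  exact ⟨hFp δ hδ hl fun i hi => (le_max_left _ _).trans_lt (hcl i hi),
    hGq δ hδ hl fun i hi => (le_max_right _ _).trans_lt (hcl i hi)⟩

theorem onClub_gt {κ : Cardinal.{u}} {β : Ordinal.{u}} (hβ : β < (Order.succ κ).ord) :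
    OnClub κ fun δ => β < δ :=
  ⟨fun _ => β, fun _ _ => hβ, fun _ _ hl hcl => hcl 0 hl.bot_lt⟩

theorem OnClub.exists {κ : Cardinal.{u}} (hκ : ℵ₀ ≤ κ) {p : Ordinal.{u} → Prop}
    (hp : OnClub κ p) : ∃ δ < (Order.succ κ).ord, Order.IsSuccLimit δ ∧ p δ := by
  obtain ⟨F, hF, hFp⟩ := hp
  have hlim := Cardinal.isSuccLimit_ord (hκ.trans (Order.le_succ κ))
  obtain ⟨δ, hδ, hl, -, hcl⟩ := exists_closed hκ F hF hlim.bot_lt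
  exact ⟨δ, hδ, hl, hFp δ hδ hl hcl⟩

/-- With `F i` a point of `E` at or above `i`, a closed limit `δ` is the supremum of `E` below `δ`.
The point of `E` below `δ` is recorded so that `δ` can serve as the upper index in an instance of
`NF`, which puts the models at `δ` in `K_κ`. -/
theorem onClub_of_isClub {κ : Cardinal.{u}} {E : Set (Set.Iio (Order.succ κ).ord)}
    (hE : IsClub E) :
    OnClub κ fun δ => (∃ hδ : δ < (Order.succ κ).ord, ⟨δ, hδ⟩ ∈ E) ∧ ∃ α ∈ E, α.1 < δ := by
  have hex : ∀ i : Ordinal.{u}, ∃ j : Ordinal.{u}, i < (Order.succ κ).ord →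
      ∃ hj : j < (Order.succ κ).ord, ⟨j, hj⟩ ∈ E ∧ i ≤ j := by
    intro i
    by_cases hi : i < (Order.succ κ).ord
    · obtain ⟨j, hj, hij⟩ := hE.isCofinal ⟨i, hi⟩
      exact ⟨j, fun _ => ⟨j.2, hj, hij⟩⟩
    · exact ⟨0, fun h => absurd h hi⟩
  choose F hF using hex
  refine ⟨F, fun i hi => (hF i hi).1, fun δ hδ hl hcl => ?_⟩
  obtain ⟨h0, h0E, -⟩ := hF 0 (hl.bot_lt.trans hδ)
  have h0δ := hcl 0 hl.bot_lt
  refine ⟨⟨hδ, hE.isLUB_mem (t := {α | α ∈ E ∧ α.1 < δ}) (fun α hα => hα.1)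
    ⟨⟨F 0, h0⟩, h0E, h0δ⟩ ⟨fun α hα => hα.2.le, fun β hβ => ?_⟩⟩, ⟨F 0, h0⟩, h0E, h0δ⟩
  refine le_of_not_gt fun hlt => ?_
  have hlt' : β.1 < δ := hlt
  have hs := hl.succ_lt hlt'
  obtain ⟨hj, hjE, hle⟩ := hF _ (hs.trans hδ)
  exact absurd (hβ (a := ⟨F (Order.succ β.1), hj⟩) ⟨hjE, hcl _ hs⟩)
    (not_le_of_gt (Subtype.mk_lt_mk.2 ((Order.lt_succ β.1).trans_le hle)))

/-- `ν` is a continuous increasing enumeration, of length `κ⁺`, of ordinals satisfying `p`. -/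
structure IsEnum (κ : Cardinal.{u}) (p : Ordinal.{u} → Prop) (ν : Ordinal.{u} → Ordinal.{u}) :
    Prop where
  lt : ∀ i < (Order.succ κ).ord, ν i < (Order.succ κ).ord
  prop : ∀ i < (Order.succ κ).ord, p (ν i)
  mono : ∀ i j, i < j → j < (Order.succ κ).ord → ν i < ν j
  cont : ∀ δ, Order.IsSuccLimit δ → δ < (Order.succ κ).ord → ∀ γ < ν δ, ∃ j < δ, γ < ν j
  isLimit : ∀ i < (Order.succ κ).ord, Order.IsSuccLimit (ν i)

theorem IsEnum.imp {κ : Cardinal.{u}} {p q : Ordinal.{u} → Prop} {ν : Ordinal.{u} → Ordinal.{u}}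
    (hν : IsEnum κ p ν) (hpq : ∀ i, p i → q i) : IsEnum κ q ν :=
  ⟨hν.lt, fun i hi => hpq _ (hν.prop i hi), hν.mono, hν.cont, hν.isLimit⟩

theorem IsEnum.le_apply {κ : Cardinal.{u}} {p : Ordinal.{u} → Prop} {ν : Ordinal.{u} → Ordinal.{u}}
    (hν : IsEnum κ p ν) {i : Ordinal.{u}} (hi : i < (Order.succ κ).ord) : i ≤ ν i := by
  induction i using WellFoundedLT.induction with
  | ind i ih =>
    exact le_of_forall_lt fun j hj => (ih j hj (hj.trans hi)).trans_lt (hν.mono j i hj hi)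

/-- At limits continuity forces the supremum, which is closed because the earlier values are.
Elsewhere any closed limit point above all earlier values serves. -/
theorem OnClub.exists_isEnum {κ : Cardinal.{u}} (hκ : ℵ₀ ≤ κ) {p : Ordinal.{u} → Prop}
    (hp : OnClub κ p) : ∃ ν, IsEnum κ p ν := by
  obtain ⟨F, hF, hFp⟩ := hp
  have hlim := Cardinal.isSuccLimit_ord (hκ.trans (Order.le_succ κ))
  refine Exists.elim (exists_recursion (St := Ordinal.{u}) (Order.succ κ).ord
    (fun i f x => x < (Order.succ κ).ord ∧ Order.IsSuccLimit x ∧ (∀ l < x, F l < x) ∧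
      (∀ j < i, f j < x) ∧ (Order.IsSuccLimit i → ∀ γ < x, ∃ j < i, γ < f j)) ?_ ?_) ?_
  · rintro i f g x hfg ⟨h1, h2, h3, h4, h5⟩
    refine ⟨h1, h2, h3, fun j hj => hfg j hj ▸ h4 j hj, fun hi γ hγ => ?_⟩
    obtain ⟨j, hj, hjγ⟩ := h5 hi γ hγ
    exact ⟨j, hj, hfg j hj ▸ hjγ⟩
  · intro i hi f hf
    obtain ⟨ε, hε, hb⟩ := exists_lt_of_card_le hκ (β := Set.Iio i) (by
        rw [Cardinal.mk_Iio_ordinal, Cardinal.lift_le]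
        exact Order.lt_succ_iff.1 (Cardinal.lt_ord.1 hi)) (fun l => f l)
        (fun l => (hf l l.2).1)
    by_cases hl : Order.IsSuccLimit i
    · have hbd : BddAbove (Set.range fun l : Set.Iio i => f l) :=
        ⟨ε, by rintro _ ⟨l, rfl⟩; exact (hb l).le⟩
      have hne : Nonempty (Set.Iio i) := ⟨⟨0, hl.bot_lt⟩⟩
      have hlt : ∀ j < i, f j < ⨆ l : Set.Iio i, f l := fun j hj =>
        ((hf _ (hl.succ_lt hj)).2.2.2.1 j (Order.lt_succ j)).trans_le
          (le_ciSup hbd ⟨_, hl.succ_lt hj⟩)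
      have hex : ∀ γ < ⨆ l : Set.Iio i, f l, ∃ j < i, γ < f j := fun γ hγ => by
        obtain ⟨j, hj⟩ := exists_lt_of_lt_ciSup hγ
        exact ⟨j, j.2, hj⟩
      refine ⟨⨆ l : Set.Iio i, f l, (ciSup_le fun l => (hb l).le).trans_lt hε, ?_, ?_, hlt,
        fun _ => hex⟩
      · refine Order.isSuccLimit_iff_of_orderBot.2 ⟨(bot_le.trans_lt (hlt 0 hl.bot_lt)).ne',
          Order.isSuccPrelimit_of_succ_lt fun γ hγ => ?_⟩
        obtain ⟨j, hj, hγj⟩ := hex γ hγ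
        exact (Order.succ_le_of_lt hγj).trans_lt (hlt j hj)
      · intro γ hγ
        obtain ⟨j, hj, hγj⟩ := hex γ hγ
        exact ((hf j hj).2.2.1 γ hγj).trans (hlt j hj)
    · obtain ⟨δ, hδ, hδl, hεδ, hcl⟩ := exists_closed hκ F hF hε
      exact ⟨δ, hδ, hδl, hcl, fun j hj => (hb ⟨j, hj⟩).trans hεδ, fun h => absurd h hl⟩
  · rintro ν hν
    exact ⟨ν, fun i hi => (hν i hi).1, fun i hi => hFp _ (hν i hi).1 (hν i hi).2.1 (hν i hi).2.2.1,
      fun i j hij hj => (hν j hj).2.2.2.1 i hij, fun δ hδ hδκ => (hν δ hδκ).2.2.2.2 hδ,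
      fun i hi => (hν i hi).2.1⟩

theorem IsEnum.incCont {k : OrderedClass L} (hk : k.IsAEC) {κ : Cardinal.{u}}
    {p : Ordinal.{u} → Prop} {ν : Ordinal.{u} → Ordinal.{u}} (hν : IsEnum κ p ν)
    {c : Ordinal.{u} → Model L} (hc : k.IncCont c (Order.succ κ).ord) :
    k.IncCont (fun i => c (ν i)) (Order.succ κ).ord := by
  refine ⟨fun i j hij hj => hc.1 _ _ (hν.mono i j hij hj) (hν.lt j hj), fun δ hδ hδκ => ?_⟩
  simp only
  rw [hc.2 _ (hν.isLimit δ hδκ) (hν.lt δ hδκ)]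
  ext x
  simp only [Set.mem_iUnion, Set.mem_Iio, exists_prop]
  constructor
  · rintro ⟨γ, hγ, hx⟩
    obtain ⟨j, hj, hγj⟩ := hν.cont δ hδ hδκ γ hγ
    exact ⟨j, hj, hk.subset (hc.1 _ _ hγj (hν.lt j (hj.trans hδκ))) hx⟩
  · rintro ⟨j, hj, hx⟩
    exact ⟨_, hν.mono j δ hj hδκ, hx⟩

theorem IsEnum.isUnion {k : OrderedClass L} (hk : k.IsAEC) {κ : Cardinal.{u}}
    {p : Ordinal.{u} → Prop} {ν : Ordinal.{u} → Ordinal.{u}} (hν : IsEnum κ p ν)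
    {c : Ordinal.{u} → Model L} (hc : k.IncCont c (Order.succ κ).ord) {M : Model L}
    (hM : IsUnion M c (Order.succ κ).ord) :
    IsUnion M (fun i => c (ν i)) (Order.succ κ).ord := by
  refine ⟨fun i hi => hM.1 _ (hν.lt i hi), ?_⟩
  rw [hM.2]
  ext x
  simp only [Set.mem_iUnion, Set.mem_Iio, exists_prop]
  constructor
  · rintro ⟨γ, hγ, hx⟩
    rcases (hν.le_apply hγ).eq_or_lt with he | hlt
    · exact ⟨γ, hγ, he ▸ hx⟩
    · exact ⟨γ, hγ, hk.subset (hc.1 _ _ hlt (hν.lt γ hγ)) hx⟩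
  · rintro ⟨j, hj, hx⟩
    exact ⟨_, hν.lt j hj, hx⟩

namespace PreFrame

variable {s : PreFrame L} {κ : Cardinal.{u}}

namespace IsWSFrame

/-- An element of one filtration appears in the other at a bounded stage; at limits closed under
both bounds each member contains the other. -/
theorem onClub_eq (h : s.IsWSFrame κ) {c d : Ordinal.{u} → Model L} {M : Model L}
    (hc : s.IncCont c (Order.succ κ).ord) (hd : s.IncCont d (Order.succ κ).ord)
    (hcκ : ∀ i < (Order.succ κ).ord, #(c i).carrier ≤ Cardinal.lift.{u + 1} κ)
    (hdκ : ∀ i < (Order.succ κ).ord, #(d i).carrier ≤ Cardinal.lift.{u + 1} κ)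
    (hcM : IsUnion M c (Order.succ κ).ord) (hdM : IsUnion M d (Order.succ κ).ord) :
    OnClub κ fun δ => c δ = d δ := by
  have hmono : ∀ c : Ordinal.{u} → Model L, s.IncCont c (Order.succ κ).ord →
      ∀ i j, i ≤ j → j < (Order.succ κ).ord → (c i).carrier ⊆ (c j).carrier := by
    intro c hc i j hij hj
    rcases hij.eq_or_lt with rfl | hlt
    · exact subset_rfl
    · exact h.aec.subset (hc.1 i j hlt hj)
  obtain ⟨F, hF, hFc⟩ := h.exists_catch (hmono c hc) hdκ
  obtain ⟨G, hG, hGd⟩ := h.exists_catch (hmono d hd) hcκ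
  have key : ∀ {c d : Ordinal.{u} → Model L} {F : Ordinal.{u} → Ordinal.{u}},
      s.IncCont c (Order.succ κ).ord → s.IncCont d (Order.succ κ).ord →
      IsUnion M c (Order.succ κ).ord → IsUnion M d (Order.succ κ).ord →
      (∀ i < (Order.succ κ).ord, F i < (Order.succ κ).ord) →
      (∀ i < (Order.succ κ).ord, ∀ v ∈ (d i).carrier, ∀ j < (Order.succ κ).ord,
        v ∈ (c j).carrier → v ∈ (c (F i)).carrier) →
      OnClub κ fun δ => (d δ).carrier ⊆ (c δ).carrier := by
    intro c d F hc hd hcM hdM hF hFc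
    refine ⟨F, hF, fun δ hδ hl hcl v hv => ?_⟩
    obtain ⟨i, hi, hvi⟩ := (mem_limit_iff hd hl hδ).1 hv
    obtain ⟨j, hj, hvj⟩ := hcM.mem_iff.1
      (((hd.le_union h.aec h.isSuccLimit_ord hdM).2 _ hδ |> h.aec.subset) hv)
    exact hmono c hc _ _ (hcl i hi).le hδ (hFc i (hi.trans hδ) v hvi j hj hvj)
  obtain ⟨H, hH, hHp⟩ := (key hc hd hcM hdM hF hFc).and (key hd hc hdM hcM hG hGd)
  refine ⟨H, hH, fun δ hδ hl hcl => ?_⟩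
  obtain ⟨h1, h2⟩ := hHp δ hδ hl hcl
  exact h.aec.eq_of_subset (h.aec.le_of_subset ((hc.le_union h.aec h.isSuccLimit_ord hcM).2 _ hδ)
    ((hd.le_union h.aec h.isSuccLimit_ord hdM).2 _ hδ) h2) h1

end IsWSFrame

/-! ### Rich filtrations -/

/-- The sequences `A`, `N`, `e` witness that the union of `N` is a saturated extension of
the union of `A`. -/
structure Rich (s : PreFrame L) (κ : Cardinal.{u}) (A N e : Ordinal.{u} → Model L) : Prop where
  incA : s.IncCont A (Order.succ κ).ord
  incN : s.IncCont N (Order.succ κ).ord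
  memN : ∀ i < (Order.succ κ).ord, N i ∈ s.KC κ
  leN : ∀ i < (Order.succ κ).ord, s.le (A i) (N i)
  lee : ∀ i < (Order.succ κ).ord, s.le (N i) (e i)
  nf : ∀ i < (Order.succ κ).ord, s.NF κ (A i) (e i) (A (Order.succ i)) (N (Order.succ i))
  dense : ∀ i < (Order.succ κ).ord, ∀ p ∈ s.Sbs (N i), ∃ γ < (Order.succ κ).ord,
    ∀ j < (Order.succ κ).ord, γ ≤ j → ∃ b ∈ (e j).carrier,
      s.DNF (s.tp b (N j) (e j)) (N i) (N j) ∧ s.restr (s.tp b (N j) (e j)) (N i) = p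

namespace IsWSFrame

/-- A club property is returned rather than one enumeration, so that two extensions can be thinned
along the same enumeration. -/
theorem exists_rich (h : s.IsWSFrame κ) {M₀ M₁ : Model L} (hp : s.PrecPlus κ M₀ M₁) :
    ∃ c₀ c₁ e : Ordinal.{u} → Model L, ∃ p : Ordinal.{u} → Prop,
      s.IncCont c₀ (Order.succ κ).ord ∧ s.IncCont c₁ (Order.succ κ).ord ∧
      IsUnion M₀ c₀ (Order.succ κ).ord ∧ IsUnion M₁ c₁ (Order.succ κ).ord ∧
      (∀ i < (Order.succ κ).ord, #(c₀ i).carrier ≤ Cardinal.lift.{u + 1} κ) ∧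
      (∀ i < (Order.succ κ).ord, #(c₁ i).carrier ≤ Cardinal.lift.{u + 1} κ) ∧ OnClub κ p ∧
      ∀ ν, IsEnum κ p ν → s.Rich κ (fun i => c₀ (ν i)) (fun i => c₁ (ν i)) (fun i => e (ν i)) := by
  obtain ⟨-, -, c₀, c₁, e, E, hc₀, hc₁, -, hE, hu₀, hu₁, hle, hNF, hd⟩ := hp
  have hclub := onClub_of_isClub hE
  have hbd : ∀ i < (Order.succ κ).ord, ∃ α ∈ E, ∃ β ∈ E, α < β ∧ i ≤ β.1 := by
    intro i hi
    obtain ⟨δ, hδ, -, ⟨⟨hδ', hδE⟩, α, hα, hαδ⟩, hiδ⟩ := (hclub.and (onClub_gt hi)).exists h.inf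
    exact ⟨α, hα, ⟨δ, hδ'⟩, hδE, hαδ, hiδ.le⟩
  have hcard : ∀ c : Ordinal.{u} → Model L, s.IncCont c (Order.succ κ).ord →
      (∀ α ∈ E, ∀ β ∈ E, α < β → c β ∈ s.KC κ) →
      ∀ i < (Order.succ κ).ord, #(c i).carrier ≤ Cardinal.lift.{u + 1} κ := by
    intro c hc hcE i hi
    obtain ⟨α, hα, β, hβ, hαβ, hiβ⟩ := hbd i hi
    refine le_trans (Cardinal.mk_le_mk_of_subset ?_) (hcE α hα β hβ hαβ).2.le
    rcases hiβ.eq_or_lt with rfl | hlt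
    · exact subset_rfl
    · exact h.aec.subset (hc.1 _ _ hlt β.2)
  refine ⟨c₀, c₁, e, _, hc₀, hc₁, hu₀, hu₁,
    hcard c₀ hc₀ fun α hα β hβ hαβ => (hNF α hα β hβ hαβ).2.2.1,
    hcard c₁ hc₁ fun α hα β hβ hαβ => (hNF α hα β hβ hαβ).2.2.2.1, hclub, fun ν hν => ?_⟩
  refine ⟨hν.incCont h.aec hc₀, hν.incCont h.aec hc₁, fun i hi => ?_, fun i hi => ?_,
    fun i hi => ?_, fun i hi => ?_, fun i hi p hp => ?_⟩
  · obtain ⟨⟨hi', hE'⟩, α, hα, hαi⟩ := hν.prop i hi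
    exact (hNF α hα ⟨_, hi'⟩ hE' hαi).2.2.2.1
  · obtain ⟨⟨hi', hE'⟩, -⟩ := hν.prop i hi
    exact (hle ⟨_, hi'⟩ hE').1
  · obtain ⟨⟨hi', hE'⟩, -⟩ := hν.prop i hi
    exact (hle ⟨_, hi'⟩ hE').2
  · have hsi := h.isSuccLimit_ord.succ_lt hi
    obtain ⟨⟨hi', hE'⟩, -⟩ := hν.prop i hi
    obtain ⟨⟨hj', hF'⟩, -⟩ := hν.prop _ hsi
    exact hNF ⟨_, hi'⟩ hE' ⟨_, hj'⟩ hF' (hν.mono i _ (Order.lt_succ i) hsi)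
  · obtain ⟨⟨hi', hE'⟩, -⟩ := hν.prop i hi
    obtain ⟨γ, hγ, hγb⟩ := hd ⟨_, hi'⟩ hE' p hp
    refine ⟨γ, hγ, fun j hj hγj => ?_⟩
    obtain ⟨⟨hj', hF'⟩, -⟩ := hν.prop j hj
    exact hγb ⟨_, hj'⟩ hF' (hγj.trans (hν.le_apply hj))

end IsWSFrame
end PreFrame
end SemiGood

/-! ### The construction of length `κ⁺` -/

namespace SemiGood
open Model OrderedClass

variable {L : FirstOrder.Language.{u, u}}

theorem OrderedClass.IsAEC.tp_smul_of_fix {k : OrderedClass L} (hk : k.IsAEC) {a : ZFSet.{u}}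
    {M N : Model L} {σ : Equiv.Perm ZFSet.{u}} (hMN : k.le M N) (ha : a ∈ N.carrier)
    (hσ : ∀ x ∈ M.carrier, σ x = x) : k.tp a M N = k.tp (σ a) M (σ • N) := by
  have hN := (hk.mem_of_le _ _ hMN).2
  have h1 := hk.smul_le_smul σ hMN
  rw [smul_eq_self hσ] at h1
  exact hk.tp_eq_of_perm hMN h1 ha (mem_smul.2 ha) hσ (hk.refl _ (hk.smul_mem σ hN))
    (hk.refl _ (hk.smul_mem σ hN))

namespace PreFrame

variable {s : PreFrame L} {κ : Cardinal.{u}}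

namespace IsWSFrame

theorem amalg_pair (h : s.IsWSFrame κ) {P : Model L} {Q : Bool → Model L} (hP : P ∈ s.KC κ)
    (hQ : ∀ l, Q l ∈ s.KC κ) (hPQ : ∀ l, s.le P (Q l)) :
    ∃ R ∈ s.KC κ, ∃ χ : Bool → Equiv.Perm ZFSet.{u}, (∀ l, ∀ x ∈ P.carrier, χ l x = x) ∧
      ∀ l, s.le (χ l • Q l) R := by
  obtain ⟨R, hR, σ, h1, h2, h3⟩ := h.amalg 1 hP (hQ true) (hQ false) (hPQ true)
    (by rw [one_smul]; exact hPQ false)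
  refine ⟨R, hR, fun l => cond l σ 1, ?_, ?_⟩
  · rintro (_ | _) x hx
    · rfl
    · exact h1 x hx
  · rintro (_ | _)
    · simpa using h3
    · exact h2

/-- Amalgamate `e` with `P` over `N`, realizing if possible a type over `N` both in `P` and `e`. -/
theorem exists_realize (h : s.IsWSFrame κ) {N e P : Model L} (hN : N ∈ s.KC κ) (he : e ∈ s.KC κ)
    (hP : P ∈ s.KC κ) (hNe : s.le N e) {g : Equiv.Perm ZFSet.{u}} (hg : s.le (g • N) P) :
    ∃ Q ∈ s.KC κ, ∃ σ : Equiv.Perm ZFSet.{u}, s.le P Q ∧ (∀ x ∈ N.carrier, σ x = g x) ∧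
      s.le (σ • e) Q ∧ ((∃ b ∈ (g⁻¹ • P).carrier, b ∉ N.carrier ∧ ∃ b' ∈ e.carrier,
        s.tp b N (g⁻¹ • P) = s.tp b' N e) →
        ∃ b ∈ P.carrier, b ∉ (g • N).carrier ∧ b ∈ (σ • e).carrier) := by
  by_cases hex : ∃ b ∈ (g⁻¹ • P).carrier, b ∉ N.carrier ∧ ∃ b' ∈ e.carrier,
        s.tp b N (g⁻¹ • P) = s.tp b' N e
  · obtain ⟨b, hb, hbN, b', hb', ht⟩ := hex
    obtain ⟨R, hR, σ, h1, h2, h3, h4⟩ := h.tp_amalg' ht.symm hN he (h.aec.smul_mem_KC _ hP) hNe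
      hb' (h.aec.smul_le_iff.1 hg) hb
    refine ⟨g • R, h.aec.smul_mem_KC g hR, g * σ, ?_, fun x hx => ?_, ?_, fun _ => ?_⟩
    · have := h.aec.smul_le_smul g h4
      rwa [smul_inv_smul] at this
    · rw [Equiv.Perm.mul_apply, h1 x hx]
    · rw [mul_smul]
      exact h.aec.smul_le_smul g h3
    · refine ⟨g b, ?_, fun h' => hbN (mem_smul.1 h'), ?_⟩
      · have := (mem_smul (σ := g)).2 hb
        rwa [smul_inv_smul] at this
      · rw [← h2, ← Equiv.Perm.mul_apply]
        exact mem_smul.2 hb'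
  · obtain ⟨Q, hQ, σ, h1, h2, h3⟩ := h.amalg g hN he hP hNe hg
    exact ⟨Q, hQ, σ, h3, h1, h2, fun h' => absurd h' hex⟩

/-- Both `e l` go into an extension `R` of `P`, realizing there what can be realized. A non-forking
amalgam `S` of `R` with a copy of `A'` is, by symmetry and monotonicity, also one of each copy of `e
l` with it. Weak uniqueness embeds each `N' l` over `S` with the same map on `A'`, and the results
are amalgamated over `S`. -/
theorem exists_step (h : s.IsWSFrame κ) {A A' P : Model L} {N e N' : Bool → Model L}
    (hNF : ∀ l, s.NF κ A (e l) A' (N' l)) (hN : ∀ l, N l ∈ s.KC κ) (hAN : ∀ l, s.le A (N l))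
    (hNe : ∀ l, s.le (N l) (e l)) (hP : P ∈ s.KC κ) {g : Bool → Equiv.Perm ZFSet.{u}}
    (hgP : ∀ l, s.le (g l • N l) P) (hg : ∀ l, ∀ x ∈ A.carrier, g l x = g false x) :
    ∃ P' ∈ s.KC κ, ∃ g' : Bool → Equiv.Perm ZFSet.{u}, s.le P P' ∧
      (∀ l, ∀ x ∈ (N l).carrier, g' l x = g l x) ∧ (∀ l, s.le (g' l • N' l) P') ∧
      (∀ l, ∀ x ∈ A'.carrier, g' l x = g' false x) ∧
      ∀ l, (∃ b ∈ ((g l)⁻¹ • P).carrier, b ∉ (N l).carrier ∧ ∃ b' ∈ (e l).carrier,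
        s.tp b (N l) ((g l)⁻¹ • P) = s.tp b' (N l) (e l)) →
        ∃ b ∈ P.carrier, b ∉ (g l • N l).carrier ∧ b ∈ (g' l • N' l).carrier := by
  have hA := (hNF false).1
  have hA' := (hNF false).2.2.1
  have hAA' := (hNF false).2.2.2.2.2.2.1
  have he : ∀ l, e l ∈ s.KC κ := fun l => (hNF l).2.1
  have heN : ∀ l, s.le (e l) (N' l) := fun l => (hNF l).2.2.2.2.2.1
  choose Q hQ σ hPQ hσ hσe hreal using fun l => h.exists_realize (hN l) (he l) hP (hNe l) (hgP l)
  obtain ⟨R, hR, χ, hχ, hχR⟩ := h.amalg_pair hP hQ hPQ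
  have hPR : s.le P R := by
    have := h.aec.smul_le_smul (χ false) (hPQ false)
    rw [smul_eq_self (hχ false)] at this
    exact h.aec.trans _ _ _ this (hχR false)
  set f : Bool → Equiv.Perm ZFSet.{u} := fun l => χ l * σ l with hf
  have hfN : ∀ l, ∀ x ∈ (N l).carrier, f l x = g l x := fun l x hx => by
    simp only [hf, Equiv.Perm.mul_apply]
    rw [hσ l x hx]
    exact hχ l _ (h.aec.subset (hgP l) (mem_smul.2 hx))
  have hfe : ∀ l, s.le (f l • e l) R := fun l => by
    simp only [hf, mul_smul]
    exact h.aec.trans _ _ _ (h.aec.smul_le_smul _ (hσe l)) (hχR l)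
  have hfA : ∀ l, ∀ x ∈ A.carrier, f l x = g false x := fun l x hx => by
    rw [hfN l x (h.aec.subset (hAN l) hx), hg l x hx]
  have hgAP : s.le (g false • A) P :=
    h.aec.trans _ _ _ (h.aec.smul_le_smul _ (hAN false)) (hgP false)
  obtain ⟨S, hS, ρ, hρ, hn⟩ := h.exists_NF (h.aec.smul_mem_KC _ hA)
    (h.aec.smul_mem_KC (g false) hA') hR (h.aec.smul_le_smul _ hAA')
    (h.aec.trans _ _ _ hgAP hPR)
  have hn' := h.NF_symm hn
  rw [← mul_smul] at hn'
  have hk : ∀ l, ∃ T ∈ s.KC κ, ∃ τ : Equiv.Perm ZFSet.{u}, s.le S T ∧ s.le (τ • N' l) T ∧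
      (∀ z ∈ (e l).carrier, τ z = f l z) ∧ ∀ z ∈ A'.carrier, τ z = (ρ * g false) z := by
    intro l
    refine h.NF_unique (hNF l) (M₃' := S) ?_ fun z hz => ?_
    · rw [smul_congr (hfA l)]
      refine h.NF_mono hn' ?_ hn'.2.2.2.2.2.2.1 (hfe l) (h.aec.refl _ hn'.2.2.1.1)
      rw [← smul_congr (hfA l)]
      exact h.aec.smul_le_smul _ (hNF l).2.2.2.2.1
    · rw [hfA l z hz, Equiv.Perm.mul_apply, hρ _ (mem_smul.2 hz)]
  choose T hT τ hST hτN hτe hτA using hk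
  obtain ⟨P', hP', ψ, hψ, hψP⟩ := h.amalg_pair hS hT hST
  have hRS : s.le R S := hn.2.2.2.2.2.2.2.1
  have hSP : s.le S P' := by
    have := h.aec.smul_le_smul (ψ false) (hST false)
    rw [smul_eq_self (hψ false)] at this
    exact h.aec.trans _ _ _ this (hψP false)
  have hψe : ∀ l, ∀ x ∈ (e l).carrier, (ψ l * τ l) x = f l x := fun l x hx => by
    rw [Equiv.Perm.mul_apply, hτe l x hx]
    exact hψ l _ (h.aec.subset hRS (h.aec.subset (hfe l) (mem_smul.2 hx)))
  have hψA : ∀ l, ∀ x ∈ A'.carrier, (ψ l * τ l) x = (ρ * g false) x := fun l x hx => by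
    rw [Equiv.Perm.mul_apply, hτA l x hx]
    exact hψ l _ (h.aec.subset hn'.2.2.2.2.2.2.2.1 (mem_smul.2 hx))
  refine ⟨P', hP', fun l => ψ l * τ l, h.aec.trans _ _ _ (h.aec.trans _ _ _ hPR hRS) hSP,
    fun l x hx => ?_, fun l => ?_, fun l x hx => ?_, fun l hex => ?_⟩
  · rw [hψe l x (h.aec.subset (hNe l) hx), hfN l x hx]
  · rw [mul_smul]
    exact h.aec.trans _ _ _ (h.aec.smul_le_smul _ (hτN l)) (hψP l)
  · rw [hψA l x hx, hψA false x hx]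
  · obtain ⟨b, hb, hbN, b', hb', rfl⟩ := hreal l hex
    refine ⟨_, hb, hbN, b', h.aec.subset (heN l) hb', ?_⟩
    change (ψ l * τ l) b' = σ l b'
    rw [hψe l b' hb']
    exact hχ l _ hb

/-- A chain over a rich sequence, in which types get realized whenever possible, is exhausted. -/
theorem mem_of_rich (h : s.IsWSFrame κ) {A N e Q : Ordinal.{u} → Model L} (hR : s.Rich κ A N e)
    (hQ : s.IncCont Q (Order.succ κ).ord) (hQm : ∀ i < (Order.succ κ).ord, Q i ∈ s.KC κ)
    (hNQ : ∀ i < (Order.succ κ).ord, s.le (N i) (Q i))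
    (hst : ∀ i < (Order.succ κ).ord, (∃ b ∈ (Q i).carrier, b ∉ (N i).carrier ∧
      ∃ b' ∈ (e i).carrier, s.tp b (N i) (Q i) = s.tp b' (N i) (e i)) →
      ∃ b ∈ (Q i).carrier, b ∉ (N i).carrier ∧ b ∈ (N (Order.succ i)).carrier)
    {i₀ : Ordinal.{u}} (hi₀ : i₀ < (Order.succ κ).ord) {v : ZFSet.{u}} (hv : v ∈ (Q i₀).carrier) :
    ∃ j < (Order.succ κ).ord, v ∈ (N j).carrier := by
  by_contra hcon
  push Not at hcon
  have hNle : ∀ i j, i ≤ j → j < (Order.succ κ).ord → s.le (N i) (N j) := fun i j hij hj =>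
    hR.incN.le h.aec hij hj (hR.memN i (hij.trans_lt hj)).1
  have hQle : ∀ i j, i ≤ j → j < (Order.succ κ).ord → s.le (Q i) (Q j) := fun i j hij hj =>
    hQ.le h.aec hij hj (hQm i (hij.trans_lt hj)).1
  obtain ⟨F, hF, hFc⟩ := h.exists_catch (c := N) (d := Q)
    (fun i j hij hj => h.aec.subset (hNle i j hij hj)) (fun i hi => (hQm i hi).2.le)
  -- `Γ i` bounds the thresholds of `dense` for all basic types over `N i` realized in `Q i`. There
  -- are at most `κ` of them, although `N i` may have `κ⁺` basic types.
  have hΓ : ∀ i : Ordinal.{u}, ∃ ε : Ordinal.{u}, i < (Order.succ κ).ord →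
      ε < (Order.succ κ).ord ∧ ∀ b ∈ (Q i).carrier, s.tp b (N i) (Q i) ∈ s.Sbs (N i) →
        ∀ j < (Order.succ κ).ord, ε ≤ j → ∃ b' ∈ (e j).carrier,
          s.DNF (s.tp b' (N j) (e j)) (N i) (N j) ∧
          s.restr (s.tp b' (N j) (e j)) (N i) = s.tp b (N i) (Q i) := by
    intro i
    by_cases hi : i < (Order.succ κ).ord
    · have hex : ∀ b : (Q i).carrier, ∃ γ < (Order.succ κ).ord,
          s.tp b (N i) (Q i) ∈ s.Sbs (N i) →
          ∀ j < (Order.succ κ).ord, γ ≤ j → ∃ b' ∈ (e j).carrier,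
          s.DNF (s.tp b' (N j) (e j)) (N i) (N j) ∧
          s.restr (s.tp b' (N j) (e j)) (N i) = s.tp b (N i) (Q i) := by
        intro b
        by_cases hb : s.tp b (N i) (Q i) ∈ s.Sbs (N i)
        · obtain ⟨γ, hγ, hγb⟩ := hR.dense i hi _ hb
          exact ⟨γ, hγ, fun _ => hγb⟩
        · exact ⟨0, h.isSuccLimit_ord.bot_lt, fun h' => absurd h' hb⟩
      choose γ hγ hγb using hex
      obtain ⟨ε, hε, hb⟩ := exists_lt_of_card_le h.inf (hQm i hi).2.le γ hγ
      exact ⟨ε, fun _ => ⟨hε, fun b hbQ hbs j hj hεj =>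
        hγb ⟨b, hbQ⟩ hbs j hj ((hb _).le.trans hεj)⟩⟩
    · exact ⟨0, fun h' => absurd h' hi⟩
  choose Γ hΓ using hΓ
  have hcl : OnClub κ fun δ => (∀ i < δ, F i < δ) ∧ ∀ i < δ, Γ i < δ :=
    OnClub.and ⟨F, hF, fun _ _ _ hc => hc⟩ ⟨Γ, fun i hi => (hΓ i hi).1, fun _ _ _ hc => hc⟩
  obtain ⟨δ, hδ, hlim, ⟨hFδ, hΓδ⟩, hi₀δ⟩ := (hcl.and (onClub_gt hi₀)).exists h.inf
  have hsδ := h.isSuccLimit_ord.succ_lt hδ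
  have hvN := hcon δ hδ
  have hlt : s.lt (N δ) (Q δ) := ⟨hNQ δ hδ, fun he => hvN (by
    rw [he]
    exact h.aec.subset (hQle _ _ hi₀δ.le hδ) hv)⟩
  -- The basic type of `b` over `N δ` is based on some `N α` with `α < δ`, and `b` itself appears at
  -- some `β < δ`. At `i = max α β` both hold, and `δ` lies beyond the threshold `Γ i`.
  obtain ⟨b, hb, hbN, hbs⟩ := h.good.density _ (hR.memN δ hδ) _ (hQm δ hδ) hlt
  obtain ⟨α, hα, hαd⟩ := h.good.local_character δ N hlim hδ
    (hR.incN.mono (Order.succ_le_of_lt hδ)) (fun i hi => hR.memN i (hi.trans_lt hδ)) _ hbs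
  obtain ⟨β, hβ, hbβ⟩ := (mem_limit_iff hQ hlim hδ).1 hb
  have hi : max α β < δ := max_lt hα hβ
  set i := max α β with hidef
  have hiκ := hi.trans hδ
  have hbi : b ∈ (Q i).carrier := h.aec.subset (hQle _ _ (le_max_right α β) hiκ) hbβ
  have hnf : s.nf (N i) (N δ) b (Q δ) :=
    h.nf_base (h.nf_of_dnf (hQm δ hδ) (hNQ δ hδ) hb hαd) (hNle _ _ (le_max_left α β) hiκ)
      (hNle _ _ hi.le hδ) (h.aec.refl _ (hR.memN δ hδ).1)
  have htp : s.tp b (N i) (Q i) = s.tp b (N i) (Q δ) :=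
    h.aec.tp_eq_of_le (hNQ i hiκ) (hQle _ _ hi.le hδ) hbi
  obtain ⟨b', hb', hd', hr'⟩ := (hΓ i hiκ).2 b hbi (by
    rw [htp]
    exact (h.good.nf_basic _ _ _ _ hnf).2.2.2.2.2.2.2.1) δ hδ (hΓδ i hi).le
  have hnf' := h.nf_of_dnf (hR.nf δ hδ).2.1 (hR.lee δ hδ) hb' hd'
  have heq := h.good.uniqueness _ (hR.memN i hiκ) _ (hR.memN δ hδ) (hNle _ _ hi.le hδ) _ hbs _
    (h.good.nf_basic _ _ _ _ hnf').2.2.2.2.2.2.2.2 (dnf_of_nf hnf) hd' (by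
      rw [hr', h.aec.restr_tp (hNle _ _ hi.le hδ), htp])
  -- Some `c`, possibly different from `b`, enters `N (δ + 1)`. By continuity of `Q` it lies in `Q
  -- j` with `j < δ`, so closure under `F` puts it into `N δ` already.
  obtain ⟨c, hc, hcN, hcN'⟩ := hst δ hδ ⟨b, hb, hbN, b', hb', heq⟩
  obtain ⟨j, hj, hcj⟩ := (mem_limit_iff hQ hlim hδ).1 hc
  exact hcN (h.aec.subset (hNle _ _ (hFδ j hj).le hδ) (hFc j (hj.trans hδ) c hcj _ hsδ hcN'))

/-- The unions of two rich sequences over the same base are isomorphic, extending any given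
amalgam of their first members. -/
theorem exists_perm_of_rich (h : s.IsWSFrame κ) {A : Ordinal.{u} → Model L}
    {N e : Bool → Ordinal.{u} → Model L} (hR : ∀ l, s.Rich κ A (N l) (e l)) {M : Bool → Model L}
    (hM : ∀ l, IsUnion (M l) (N l) (Order.succ κ).ord) {P₀ : Model L} (hP₀ : P₀ ∈ s.KC κ)
    {g : Bool → Equiv.Perm ZFSet.{u}} (hgP : ∀ l, s.le (g l • N l 0) P₀)
    (hg : ∀ l, ∀ x ∈ (A 0).carrier, g l x = g false x) :
    ∃ σ : Equiv.Perm ZFSet.{u}, σ • M true = M false ∧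
      (∀ i < (Order.succ κ).ord, ∀ x ∈ (A i).carrier, σ x = x) ∧
      ∀ x ∈ (N true 0).carrier, ∀ y ∈ (N false 0).carrier, g true x = g false y → σ x = y := by
  have hNle : ∀ l i j, i ≤ j → j < (Order.succ κ).ord → s.le (N l i) (N l j) :=
    fun l i j hij hj => (hR l).incN.le h.aec hij hj ((hR l).memN i (hij.trans_lt hj)).1
  refine Exists.elim (h.aec.exists_cohChain (ι := Bool) (ι' := Unit) (θ := (Order.succ κ).ord)
    (src := N) (fun l i j hij hj => h.aec.subset ((hR l).incN.1 i j hij hj))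
    (fun i P τ => P () ∈ s.KC κ ∧ (∀ l, s.le (τ l • N l i) (P ())) ∧
      ∀ l, ∀ x ∈ (A i).carrier, τ l x = τ false x)
    (fun i P τ _ τ' => ∀ l, (∃ b ∈ ((τ l)⁻¹ • P ()).carrier, b ∉ (N l i).carrier ∧
      ∃ b' ∈ (e l i).carrier,
        s.tp b (N l i) ((τ l)⁻¹ • P ()) = s.tp b' (N l i) (e l i)) →
        ∃ b ∈ (P ()).carrier, b ∉ (τ l • N l i).carrier ∧
          b ∈ (τ' l • N l (Order.succ i)).carrier)
    (fun _ => P₀) g ⟨hP₀, hgP, hg⟩ ?_ ?_) ?_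
  · rintro i P τ hi ⟨h1, h2, h3⟩
    have hi' := (Order.lt_succ i).trans hi
    obtain ⟨P', hP', τ', c1, c2, c3, c4, c5⟩ := h.exists_step (fun l => (hR l).nf i hi')
      (fun l => (hR l).memN i hi') (fun l => (hR l).leN i hi') (fun l => (hR l).lee i hi') h1 h2 h3
    exact ⟨fun _ => P', τ', fun _ => c1, c2, ⟨hP', c3, c4⟩, c5⟩
  · intro δ P τ hδ hδκ hc hInv _ _
    refine ⟨h.cohChain_mem_KC hc hδ hδκ fun i hi => (hInv i hi).1, fun l =>
      hc.limit_le h.aec hδ ((hR l).incN.mono (Order.succ_le_of_lt hδκ)) fun i hi =>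
        (hInv i hi).2.1 l, fun l x hx => ?_⟩
    obtain ⟨i, hi, hxi⟩ := (mem_limit_iff (hR false).incA hδ hδκ).1 hx
    have hx' : ∀ l, x ∈ (N l i).carrier := fun l =>
      h.aec.subset ((hR l).leN i (hi.trans hδκ)) hxi
    rw [hc.coh i δ hi (Order.lt_succ δ) l x (hx' l),
      hc.coh i δ hi (Order.lt_succ δ) false x (hx' false), (hInv i hi).2.2 l x hxi]
  · rintro P ⟨τ, hc, hP0, hτ0, hInv, hStep⟩
    -- `G l` is the limit map on the union of `N l`. Surjectivity onto the union of the `P i` is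
    -- checked by pulling `P` back along `G l` and applying `mem_of_rich`.
    choose G hG using fun l => exists_perm_limit (src := N l) (τ := fun i => τ i l)
      (fun i j hij hj => h.aec.subset ((hR l).incN.1 i j hij hj))
      (fun i j hij hj x hx => hc.coh i j hij hj l x hx)
    have hP := hc.chain ()
    obtain ⟨Pt, hPt⟩ := exists_isUnion h.isSuccLimit_ord fun i j hij hj =>
      h.aec.sub_of_le _ _ (hP.1 i j hij hj)
    have hGN : ∀ l, ∀ i < (Order.succ κ).ord, G l • N l i = τ i l • N l i := fun l i hi =>
      smul_congr (hG l i hi)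
    have hcar : ∀ l, (G l • M l).carrier = Pt.carrier := by
      intro l
      apply Set.Subset.antisymm
      · rintro _ ⟨x, hx, rfl⟩
        obtain ⟨i, hi, hxi⟩ := (hM l).mem_iff.1 hx
        refine hPt.mem_iff.2 ⟨i, hi, h.aec.subset ((hInv i hi).2.1 l) ?_⟩
        rw [← hGN l i hi]
        exact mem_smul.2 hxi
      · intro v hv
        obtain ⟨i, hi, hvi⟩ := hPt.mem_iff.1 hv
        have hmem : (G l)⁻¹ v ∈ ((G l)⁻¹ • P i ()).carrier := mem_smul.2 hvi
        have hNQ : ∀ i < (Order.succ κ).ord, s.le (N l i) ((G l)⁻¹ • P i ()) := fun i hi =>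
          h.aec.smul_le_iff.1 (by rw [hGN l i hi]; exact (hInv i hi).2.1 l)
        refine Exists.elim (h.mem_of_rich (hR l) (hP.smul h.aec (G l)⁻¹)
          (fun i hi => h.aec.smul_mem_KC _ (hInv i hi).1) hNQ ?_ hi hmem) ?_
        · rintro i hi ⟨b, hb, hbN, b', hb', ht⟩
          have hsi := h.isSuccLimit_ord.succ_lt hi
          -- The recursion speaks of the pullback along `τ i l`, `mem_of_rich` of that along `G l`.
          -- The two differ by a permutation fixing `N l i`, which preserves types over it.
          have hfix : ∀ x ∈ (N l i).carrier, ((τ i l)⁻¹ * G l) x = x := fun x hx => by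
            rw [Equiv.Perm.mul_apply, hG l i hi x hx, perm_inv_apply]
          have hm : ((τ i l)⁻¹ * G l) • (G l)⁻¹ • P i () = (τ i l)⁻¹ • P i () := by
            rw [mul_smul, smul_inv_smul]
          have hbn : ((τ i l)⁻¹ * G l) b ∉ (N l i).carrier := fun hbn => hbN (by
            rw [← smul_eq_self hfix] at hbn
            exact mem_smul.1 hbn)
          obtain ⟨c, hc1, hc2, hc3⟩ := hStep i hsi l ⟨_, hm ▸ mem_smul.2 hb, hbn, b', hb', by
            rw [← ht, h.aec.tp_smul_of_fix (hNQ i hi) hb hfix, hm]⟩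
          refine ⟨(G l)⁻¹ c, mem_smul.2 hc1, fun hcn => hc2 ?_, ?_⟩
          · rw [← hGN l i hi, ← perm_apply_inv (G l) c]
            exact mem_smul.2 hcn
          · rw [← hGN l _ hsi, ← perm_apply_inv (G l) c] at hc3
            exact mem_smul.1 hc3
        · rintro j ⟨hj, hvj⟩
          have := (mem_smul (σ := G l)).2 ((((hR l).incN.le_union h.aec h.isSuccLimit_ord
            (hM l)).2 j hj |> h.aec.subset) hvj)
          rwa [perm_apply_inv] at this
    have hle : ∀ l, G l • M l = Pt := by
      intro l
      refine h.aec.eq_of_subset ?_ (hcar l).ge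
      refine h.aec.smooth _ _ _ _ h.isSuccLimit_ord ((hR l).incN.smul h.aec (G l))
        ⟨fun i hi => ((hM l).1 i hi).smul (G l), ?_⟩ fun i hi => ?_
      · simp only [carrier_smul, (hM l).2, Set.image_iUnion]
      · rw [hGN l i hi]
        exact h.aec.trans _ _ _ ((hInv i hi).2.1 l)
          ((hP.le_union h.aec h.isSuccLimit_ord hPt).2 i hi)
    have h0 := h.isSuccLimit_ord.bot_lt
    refine ⟨(G false)⁻¹ * G true, ?_, fun i hi x hx => ?_, fun x hx y hy hxy => ?_⟩
    · rw [mul_smul, hle true, ← hle false, inv_smul_smul]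
    · have hx' : ∀ l, x ∈ (N l i).carrier := fun l => h.aec.subset ((hR l).leN i hi) hx
      rw [Equiv.Perm.mul_apply, hG true i hi x (hx' true), (hInv i hi).2.2 true x hx,
        ← hG false i hi x (hx' false), perm_inv_apply]
    · rw [Equiv.Perm.mul_apply, hG true 0 h0 x hx, hτ0, hxy, ← hτ0, ← hG false 0 h0 y hy,
        perm_inv_apply]

end IsWSFrame
end PreFrame
end SemiGood

/-! ### The three isomorphism statements -/

namespace SemiGood
open Model OrderedClass

variable {L : FirstOrder.Language.{u, u}}

namespace PreFrame

variable {s : PreFrame L} {κ : Cardinal.{u}}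

theorem Rich.congr {A A' N e : Ordinal.{u} → Model L} (hR : s.Rich κ A N e)
    (hlim : Order.IsSuccLimit (Order.succ κ).ord)
    (hA : ∀ i < (Order.succ κ).ord, A i = A' i) : s.Rich κ A' N e := by
  refine ⟨⟨fun i j hij hj => ?_, fun δ hδ hδκ => ?_⟩, hR.incN, hR.memN, fun i hi => ?_, hR.lee,
    fun i hi => ?_, hR.dense⟩
  · rw [← hA i (hij.trans hj), ← hA j hj]
    exact hR.incA.1 i j hij hj
  · rw [← hA δ hδκ, hR.incA.2 δ hδ hδκ]
    exact Set.iUnion₂_congr fun i hi => by rw [hA i (lt_trans (Set.mem_Iio.1 hi) hδκ)]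
  · rw [← hA i hi]
    exact hR.leN i hi
  · rw [← hA i hi, ← hA _ (hlim.succ_lt hi)]
    exact hR.nf i hi

namespace IsWSFrame

/-- The two filtrations of `M₀` agree on a club, so one of them can serve for both extensions. The
further club property `q` is left free: it is used to start late enough, and to agree with the
filtrations of `NFHat`. -/
theorem exists_rich_pair (h : s.IsWSFrame κ) {M₀ : Model L} {M : Bool → Model L}
    (hp : ∀ l, s.PrecPlus κ M₀ (M l)) :
    ∃ (c₀ : Ordinal.{u} → Model L) (c e : Bool → Ordinal.{u} → Model L),
      (s.IncCont c₀ (Order.succ κ).ord ∧ IsUnion M₀ c₀ (Order.succ κ).ord ∧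
        ∀ i < (Order.succ κ).ord, #(c₀ i).carrier ≤ Cardinal.lift.{u + 1} κ) ∧
      (∀ l, s.IncCont (c l) (Order.succ κ).ord ∧ IsUnion (M l) (c l) (Order.succ κ).ord ∧
        ∀ i < (Order.succ κ).ord, #(c l i).carrier ≤ Cardinal.lift.{u + 1} κ) ∧
      ∀ q : Ordinal.{u} → Prop, OnClub κ q → ∃ ν, IsEnum κ q ν ∧
        ∀ l, s.Rich κ (fun i => c₀ (ν i)) (fun i => c l (ν i)) (fun i => e l (ν i)) := by
  choose c₀ c e p hc₀ hc hu₀ hu hκ₀ hκ hclub hrich using fun l => h.exists_rich (hp l)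
  have heq := h.onClub_eq (hc₀ true) (hc₀ false) (hκ₀ true) (hκ₀ false) (hu₀ true) (hu₀ false)
  refine ⟨c₀ true, c, e, ⟨hc₀ true, hu₀ true, hκ₀ true⟩, fun l => ⟨hc l, hu l, hκ l⟩,
    fun q hq => ?_⟩
  obtain ⟨ν, hν⟩ := (((hclub true).and (hclub false)).and (heq.and hq)).exists_isEnum h.inf
  refine ⟨ν, hν.imp fun i hi => hi.2.2, ?_⟩
  rintro (_ | _)
  · exact (hrich false ν (hν.imp fun i hi => hi.1.2)).congr h.isSuccLimit_ord fun i hi =>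
      (hν.prop i hi).2.1.symm
  · exact hrich true ν (hν.imp fun i hi => hi.1.1)

theorem exists_iso_of_rich (h : s.IsWSFrame κ) {M₀ : Model L} {M : Bool → Model L}
    {c₀ : Ordinal.{u} → Model L} {c e : Bool → Ordinal.{u} → Model L}
    {ν : Ordinal.{u} → Ordinal.{u}} {q : Ordinal.{u} → Prop}
    (hc₀ : s.IncCont c₀ (Order.succ κ).ord) (hu₀ : IsUnion M₀ c₀ (Order.succ κ).ord)
    (hc : ∀ l, s.IncCont (c l) (Order.succ κ).ord)
    (hu : ∀ l, IsUnion (M l) (c l) (Order.succ κ).ord) (hν : IsEnum κ q ν)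
    (hR : ∀ l, s.Rich κ (fun i => c₀ (ν i)) (fun i => c l (ν i)) (fun i => e l (ν i)))
    {P : Model L} (hP : P ∈ s.KC κ) {σ : Equiv.Perm ZFSet.{u}}
    (h1 : s.le (σ • c true (ν 0)) P) (h2 : s.le (c false (ν 0)) P)
    (hσ : ∀ x ∈ (c₀ (ν 0)).carrier, σ x = x) :
    ∃ f : Iso (M true) (M false), Over f M₀.carrier ∧ ∀ x : (M true).carrier,
      (x : ZFSet.{u}) ∈ (c true (ν 0)).carrier → σ x ∈ (c false (ν 0)).carrier →
      (f x : ZFSet.{u}) = σ x := by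
  obtain ⟨ρ, hρ, hρA, hρN⟩ := h.exists_perm_of_rich hR (fun l => hν.isUnion h.aec (hc l) (hu l)) hP
    (g := fun l => cond l σ 1) (by
      rintro (_ | _)
      · simpa using h2
      · exact h1) (by
      rintro (_ | _) x hx
      · rfl
      · exact hσ x hx)
  obtain ⟨f, hf⟩ := exists_iso hρ
  refine ⟨f, fun x hx => ?_, fun x hx hx' => ?_⟩
  · obtain ⟨i, hi, hxi⟩ := (hν.isUnion h.aec hc₀ hu₀).mem_iff.1 hx
    rw [hf, hρA i hi x hxi]
  · rw [hf]
    exact hρN x hx (σ x) hx' rfl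

theorem exists_iso_over (h : s.IsWSFrame κ) {M₀ : Model L} {M : Bool → Model L}
    (hp : ∀ l, s.PrecPlus κ M₀ (M l)) :
    ∃ f : Iso (M true) (M false), Over f M₀.carrier := by
  obtain ⟨c₀, c, e, ⟨hc₀, hu₀, -⟩, hc, hall⟩ := h.exists_rich_pair hp
  have h0 := h.isSuccLimit_ord.bot_lt
  obtain ⟨ν, hν, hR⟩ := hall _ (onClub_gt h0)
  obtain ⟨P, hP, σ, h1, h2, h3⟩ := h.amalg 1 ((hR true).nf 0 h0).1 ((hR true).memN 0 h0)
    ((hR false).memN 0 h0) ((hR true).leN 0 h0) (by rw [one_smul]; exact (hR false).leN 0 h0)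
  obtain ⟨f, hf, -⟩ := h.exists_iso_of_rich hc₀ hu₀ (fun l => (hc l).1) (fun l => (hc l).2.1) hν hR
    hP h2 h3 h1
  exact ⟨f, hf⟩

theorem exists_iso_of_tp_eq (h : s.IsWSFrame κ) {M₀ : Model L} {M : Bool → Model L}
    (hp : ∀ l, s.PrecPlus κ M₀ (M l)) (a : ∀ l, (M l).carrier)
    (ha : ∀ N ∈ s.KC κ, s.le N M₀ → s.tp (a true) N (M true) = s.tp (a false) N (M false)) :
    ∃ f : Iso (M true) (M false), Over f M₀.carrier ∧ f (a true) = a false := by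
  obtain ⟨c₀, c, e, ⟨hc₀, hu₀, -⟩, hc, hall⟩ := h.exists_rich_pair hp
  have h0 := h.isSuccLimit_ord.bot_lt
  choose i hi hai using fun l => (hc l).2.1.mem_iff.1 (a l).2
  obtain ⟨ν, hν, hR⟩ := hall _ ((onClub_gt (hi true)).and (onClub_gt (hi false)))
  have hν0 := hν.lt 0 h0
  have haν : ∀ l, (a l : ZFSet.{u}) ∈ (c l (ν 0)).carrier := by
    rintro (_ | _)
    · exact h.aec.subset ((hc _).1.1 _ _ (hν.prop 0 h0).2 hν0) (hai _)
    · exact h.aec.subset ((hc _).1.1 _ _ (hν.prop 0 h0).1 hν0) (hai _)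
  have hcM : ∀ l, s.le (c l (ν 0)) (M l) := fun l =>
    ((hc l).1.le_union h.aec h.isSuccLimit_ord (hc l).2.1).2 _ hν0
  have hA := ((hR true).nf 0 h0).1
  -- Both elements lie in the first members, so equality of their types over `c₀ (ν 0)` gives a
  -- starting amalgam that identifies them.
  obtain ⟨P, hP, σ, h1, h2, h3, h4⟩ := h.tp_amalg
    (ha _ hA ((hc₀.le_union h.aec h.isSuccLimit_ord hu₀).2 _ hν0)) hA ((hR true).memN 0 h0)
    ((hR false).memN 0 h0) ((hR true).leN 0 h0) (hcM true) (haν true) ((hR false).leN 0 h0)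
    (hcM false) (haν false)
  obtain ⟨f, hf, hf'⟩ := h.exists_iso_of_rich hc₀ hu₀ (fun l => (hc l).1) (fun l => (hc l).2.1) hν
    hR hP h3 h4 h1
  exact ⟨f, hf, Subtype.ext ((hf' _ (haν true) (by rw [h2]; exact haν false)).trans h2)⟩

theorem exists_iso_of_NFHat (h : s.IsWSFrame κ) {M₀ N₀ Nstar : Model L} {M : Bool → Model L}
    (hp : ∀ l, s.PrecPlus κ M₀ (M l)) (hn : ∀ l, s.NFHat κ N₀ Nstar M₀ (M l)) :
    ∃ f : Iso (M true) (M false), Over f (M₀.carrier ∪ Nstar.carrier) := by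
  obtain ⟨c₀, c, e, ⟨hc₀, hu₀, hκ₀⟩, hc, hall⟩ := h.exists_rich_pair hp
  have h0 := h.isSuccLimit_ord.bot_lt
  choose _ _ _ _ d₀ d hd₀ hd hNF hd00 hd0 hv₀ hv using hn
  have hq : ∀ l, OnClub κ fun δ => c₀ δ = d₀ l δ ∧ c l δ = d l δ := fun l =>
    (h.onClub_eq hc₀ (hd₀ l) hκ₀ (fun i hi => (hNF l i hi).1.2.le) hu₀ (hv₀ l)).and
      (h.onClub_eq (hc l).1 (hd l) (hc l).2.2 (fun i hi => (hNF l i hi).2.1.2.le) (hc l).2.1 (hv l))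
  obtain ⟨ν, hν, hR⟩ := hall _ ((hq true).and (hq false))
  have hν0 := hν.lt 0 h0
  have hsν := h.isSuccLimit_ord.succ_lt hν0
  have hcd : ∀ l, c₀ (ν 0) = d₀ l (ν 0) ∧ c l (ν 0) = d l (ν 0) := by
    rintro (_ | _)
    exacts [(hν.prop 0 h0).2, (hν.prop 0 h0).1]
  -- Long transitivity along the filtrations of `NFHat` from `0` to `ν 0`, where they agree with the
  -- rich ones.
  have hNF0 : ∀ l, s.NF κ N₀ Nstar (c₀ (ν 0)) (c l (ν 0)) := fun l => by
    rw [(hcd l).1, (hcd l).2, ← hd00 l, ← hd0 l]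
    exact h.NF_chain hν0 ((hd₀ l).mono hsν.le) ((hd l).mono hsν.le)
      (fun i hi => (hNF l i (hi.trans_lt hν0)).1) (fun i hi => (hNF l i (hi.trans_lt hν0)).2.1)
      (fun i hi => (hNF l i (hi.trans_lt hν0)).2.2.2.2.1) fun i hi => hNF l i (hi.trans hν0)
  -- Weak uniqueness yields a starting amalgam of the first members over both `N*` and `c₀ (ν 0)`.
  obtain ⟨P, hP, σ, h1, h2, h3, h4⟩ := h.NF_unique (g₁ := 1) (g₂ := 1) (hNF0 true)
    (by simpa only [one_smul] using hNF0 false) fun _ _ => rfl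
  obtain ⟨f, hf, hf'⟩ := h.exists_iso_of_rich hc₀ hu₀ (fun l => (hc l).1) (fun l => (hc l).2.1) hν
    hR hP h2 h1 h4
  have hNc : ∀ l, Nstar.carrier ⊆ (c l (ν 0)).carrier := fun l =>
    h.aec.subset (hNF0 l).2.2.2.2.2.1
  refine ⟨f, fun x hx => ?_⟩
  rcases hx with hx | hx
  · exact hf x hx
  · rw [hf' x (hNc true hx) (by rw [h3 _ hx]; exact hNc false hx), h3 _ hx]
    rfl

end IsWSFrame
end PreFrame
end SemiGood

theorem theorem7p13 {L : FirstOrder.Language.{u, u}} (s : SemiGood.PreFrame L)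
    (κ : Cardinal.{u}) (hκ : ℵ₀ ≤ κ) (hs : s.IsSemiGood κ)
    (hconj : s.HasConjugation κ) (hws : s.WeaklySuccessful κ)
    (M₀ M₁ M₂ : SemiGood.Model L) (h₁ : s.PrecPlus κ M₀ M₁) (h₂ : s.PrecPlus κ M₀ M₂) :
    (∃ f : SemiGood.Iso M₁ M₂, SemiGood.Over f M₀.carrier) ∧
    (∀ (a₁ : M₁.carrier) (a₂ : M₂.carrier),
      (∀ N ∈ s.KC κ, s.le N M₀ → s.tp a₁ N M₁ = s.tp a₂ N M₂) →
      ∃ f : SemiGood.Iso M₁ M₂, SemiGood.Over f M₀.carrier ∧ f a₁ = a₂) ∧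
    (∀ N₀ ∈ s.KC κ, ∀ Nstar ∈ s.KC κ, s.le N₀ Nstar →
      s.NFHat κ N₀ Nstar M₀ M₁ → s.NFHat κ N₀ Nstar M₀ M₂ →
      ∃ f : SemiGood.Iso M₁ M₂, SemiGood.Over f (M₀.carrier ∪ Nstar.carrier)) := by
  have h : s.IsWSFrame κ := ⟨hκ, hs, hws⟩
  have hp : ∀ l : Bool, s.PrecPlus κ M₀ (cond l M₁ M₂) := by
    rintro (_ | _)
    exacts [h₂, h₁]
  refine ⟨h.exists_iso_over hp, fun a₁ a₂ ha => ?_, fun N₀ _ Nstar _ _ hn₁ hn₂ => ?_⟩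
  · exact h.exists_iso_of_tp_eq hp (fun l => match l with | true => a₁ | false => a₂) ha
  · refine h.exists_iso_of_NFHat (N₀ := N₀) (M := fun l => cond l M₁ M₂) hp ?_
    rintro (_ | _)
    exacts [hn₂, hn₁]
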